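/- Let $n\ge 2$. A proper subdomain of $\mathbb{R}^n$ is a nonempty open connected set $D\subsetneq\mathbb{R}^n$; it is called Apollonian if $\mathbb{R}^n\setminus D$ is not contained in a hyperplane. All paths and arcs are rectifiable, $\ell$ denotes Euclidean length, and an arc is an injective path or, if its endpoints coincide, a single point. For an arc $\gamma$ and points $z,w$ on it, $\gamma[z,w]$ is the part of $\gamma$ between $z$ and $w$. For $x,y\in D$ let $d_D(x)$ be the distance from $x$ to $\partial D$, and put $$\lambda_D(x,y)=\inf_\gamma \ell(\gamma),\qquad \varrho_D(x,y)=\inf_\gamma\operatorname{diam}(\gamma),\qquad k_D(x,y)=\inf_\gamma\int_\gamma\frac{|dz|}{d_D(z)},$$ where the infima are over all paths (for $\varrho_D$: all arcs) $\gamma$ joining $x$ and $y$ in $D$, and $$j'_D(x,y)=\log\Big(1+\frac{\varrho_D(x,y)}{\min\{d_D(x),d_D(y)\}}\Big),\qquad \alpha_D(x,y)=\sup_{a,b}\log\frac{|a-x|\,|b-y|}{|a-y|\,|b-x|},$$ where $a,b$ range over the boundary of $D$ in $\mathbb{R}^n\cup\{\infty\}$ and $\frac{|\infty-x|}{|\infty-y|}=1$.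 Let $\widetilde\alpha_D(x,y)=\inf_\gamma\alpha_D(\gamma)$ over all paths $\gamma:[0,1]\to D$ joining $x$ and $y$ in $D$, where $\alpha_D(\gamma)$ is the supremum of $\sum_{i<k}\alpha_D(\gamma(t_i),\gamma(t_{i+1}))$ over all partitions $0=t_0<\dots<t_k=1$. **Theorem.** For an Apollonian proper subdomain $D$ of $\mathbb{R}^n$ the following conditions are quantitatively equivalent. 1. ($D$ is inner $c$-uniform.) Any $x,y\in D$ can be joined by an arc $\gamma$ in $D$ with $\min\{\ell(\gamma[x,w]),\ell(\gamma[y,w])\}\le c\,d_D(w)$ for all $w\in\gamma$ and $\ell(\gamma)\le c\,\lambda_D(x,y)$. 2. $k_D(x,y)\le c_1\,j'_D(x,y)$ for all $x,y\in D$. 3. $\widetilde\alpha_D(x,y)\le c_2\,j'_D(x,y)$ for all $x,y\in D$. 4. Any $x,y\in D$ can be joined by an arc $\gamma$ in $D$ with $\min\{\operatorname{diam}\gamma[x,w],\operatorname{diam}\gamma[y,w]\}\le c_3\,d_D(w)$ for all $w\in\gamma$ and $\operatorname{diam}\gamma\le c_3\,\varrho_D(x,y)$. That is: for any two of these conditions,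 (P) and (Q), and every constant $c>1$ there is a constant $c'>1$, depending only on $c$, $n$ and the choice of (P) and (Q), such that every Apollonian proper subdomain $D$ of $\mathbb{R}^n$ satisfying (P) with constant $c$ satisfies (Q) with constant $c'$. -/

import Mathlib

open Set MeasureTheory
open scoped ENNReal

namespace InnerUniform

noncomputable section

/-- A proper subdomain of `ℝⁿ`: a nonempty, open, connected set which is not all of `ℝⁿ`. -/
def IsProperDomain {n : ℕ} (D : Set (EuclideanSpace ℝ (Fin n))) : Prop :=
  IsOpen D ∧ IsConnected D ∧ D ≠ univ

/-- The complement of `D` is not contained in any hyperplane `{p | ⟪v, p⟫ = b}`, `v ≠ 0`. -/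
def IsApollonian {n : ℕ} (D : Set (EuclideanSpace ℝ (Fin n))) : Prop :=
  ¬ ∃ (v : EuclideanSpace ℝ (Fin n)) (b : ℝ), v ≠ 0 ∧ Dᶜ ⊆ {p | inner ℝ v p = b}

/-- `d_D(z)`, the distance from `z` to the boundary of `D` in `ℝⁿ`. -/
def bdist {n : ℕ} (D : Set (EuclideanSpace ℝ (Fin n))) (z : EuclideanSpace ℝ (Fin n)) : ℝ :=
  Metric.infDist z (frontier D)

/-! ### Paths and arcs -/

/-- `γ`, restricted to `[0,1]`, is a rectifiable path in `D` from `x` to `y`. -/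
structure IsPathIn {n : ℕ} (D : Set (EuclideanSpace ℝ (Fin n)))
    (x y : EuclideanSpace ℝ (Fin n)) (γ : ℝ → EuclideanSpace ℝ (Fin n)) : Prop where
  continuousOn : ContinuousOn γ (Icc 0 1)
  rectifiable : BoundedVariationOn γ (Icc 0 1)
  mapsTo : MapsTo γ (Icc 0 1) D
  source : γ 0 = x
  target : γ 1 = y

/-- `γ`, restricted to `[0,1]`, is a rectifiable arc in `D` from `x` to `y`: an injective path, or,
when `x = y`, the degenerate arc consisting of the point `x` only. -/
structure IsArcIn {n : ℕ} (D : Set (EuclideanSpace ℝ (Fin n)))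
    (x y : EuclideanSpace ℝ (Fin n)) (γ : ℝ → EuclideanSpace ℝ (Fin n)) : Prop
    extends IsPathIn D x y γ where
  injOn_or_const : InjOn γ (Icc 0 1) ∨ ∀ t ∈ Icc (0 : ℝ) 1, γ t = x

/-- The `d`-length of `γ` on `[0,1]`: the supremum of `∑ d(γ(tᵢ), γ(tᵢ₊₁))` over all partitions
`0 = t₀ < t₁ < ⋯ < t_k = 1`. -/
def dLength {n : ℕ} (d : EuclideanSpace ℝ (Fin n) → EuclideanSpace ℝ (Fin n) → ℝ)
    (γ : ℝ → EuclideanSpace ℝ (Fin n)) : ℝ≥0∞ :=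
  ⨆ (k : ℕ) (t : ℕ → ℝ) (_ : t 0 = 0 ∧ t k = 1 ∧ ∀ i < k, t i < t (i + 1)),
    ∑ i ∈ Finset.range k, ENNReal.ofReal (d (γ (t i)) (γ (t (i + 1))))

/-- The inner metric of `d` in `D`: the infimum of the `d`-lengths of the rectifiable paths
joining `x` and `y` in `D`. -/
def innerMetric {n : ℕ} (D : Set (EuclideanSpace ℝ (Fin n)))
    (d : EuclideanSpace ℝ (Fin n) → EuclideanSpace ℝ (Fin n) → ℝ)
    (x y : EuclideanSpace ℝ (Fin n)) : ℝ≥0∞ :=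
  ⨅ (γ : ℝ → EuclideanSpace ℝ (Fin n)) (_ : IsPathIn D x y γ), dLength d γ

/-- `λ_D`, the inner length metric: the infimum of the Euclidean lengths of the rectifiable paths
joining `x` and `y` in `D`. -/
def innerLength {n : ℕ} (D : Set (EuclideanSpace ℝ (Fin n)))
    (x y : EuclideanSpace ℝ (Fin n)) : ℝ≥0∞ :=
  ⨅ (γ : ℝ → EuclideanSpace ℝ (Fin n)) (_ : IsPathIn D x y γ), eVariationOn γ (Icc 0 1)

/-- `ϱ_D`, the inner diameter metric: the infimum of the diameters of the arcs joining `x` and `y`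
in `D`. -/
def innerDiam {n : ℕ} (D : Set (EuclideanSpace ℝ (Fin n)))
    (x y : EuclideanSpace ℝ (Fin n)) : ℝ :=
  sInf {r | ∃ γ : ℝ → EuclideanSpace ℝ (Fin n),
    IsArcIn D x y γ ∧ r = Metric.diam (γ '' Icc 0 1)}

/-- `j'_D(x,y) = log (1 + ϱ_D(x,y) / min (d_D(x), d_D(y)))`. -/
def jPrime {n : ℕ} (D : Set (EuclideanSpace ℝ (Fin n)))
    (x y : EuclideanSpace ℝ (Fin n)) : ℝ :=
  Real.log (1 + innerDiam D x y / min (bdist D x) (bdist D y))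

/-! ### The quasihyperbolic metric -/

/-- The integral `∫_γ ρ |dz|` with respect to arc length of a nonnegative function along a
rectifiable path, computed in the parametrization of `γ` by arc length. -/
def arcIntegral {n : ℕ} (ρ : EuclideanSpace ℝ (Fin n) → ℝ≥0∞)
    (γ : ℝ → EuclideanSpace ℝ (Fin n)) : ℝ≥0∞ :=
  ∫⁻ s in Icc 0 (eVariationOn γ (Icc 0 1)).toReal, ρ (naturalParameterization γ (Icc 0 1) 0 s)

/-- `k_D`, the quasihyperbolic metric. -/
def quasihyperbolic {n : ℕ} (D : Set (EuclideanSpace ℝ (Fin n)))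
    (x y : EuclideanSpace ℝ (Fin n)) : ℝ≥0∞ :=
  ⨅ (γ : ℝ → EuclideanSpace ℝ (Fin n)) (_ : IsPathIn D x y γ),
    arcIntegral (fun z => ENNReal.ofReal (1 / bdist D z)) γ

/-! ### The Apollonian metric -/

/-- The boundary of `D` in the one-point compactification of `ℝⁿ`
(so it contains `∞` exactly when `D` is unbounded). -/
def extBoundary {n : ℕ} (D : Set (EuclideanSpace ℝ (Fin n))) :
    Set (OnePoint (EuclideanSpace ℝ (Fin n))) :=
  frontier ((OnePoint.some : EuclideanSpace ℝ (Fin n) → OnePoint (EuclideanSpace ℝ (Fin n))) '' D)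

/-- The quotient `|a - x| / |a - y|`, equal to `1` for `a = ∞`. -/
def ratio {n : ℕ} (a : OnePoint (EuclideanSpace ℝ (Fin n)))
    (x y : EuclideanSpace ℝ (Fin n)) : ℝ :=
  a.elim 1 (fun p => dist p x / dist p y)

/-- The Apollonian metric `α_D(x,y) = sup log (|a - x| |b - y| / (|a - y| |b - x|))`, the supremum
being over all boundary points `a`, `b` of `D`, including `∞` if `D` is unbounded. -/
def apollonian {n : ℕ} (D : Set (EuclideanSpace ℝ (Fin n)))
    (x y : EuclideanSpace ℝ (Fin n)) : ℝ :=
  sSup {r | ∃ a ∈ extBoundary D, ∃ b ∈ extBoundary D, r = Real.log (ratio a x y * ratio b y x)}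

/-- `α̃_D`, the Apollonian inner metric. -/
def apollonianInner {n : ℕ} (D : Set (EuclideanSpace ℝ (Fin n)))
    (x y : EuclideanSpace ℝ (Fin n)) : ℝ≥0∞ :=
  innerMetric D (apollonian D) x y

/-! ### The four conditions -/

/-- `D` is inner `c`-uniform. For `z = γ t` the subarcs `γ[x,z]` and `γ[y,z]` are the restrictions
of `γ` to `[0,t]` and to `[t,1]`. -/
def IsInnerUniform {n : ℕ} (D : Set (EuclideanSpace ℝ (Fin n))) (c : ℝ) : Prop :=
  ∀ x ∈ D, ∀ y ∈ D, ∃ γ : ℝ → EuclideanSpace ℝ (Fin n), IsArcIn D x y γ ∧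
    (∀ t ∈ Icc (0 : ℝ) 1,
      min (eVariationOn γ (Icc 0 t)) (eVariationOn γ (Icc t 1)) ≤
        ENNReal.ofReal (c * bdist D (γ t))) ∧
    eVariationOn γ (Icc 0 1) ≤ ENNReal.ofReal c * innerLength D x y

/-- `k_D ≤ c j'_D`. -/
def QuasihyperbolicLeJPrime {n : ℕ} (D : Set (EuclideanSpace ℝ (Fin n))) (c : ℝ) : Prop :=
  ∀ x ∈ D, ∀ y ∈ D, quasihyperbolic D x y ≤ ENNReal.ofReal (c * jPrime D x y)

/-- `α̃_D ≤ c j'_D`. -/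
def ApollonianInnerLeJPrime {n : ℕ} (D : Set (EuclideanSpace ℝ (Fin n))) (c : ℝ) : Prop :=
  ∀ x ∈ D, ∀ y ∈ D, apollonianInner D x y ≤ ENNReal.ofReal (c * jPrime D x y)

/-- Inner uniformity with constant `c` in terms of diameters instead of lengths. -/
def IsDiamInnerUniform {n : ℕ} (D : Set (EuclideanSpace ℝ (Fin n))) (c : ℝ) : Prop :=
  ∀ x ∈ D, ∀ y ∈ D, ∃ γ : ℝ → EuclideanSpace ℝ (Fin n), IsArcIn D x y γ ∧
    (∀ t ∈ Icc (0 : ℝ) 1,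
      min (Metric.diam (γ '' Icc 0 t)) (Metric.diam (γ '' Icc t 1)) ≤ c * bdist D (γ t)) ∧
    Metric.diam (γ '' Icc 0 1) ≤ c * innerDiam D x y

end

end InnerUniform

open InnerUniform

/-! All four conditions are compared with one combinatorial condition. Two points of D are close
(`Step`) if their distance is at most half the distance of either of them to the boundary. Chains of
close points are a discrete form of quasihyperbolic geodesics, and `ChainBound` asks for chains with
at most A(j' + 1) steps. The additive 1 is harmless: close points are joined by a segment, and for
points that are not close j' is bounded below by an absolute constant.

Conditions imply chains. A path is cut wherever a monotone function Φ along it has grown by a fixed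
amount (`hasChain_of_monotoneOn`). For k, Φ is the quasihyperbolic length, and a piece of small
growth lies in a small ball. For the Apollonian inner metric, Φ is the Apollonian length, and growth
below log 2 keeps distances to the boundary comparable. For the diameter condition the arc is
halved, and on each half Φ is the logarithm of a constant plus the diameter of the piece already
traversed. In the last two cases a piece stays at distance at least some r from the boundary and
within a multiple of r of its start. By packing (`exists_hasChain_of_dist_le`) boundedly many steps
then suffice, because every other member of a shortest chain along the piece gives a separated set.
An inner uniform domain is brought to the diameter condition by showing that the inner length metric
is at most a constant times the inner diameter metric (`exists_innerLength_le_innerDiam`).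

Chains imply conditions. For k and the Apollonian inner metric, the polygonal path through a chain
has length at most a constant times the sum of the relative step sizes. For the two arc conditions a
shortest chain is used. Its subchains are again shortest, so `ChainBound` applies to any two
members, and the distances d_i of the members to the boundary form a sequence on which the number of
steps is logarithmic in the relative size of the sum (`IsTame`). Such a sequence has no long
plateaus, hence no deep dips below later larger terms, hence it grows geometrically up to its
maximum and decays geometrically after it. So the part of the chain on the shorter side has length
at most a multiple of the current d_i, which is the cigar condition. Unless the end points are
close, the maximum of d_i is at most a multiple of the inner diameter distance
(`exists_bdist_le_innerDiam`). The arc obtained from the chain therefore has length, and not only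
diameter, controlled by that distance, which gives both arc conditions at once. -/

namespace InnerUniform

/-! ### Chains of a relation -/

/-- `p 0, …, p m` is a chain from `x` to `y` for the relation `R`. -/
structure IsChainSeq {X : Type*} (R : X → X → Prop) (m : ℕ) (x y : X) (p : ℕ → X) : Prop where
  source : p 0 = x
  target : p m = y
  step : ∀ i < m, R (p i) (p (i + 1))

/-- `x` and `y` are joined by a chain of `m` steps. -/
def HasChain {X : Type*} (R : X → X → Prop) (m : ℕ) (x y : X) : Prop :=
  ∃ p : ℕ → X, IsChainSeq R m x y p

section Chains

variable {X : Type*} {R R' : X → X → Prop} {m m' : ℕ} {x y z : X} {p : ℕ → X}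

lemma HasChain.single (h : R x y) : HasChain R 1 x y :=
  ⟨fun i => if i = 0 then x else y, by simp, by simp, by
    intro i hi
    obtain rfl : i = 0 := by omega
    simpa using h⟩

lemma HasChain.trans (h : HasChain R m x y) (h' : HasChain R m' y z) :
    HasChain R (m + m') x z := by
  obtain ⟨p, hp0, hpm, hp⟩ := h
  obtain ⟨q, hq0, hqm, hq⟩ := h'
  refine ⟨fun i => if i ≤ m then p i else q (i - m), by simpa using hp0, ?_, ?_⟩
  · rcases Nat.eq_zero_or_pos m' with rfl | h
    · simp [hpm, ← hqm, hq0]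
    · simp [show ¬ (m + m' ≤ m) by omega, hqm]
  · intro i hi
    rcases lt_trichotomy i m with h | rfl | h
    · simpa [h.le, Nat.succ_le_of_lt h] using hp i h
    · have := hq 0 (by omega)
      simpa [hpm, ← hq0] using this
    · have := hq (i - m) (by omega)
      rw [show i - m + 1 = i + 1 - m by omega] at this
      simpa [show ¬ i ≤ m by omega, show ¬ i + 1 ≤ m by omega] using this

lemma HasChain.imp (h : HasChain R m x y) (hR : ∀ u v, R u v → R' u v) : HasChain R' m x y := by
  obtain ⟨p, hp0, hpm, hp⟩ := h
  exact ⟨p, hp0, hpm, fun i hi => hR _ _ (hp i hi)⟩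

lemma IsChainSeq.reverse (hR : ∀ u v, R u v → R v u) (h : IsChainSeq R m x y p) :
    IsChainSeq R m y x (fun i => p (m - i)) := by
  obtain ⟨hp0, hpm, hp⟩ := h
  refine ⟨by simpa using hpm, by simpa using hp0, ?_⟩
  intro i hi
  have := hp (m - (i + 1)) (by omega)
  rw [show m - (i + 1) + 1 = m - i by omega] at this
  exact hR _ _ this

lemma HasChain.symm (hR : ∀ u v, R u v → R v u) (h : HasChain R m x y) : HasChain R m y x := by
  obtain ⟨p, hp⟩ := h
  exact ⟨_, hp.reverse hR⟩

lemma HasChain.mono (hR : R y y) (h : HasChain R m x y) (hm : m ≤ m') : HasChain R m' x y := by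
  induction m', hm using Nat.le_induction with
  | base => exact h
  | succ k _ ih => exact ih.trans (.single hR)

lemma IsChainSeq.sub (h : IsChainSeq R m x y p) {i j : ℕ} (hij : i ≤ j) (hj : j ≤ m) :
    IsChainSeq R (j - i) (p i) (p j) (fun k => p (i + k)) := by
  refine ⟨by simp, by simp [show i + (j - i) = j by omega], ?_⟩
  intro k hk
  exact h.step (i + k) (by omega)

/-- A chain which is as short as possible from `x` to `y` is as short as possible between any two
of its members. -/
lemma IsChainSeq.sub_le_of_minimal (h : IsChainSeq R m x y p)
    (hmin : ∀ k, HasChain R k x y → m ≤ k) {i j k : ℕ} (hij : i ≤ j) (hj : j ≤ m)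
    (hk : HasChain R k (p i) (p j)) : j - i ≤ k := by
  have h1 : HasChain R (i - 0) x (p i) := by
    have := h.sub (Nat.zero_le i) (hij.trans hj)
    rw [h.source] at this
    exact ⟨_, this⟩
  have h2 : HasChain R (m - j) (p j) y := by
    have := h.sub hj le_rfl
    rw [h.target] at this
    exact ⟨_, this⟩
  have := hmin _ ((h1.trans hk).trans h2)
  omega

lemma HasChain.exists_minimal (h : HasChain R m x y) :
    ∃ k p, k ≤ m ∧ IsChainSeq R k x y p ∧ ∀ l, HasChain R l x y → k ≤ l := by
  classical
  have hex : ∃ k, HasChain R k x y := ⟨m, h⟩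
  obtain ⟨p, hp⟩ := Nat.find_spec hex
  exact ⟨Nat.find hex, p, Nat.find_min' hex h, hp, fun l hl => Nat.find_min' hex hl⟩

/-- In a shortest chain, members whose indices differ by at least two are not related. -/
lemma IsChainSeq.not_rel_of_minimal (h : IsChainSeq R m x y p)
    (hmin : ∀ k, HasChain R k x y → m ≤ k) {i j : ℕ} (hij : i + 2 ≤ j) (hj : j ≤ m) :
    ¬ R (p i) (p j) := by
  intro hR
  have := h.sub_le_of_minimal hmin (by omega) hj (HasChain.single hR)
  omega

end Chains

/-- A packing bound: a totally bounded set contains only boundedly many pairwise `r`-separated points. -/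
lemma exists_card_le_of_separated {X : Type*} [PseudoMetricSpace X] {K : Set X}
    (hK : TotallyBounded K) {r : ℝ} (hr : 0 < r) :
    ∃ M : ℕ, ∀ (m : ℕ) (f : ℕ → X), (∀ i < m, f i ∈ K) →
      (∀ i < m, ∀ j < m, i < j → r ≤ dist (f i) (f j)) → m ≤ M := by
  obtain ⟨t, ht, hKt⟩ := Metric.totallyBounded_iff.1 hK (r / 2) (by positivity)
  refine ⟨ht.toFinset.card, fun m f hf hsep => ?_⟩
  have h1 : ∀ i, ∃ c, i < m → c ∈ t ∧ dist (f i) c < r / 2 := by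
    intro i
    by_cases hi : i < m
    · have := hKt (hf i hi)
      simp only [mem_iUnion, Metric.mem_ball, exists_prop] at this
      obtain ⟨c, hc, hd⟩ := this
      exact ⟨c, fun _ => ⟨hc, hd⟩⟩
    · exact ⟨f i, fun h => absurd h hi⟩
  choose c hc using h1
  rw [← Finset.card_range m]
  refine Finset.card_le_card_of_injOn c (fun i hi => ?_) ?_
  · simpa using (hc i (by simpa using hi)).1
  · intro i hi j hj hij
    have hi' : i < m := by simpa using hi
    have hj' : j < m := by simpa using hj
    by_contra hne
    have key : ∀ a < m, ∀ b < m, a < b → c a = c b → False := by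
      intro a ha b hb hab hcab
      have h2 := hsep a ha b hb hab
      have h3 := (hc a ha).2
      have h4 := (hc b hb).2
      have h5 := dist_triangle_right (f a) (f b) (c a)
      rw [← hcab] at h4
      linarith
    rcases lt_or_gt_of_ne hne with h | h
    · exact key i hi' j hj' h hij
    · exact key j hj' i hi' h hij.symm

/-- Scale-invariant packing bound in a proper normed space. -/
lemma exists_card_le_of_separated_ball (E : Type*) [NormedAddCommGroup E] [NormedSpace ℝ E]
    [ProperSpace E] (A : ℝ) :
    ∃ M : ℕ, ∀ (r : ℝ), 0 < r → ∀ (m : ℕ) (f : ℕ → E) (x : E), (∀ i < m, dist (f i) x ≤ A * r) →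
      (∀ i < m, ∀ j < m, i < j → r ≤ dist (f i) (f j)) → m ≤ M := by
  obtain ⟨M, hM⟩ := exists_card_le_of_separated
    (isCompact_closedBall (0 : E) A).totallyBounded zero_lt_one
  refine ⟨M, fun r hr m f x hf hsep => hM m (fun i => r⁻¹ • (f i - x)) ?_ ?_⟩
  · intro i hi
    have := hf i hi
    rw [mem_closedBall_zero_iff, norm_smul, ← dist_eq_norm, Real.norm_of_nonneg (by positivity),
      inv_mul_le_iff₀ hr]
    linarith
  · intro i hi j hj hij
    have := hsep i hi j hj hij
    rw [dist_smul₀, dist_sub_right, Real.norm_of_nonneg (by positivity), le_inv_mul_iff₀ hr]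
    linarith

/-! ### Subdividing a path -/

/-- If `Φ` is monotone and the members of `γ` on any interval on which `Φ` grows by less than `δ`
are joined by chains of length `M`, then the ends of `γ` are joined by a chain whose length is
controlled by the growth of `Φ`. -/
lemma hasChain_of_monotoneOn {X : Type*} {R : X → X → Prop} {γ : ℝ → X} {Φ : ℝ → ℝ} {b δ : ℝ}
    {M : ℕ} (hδ : 0 < δ)
    (hrefl : ∀ t ≤ b, 0 ≤ t → R (γ t) (γ t))
    (hloc : ∀ t ∈ Icc 0 b, ∃ ε > 0, ∀ s ∈ Icc 0 b, |s - t| < ε → R (γ s) (γ t) ∧ R (γ t) (γ s))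
    (hΦ : MonotoneOn Φ (Icc 0 b))
    (h : ∀ s t, 0 ≤ s → s ≤ t → t ≤ b → Φ t - Φ s < δ → HasChain R M (γ s) (γ t)) (k : ℕ) :
    ∀ a, 0 ≤ a → a ≤ b → Φ b - Φ a < k * δ → HasChain R (k * (M + 2)) (γ a) (γ b) := by
  induction k with
  | zero =>
    intro a ha hab hk
    have := hΦ ⟨ha, hab⟩ ⟨ha.trans hab, le_rfl⟩ hab
    simp at hk
    linarith
  | succ k ih =>
    intro a ha hab hk
    -- Φ may jump, so the supremum s of S need not lie in S. One step leads from a point of S to s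
    -- and another from s to a point outside S, where Φ has grown by at least δ; hence M + 2 steps
    -- for each unit δ.
    set S : Set ℝ := {t | a ≤ t ∧ t ≤ b ∧ Φ t - Φ a < δ} with hS
    have haS : a ∈ S := ⟨le_rfl, hab, by simpa using hδ⟩
    have hSb : BddAbove S := ⟨b, fun t ht => ht.2.1⟩
    set s := sSup S with hs
    have has : a ≤ s := le_csSup hSb haS
    have hsb : s ≤ b := csSup_le ⟨a, haS⟩ fun t ht => ht.2.1
    obtain ⟨ε, hε, hloc'⟩ := hloc s ⟨ha.trans has, hsb⟩
    obtain ⟨t, htS, hts⟩ := exists_lt_of_lt_csSup ⟨a, haS⟩ (show s - ε < sSup S by linarith)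
    have htle : t ≤ s := le_csSup hSb htS
    have h1 : HasChain R M (γ a) (γ t) := h a t ha htS.1 htS.2.1 htS.2.2
    have h2 : R (γ t) (γ s) := (hloc' t ⟨ha.trans htS.1, htS.2.1⟩ (by
      rw [abs_lt]; constructor <;> linarith)).1
    have h12 := h1.trans (.single h2)
    rcases hsb.eq_or_lt with hsb' | hsb'
    · rw [hsb'] at h12
      refine h12.mono (hrefl b le_rfl (ha.trans hab)) ?_
      nlinarith
    · set t' := min (s + ε / 2) b with ht'
      have hst' : s < t' := lt_min (by linarith) hsb'
      have ht'b : t' ≤ b := min_le_right _ _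
      have ht'ε : t' ≤ s + ε / 2 := min_le_left _ _
      have h3 : R (γ s) (γ t') := (hloc' t' ⟨by linarith, ht'b⟩ (by
        rw [abs_lt]; constructor <;> linarith)).2
      have h4 : ¬ (Φ t' - Φ a < δ) := fun h =>
        absurd (le_csSup hSb (show t' ∈ S from ⟨by linarith, ht'b, h⟩)) (not_le.2 hst')
      have h5 := ih t' (by linarith) ht'b (by push_cast at hk; linarith)
      have h6 := (h12.trans (.single h3)).trans h5
      convert h6 using 1
      ring

/-! ### Sequences of logarithmic type -/

/-- A positive sequence with neighbouring terms comparable, on which the number of steps is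
controlled by the logarithm of the relative size of the sum. -/
structure IsTame (A : ℝ) (m : ℕ) (d : ℕ → ℝ) : Prop where
  pos : ∀ i ≤ m, 0 < d i
  le_succ : ∀ i < m, d i ≤ 2 * d (i + 1)
  succ_le : ∀ i < m, d (i + 1) ≤ 2 * d i
  log_bound : ∀ i j, i ≤ j → j ≤ m →
    ((j - i : ℕ) : ℝ) ≤ A * (Real.log (1 + (∑ k ∈ Finset.Icc i j, d k) / min (d i) (d j)) + 1)

lemma IsTame.reverse {A : ℝ} {m : ℕ} {d : ℕ → ℝ} (h : IsTame A m d) :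
    IsTame A m (fun i => d (m - i)) := by
  refine ⟨fun i _ => h.pos _ (by omega), fun i hi => ?_, fun i hi => ?_, fun i j hij hj => ?_⟩
  · have := h.succ_le (m - (i + 1)) (by omega)
    rwa [show m - (i + 1) + 1 = m - i by omega] at this
  · have := h.le_succ (m - (i + 1)) (by omega)
    rwa [show m - (i + 1) + 1 = m - i by omega] at this
  · have := h.log_bound (m - j) (m - i) (by omega) (by omega)
    rw [show m - i - (m - j) = j - i by omega, min_comm] at this
    have hsum : ∑ k ∈ Finset.Icc i j, d (m - k) = ∑ k ∈ Finset.Icc (m - j) (m - i), d k := by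
      refine Finset.sum_nbij' (fun k => m - k) (fun k => m - k) ?_ ?_ ?_ ?_ ?_
      · intro k hk; simp only [Finset.mem_Icc] at hk ⊢; omega
      · intro k hk; simp only [Finset.mem_Icc] at hk ⊢; omega
      · intro k hk; simp only [Finset.mem_Icc] at hk; omega
      · intro k hk; simp only [Finset.mem_Icc] at hk; omega
      · intro k hk; rfl
    rwa [hsum]

lemma IsTame.le_two_pow {A : ℝ} {m : ℕ} {d : ℕ → ℝ} (h : IsTame A m d) {i k : ℕ}
    (hk : i + k ≤ m) : d (i + k) ≤ 2 ^ k * d i ∧ d i ≤ 2 ^ k * d (i + k) := by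
  induction k with
  | zero => simp
  | succ k ih =>
    obtain ⟨h1, h2⟩ := ih (by omega)
    have h3 := h.succ_le (i + k) (by omega)
    have h4 := h.le_succ (i + k) (by omega)
    rw [pow_succ, ← add_assoc]
    have : (0 : ℝ) < 2 ^ k := by positivity
    constructor
    · linarith
    · nlinarith

/-- The graph of the logarithm lies below its tangent at 2AB. With this slope the term containing x
on the right becomes x / 2 and is absorbed on the left. -/
lemma le_of_le_mul_log {A B x : ℝ} (hA : 1 ≤ A) (hB : 1 ≤ B) (hx : 0 ≤ x)
    (h : x ≤ A * (Real.log (1 + (x + 1) * B) + 1)) :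
    x ≤ 2 * A * ((1 + B) / (2 * A * B) + Real.log (2 * A * B)) := by
  have hpos : 0 < 1 + (x + 1) * B := by positivity
  have hAB : 0 < 2 * A * B := by positivity
  have h1 := Real.log_le_sub_one_of_pos (x := (1 + (x + 1) * B) / (2 * A * B)) (by positivity)
  rw [Real.log_div hpos.ne' hAB.ne'] at h1
  have h2 : A * (Real.log (1 + (x + 1) * B) + 1) ≤
      A * ((1 + (x + 1) * B) / (2 * A * B) + Real.log (2 * A * B)) := by
    exact mul_le_mul_of_nonneg_left (by linarith) (by linarith)
  have h3 : A * ((1 + (x + 1) * B) / (2 * A * B) + Real.log (2 * A * B)) =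
      x / 2 + A * ((1 + B) / (2 * A * B) + Real.log (2 * A * B)) := by
    field_simp
    ring
  linarith

/-- No long plateaus: the sum from i to j is at most (j - i + 1) R, so `log_bound` bounds j - i by a
multiple of the logarithm of j - i itself. -/
lemma IsTame.exists_plateau {A B : ℝ} (hA : 1 ≤ A) (hB : 1 ≤ B) :
    ∃ M : ℕ, ∀ (m : ℕ) (d : ℕ → ℝ), IsTame A m d → ∀ i j, i ≤ j → j ≤ m → ∀ R : ℝ,
      (∀ k, i ≤ k → k ≤ j → d k ≤ R) → R ≤ B * min (d i) (d j) → j - i ≤ M := by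
  refine ⟨⌈2 * A * ((1 + B) / (2 * A * B) + Real.log (2 * A * B))⌉₊,
    fun m d h i j hij hj R hR hRB => ?_⟩
  have hmin : 0 < min (d i) (d j) := lt_min (h.pos _ (by omega)) (h.pos _ hj)
  have h1 := h.log_bound i j hij hj
  have h2 : ∑ k ∈ Finset.Icc i j, d k ≤ (((j - i : ℕ) : ℝ) + 1) * R := by
    calc ∑ k ∈ Finset.Icc i j, d k ≤ ∑ k ∈ Finset.Icc i j, R :=
          Finset.sum_le_sum fun k hk => by
            rw [Finset.mem_Icc] at hk
            exact hR k hk.1 hk.2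
      _ = _ := by
          rw [Finset.sum_const, Nat.card_Icc, nsmul_eq_mul, show j + 1 - i = (j - i) + 1 by omega]
          push_cast
          rfl
  have h3 : (∑ k ∈ Finset.Icc i j, d k) / min (d i) (d j) ≤ (((j - i : ℕ) : ℝ) + 1) * B := by
    rw [div_le_iff₀ hmin]
    calc _ ≤ _ := h2
      _ ≤ (((j - i : ℕ) : ℝ) + 1) * (B * min (d i) (d j)) := by gcongr
      _ = _ := by ring
  have h0 : 0 ≤ ∑ k ∈ Finset.Icc i j, d k := Finset.sum_nonneg fun k hk => by
    rw [Finset.mem_Icc] at hk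
    exact (h.pos k (by omega)).le
  have h4 := le_of_le_mul_log hA hB (Nat.cast_nonneg (j - i)) (h1.trans (by gcongr))
  exact_mod_cast h4.trans (Nat.le_ceil _)

/-- Below the level of a later term, the sequence has no deep dips. -/
lemma IsTame.exists_le_mul {A : ℝ} (hA : 1 ≤ A) :
    ∃ C : ℝ, 1 ≤ C ∧ ∀ (m : ℕ) (d : ℕ → ℝ), IsTame A m d → ∀ i l q, i ≤ l → l ≤ q → q ≤ m →
      d i ≤ d q → d i ≤ C * d l := by
  obtain ⟨M, hM⟩ := IsTame.exists_plateau hA (one_le_two (α := ℝ))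
  refine ⟨2 ^ M, one_le_pow₀ one_le_two, fun m d h i l q hil hlq hq hdq => ?_⟩
  have hdl := h.pos l (by omega)
  rcases le_or_gt (d i) (d l) with hle | hlt
  · have : (1 : ℝ) ≤ 2 ^ M := one_le_pow₀ one_le_two
    nlinarith
  classical
  -- the last index before `l`, and the first one after it, at which the level `d i` is reached
  obtain ⟨i', ⟨hi'1, hi'2, hi'3⟩, hi'max⟩ : ∃ i', (i ≤ i' ∧ i' ≤ l ∧ d i ≤ d i') ∧
      ∀ k, i' < k → k ≤ l → d k < d i := by
    refine ⟨Nat.findGreatest (fun k => i ≤ k ∧ d i ≤ d k) l, ?_, ?_⟩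
    · have := Nat.findGreatest_spec (P := fun k => i ≤ k ∧ d i ≤ d k) hil ⟨le_rfl, le_rfl⟩
      exact ⟨this.1, Nat.findGreatest_le l, this.2⟩
    · intro k hk hkl
      have h1 := Nat.findGreatest_is_greatest hk hkl
      have h2 := Nat.le_findGreatest (P := fun k => i ≤ k ∧ d i ≤ d k) hil ⟨le_rfl, le_rfl⟩
      by_contra hcon
      exact h1 ⟨by omega, not_lt.1 hcon⟩
  obtain ⟨j', ⟨hj'1, hj'2, hj'3⟩, hj'min⟩ : ∃ j', (l ≤ j' ∧ j' ≤ q ∧ d i ≤ d j') ∧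
      ∀ k, l ≤ k → k < j' → d k < d i := by
    have hex : ∃ k, l ≤ k ∧ d i ≤ d k := ⟨q, hlq, hdq⟩
    refine ⟨Nat.find hex, ⟨(Nat.find_spec hex).1, Nat.find_min' hex ⟨hlq, hdq⟩,
      (Nat.find_spec hex).2⟩, fun k hk hk' => ?_⟩
    have := Nat.find_min hex hk'
    by_contra hcon
    exact this ⟨hk, not_lt.1 hcon⟩
  have hi'l : i' < l := lt_of_le_of_ne hi'2 (by rintro rfl; linarith)
  have hlj' : l < j' := lt_of_le_of_ne hj'1 (by rintro rfl; linarith)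
  have h1 : d i' ≤ 2 * d i := by
    have := h.le_succ i' (by omega)
    have := hi'max (i' + 1) (by omega) (by omega)
    linarith
  have h2 : d j' ≤ 2 * d i := by
    have h3 := h.succ_le (j' - 1) (by omega)
    have h4 := hj'min (j' - 1) (by omega) (by omega)
    rw [show j' - 1 + 1 = j' by omega] at h3
    linarith
  have hdi := h.pos i (by omega)
  -- From i' to j' all terms are at most 2 d i while both end terms are at least d i. This is a
  -- plateau with B = 2, so l is within M indices of i'.
  have h3 := hM m d h i' j' (by omega) (by omega) (2 * d i) (fun k hk hk' => by
    rcases hk.eq_or_lt with rfl | hk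
    · exact h1
    rcases hk'.eq_or_lt with rfl | hk'
    · exact h2
    rcases le_total k l with hkl | hkl
    · linarith [hi'max k hk hkl]
    · linarith [hj'min k hkl hk']) (by linarith [le_min hi'3 hj'3])
  have h4 := (h.le_two_pow (i := i') (k := l - i') (by omega)).2
  rw [show i' + (l - i') = l by omega] at h4
  calc d i ≤ d i' := hi'3
    _ ≤ _ := h4
    _ ≤ _ := by gcongr <;> first | exact one_le_two | omega

/-- Before its maximum, the partial sums of a tame sequence are controlled by the last term. -/
lemma IsTame.exists_sum_le {A : ℝ} (hA : 1 ≤ A) :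
    ∃ K : ℝ, 1 ≤ K ∧ ∀ (m : ℕ) (d : ℕ → ℝ), IsTame A m d → ∀ q ≤ m, (∀ i ≤ m, d i ≤ d q) →
      ∀ l ≤ q, ∑ k ∈ Finset.range (l + 1), d k ≤ K * d l := by
  obtain ⟨C, hC, hdip⟩ := IsTame.exists_le_mul hA
  obtain ⟨M₀, hM₀⟩ := IsTame.exists_plateau hA (B := 2 * C) (by linarith)
  set M := M₀ + 1 with hM
  have hM1 : (1 : ℝ) ≤ M := by rw [hM]; push_cast; linarith [Nat.cast_nonneg (α := ℝ) M₀]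
  refine ⟨2 * M * C, by nlinarith, fun m d h q hq hmax => ?_⟩
  have hC' : ∀ i l, i ≤ l → l ≤ q → d i ≤ C * d l := fun i l hil hlq =>
    hdip m d h i l q hil hlq hq (hmax i (by omega))
  -- Geometric growth before the maximum: without doubling, the indices from i to i + M would form a
  -- plateau of height C d (i + M), and M = M₀ + 1 is one index too long for that.
  have hgrow : ∀ i, i + M ≤ q → 2 * d i ≤ d (i + M) := by
    intro i hi
    by_contra! hcon
    have hdM := h.pos (i + M) (by omega)
    have := hM₀ m d h i (i + M) (by omega) (by omega) (C * d (i + M))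
      (fun k hk hk' => hC' k (i + M) hk' hi) (by
        rw [mul_min_of_nonneg _ _ (by linarith)]
        refine le_min ?_ ?_ <;> nlinarith)
    omega
  intro l
  induction l using Nat.strong_induction_on with
  | _ l ih =>
    intro hlq
    have hdl := h.pos l (by omega)
    have hpart : ∀ s : Finset ℕ, s.card ≤ M → (∀ k ∈ s, k ≤ l) → ∑ k ∈ s, d k ≤ M * C * d l := by
      intro s hs hsl
      calc ∑ k ∈ s, d k ≤ ∑ k ∈ s, C * d l := Finset.sum_le_sum fun k hk => hC' k l (hsl k hk) hlq
        _ = s.card * (C * d l) := by rw [Finset.sum_const, nsmul_eq_mul]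
        _ ≤ M * (C * d l) := by
            have : (s.card : ℝ) ≤ M := by exact_mod_cast hs
            have : 0 ≤ C * d l := by positivity
            gcongr
        _ = _ := by ring
    have hMC : 0 ≤ M * C * d l := by positivity
    rcases lt_or_ge l M with hlM | hlM
    · have := hpart (Finset.range (l + 1)) (by simp; omega) (fun k hk => by simp at hk; omega)
      linarith
    -- The last M terms contribute at most M C d l. The earlier ones contribute at most 2 M C d (l -
    -- M) by induction, which the doubling turns into another M C d l.
    · rw [← Finset.sum_range_add_sum_Ico _ (show l - M + 1 ≤ l + 1 by omega)]
      have h1 := ih (l - M) (by omega) (by omega)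
      have h2 := hgrow (l - M) (by omega)
      rw [show l - M + M = l by omega] at h2
      have h3 := hpart (Finset.Ico (l - M + 1) (l + 1)) (by simp; omega)
        (fun k hk => by simp at hk; omega)
      have : 2 * M * C * d (l - M) ≤ M * C * d l := by
        have : 0 ≤ M * C := by positivity
        nlinarith
      linarith

/-- After its maximum, the final sums of a tame sequence are controlled by the first term. -/
lemma IsTame.exists_sum_Icc_le {A : ℝ} (hA : 1 ≤ A) :
    ∃ K : ℝ, 1 ≤ K ∧ ∀ (m : ℕ) (d : ℕ → ℝ), IsTame A m d → ∀ q ≤ m, (∀ i ≤ m, d i ≤ d q) →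
      (∀ l ≤ q, ∑ k ∈ Finset.Icc 0 l, d k ≤ K * d l) ∧
      (∀ l, q ≤ l → l ≤ m → ∑ k ∈ Finset.Icc l m, d k ≤ K * d l) := by
  obtain ⟨K, hK, hsum⟩ := IsTame.exists_sum_le hA
  refine ⟨K, hK, fun m d h q hq hmax => ⟨fun l hl => ?_, fun l hql hlm => ?_⟩⟩
  · have := hsum m d h q hq hmax l hl
    rwa [Finset.range_eq_Ico, Finset.Ico_add_one_right_eq_Icc] at this
  · have := hsum m _ h.reverse (m - q) (by omega) (fun i hi => by
      rw [show m - (m - q) = q by omega]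
      exact hmax _ (by omega)) (m - l) (by omega)
    rw [show m - (m - l) = l by omega] at this
    refine le_trans (le_of_eq ?_) this
    refine Finset.sum_nbij' (fun k => m - k) (fun k => m - k) ?_ ?_ ?_ ?_ ?_
    · intro k hk; simp only [Finset.mem_Icc, Finset.mem_range] at hk ⊢; omega
    · intro k hk; simp only [Finset.mem_Icc, Finset.mem_range] at hk ⊢; omega
    · intro k hk; simp only [Finset.mem_Icc] at hk; omega
    · intro k hk; simp only [Finset.mem_range] at hk; omega
    · intro k hk
      simp only [Finset.mem_Icc] at hk
      rw [show m - (m - k) = k by omega]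

/-! ### Distance to the boundary -/

section BoundaryDistance

variable {n : ℕ} {D : Set (EuclideanSpace ℝ (Fin n))} {z w x y u v : EuclideanSpace ℝ (Fin n)}

lemma IsProperDomain.frontier_nonempty (hD : IsProperDomain D) : (frontier D).Nonempty :=
  nonempty_frontier_iff.2 ⟨hD.2.1.nonempty, hD.2.2⟩

lemma bdist_pos (hD : IsProperDomain D) (hz : z ∈ D) : 0 < bdist D z := by
  refine (isClosed_frontier.notMem_iff_infDist_pos hD.frontier_nonempty).1 fun h => ?_
  rw [hD.1.frontier_eq] at h
  exact h.2 hz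

lemma bdist_le_add_dist (z w : EuclideanSpace ℝ (Fin n)) : bdist D z ≤ bdist D w + dist z w :=
  Metric.infDist_le_infDist_add_dist

lemma bdist_le_dist {a : EuclideanSpace ℝ (Fin n)} (ha : a ∈ frontier D) :
    bdist D z ≤ dist z a :=
  Metric.infDist_le_dist_of_mem ha

lemma exists_bdist_eq_dist (hD : IsProperDomain D) (z : EuclideanSpace ℝ (Fin n)) :
    ∃ a ∈ frontier D, bdist D z = dist z a :=
  isClosed_frontier.exists_infDist_eq_dist hD.frontier_nonempty z

/-- The ball misses the boundary, so D and the complement of its closure would disconnect it if it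
met both. -/
lemma mem_of_dist_lt_bdist (hD : IsProperDomain D) (hz : z ∈ D) (h : dist w z < bdist D z) :
    w ∈ D := by
  have hball : Disjoint (Metric.ball z (bdist D z)) (frontier D) :=
    Metric.disjoint_ball_infDist
  have hconn : IsPreconnected (Metric.ball z (bdist D z)) :=
    (convex_ball z _).isPreconnected
  by_contra hw
  have hcl : w ∉ closure D := fun hcl => hball.le_bot
    ⟨Metric.mem_ball.2 h, by rw [hD.1.frontier_eq]; exact ⟨hcl, hw⟩⟩
  obtain ⟨q, hq, hqD, hqc⟩ := hconn D (closure D)ᶜ hD.1 isClosed_closure.isOpen_compl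
    (fun q hq => by
      by_cases hqD : q ∈ D
      · exact Or.inl hqD
      · refine Or.inr fun hqcl => hball.le_bot ⟨hq, ?_⟩
        rw [hD.1.frontier_eq]
        exact ⟨hqcl, hqD⟩)
    ⟨z, Metric.mem_ball_self (bdist_pos hD hz), hz⟩ ⟨w, Metric.mem_ball.2 h, hcl⟩
  exact hqc (subset_closure hqD)

/-- Two points of `D` which are close to each other in comparison with their distances to the
boundary. -/
structure Step (D : Set (EuclideanSpace ℝ (Fin n))) (u v : EuclideanSpace ℝ (Fin n)) : Prop where
  left_mem : u ∈ D
  right_mem : v ∈ D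
  dist_le_left : dist u v ≤ bdist D u / 2
  dist_le_right : dist u v ≤ bdist D v / 2

lemma Step.symm (h : Step D u v) : Step D v u :=
  ⟨h.2, h.1, by rw [dist_comm]; exact h.4, by rw [dist_comm]; exact h.3⟩

lemma Step.refl (hD : IsProperDomain D) (hu : u ∈ D) : Step D u u :=
  by
  have := bdist_pos hD hu
  exact ⟨hu, hu, by rw [dist_self]; positivity, by rw [dist_self]; positivity⟩

lemma Step.of_dist_le (hD : IsProperDomain D) (hu : u ∈ D) (h : dist u v ≤ bdist D u / 4) :
    Step D u v := by
  have h1 := bdist_pos hD hu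
  have h2 := bdist_le_add_dist (D := D) u v
  exact ⟨hu, mem_of_dist_lt_bdist hD hu (by rw [dist_comm]; linarith), by linarith, by linarith⟩

lemma Step.bdist_le (h : Step D u v) : bdist D u ≤ 2 * bdist D v := by
  have := bdist_le_add_dist (D := D) u v
  have := h.4
  have : 0 ≤ bdist D v := Metric.infDist_nonneg
  linarith

lemma dist_le_of_mem_segment {E : Type*} [NormedAddCommGroup E] [NormedSpace ℝ E] {u v w : E}
    (hw : w ∈ segment ℝ u v) : dist u w ≤ dist u v := by
  have := dist_add_dist_of_mem_segment hw
  linarith [dist_nonneg (x := w) (y := v)]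

lemma Step.bdist_le_of_mem_segment (h : Step D u v) (hw : w ∈ segment ℝ u v) :
    bdist D u ≤ 2 * bdist D w := by
  have h1 := bdist_le_add_dist (D := D) u w
  have h2 := dist_le_of_mem_segment hw
  have h3 := h.3
  linarith

lemma Step.mem_of_mem_segment (hD : IsProperDomain D) (h : Step D u v) (hw : w ∈ segment ℝ u v) :
    w ∈ D := by
  refine mem_of_dist_lt_bdist hD h.1 ?_
  have h2 := dist_le_of_mem_segment hw
  have h3 := h.3
  have := bdist_pos hD h.1
  rw [dist_comm]
  linarith

end BoundaryDistance

/-! ### Arcs from chains -/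

lemma eVariationOn_Icc_le_of_dist_le {E : Type*} [PseudoMetricSpace E] {γ : ℝ → E} {a b C : ℝ}
    (hC : 0 ≤ C)
    (h : ∀ s ∈ Icc a b, ∀ t ∈ Icc a b, dist (γ s) (γ t) ≤ C * |s - t|) :
    eVariationOn γ (Icc a b) ≤ ENNReal.ofReal (C * (b - a)) := by
  have hL : LipschitzOnWith (Real.toNNReal C) γ (Icc a b) := by
    refine LipschitzOnWith.of_dist_le_mul fun s hs t ht => ?_
    rw [Real.coe_toNNReal _ hC, Real.dist_eq]
    exact h s hs t ht
  have := hL.comp_eVariationOn_le (f := γ) (g := (id : ℝ → ℝ)) (s := Icc a b) (fun x hx => hx)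
  rw [Function.comp_id, eVariationOn_id_Icc] at this
  rw [ENNReal.ofReal_mul hC]
  exact this

/-- The union of the segments of a polygonal line contains a simple arc with the same ends, which
runs through the segments in their order. -/
lemma exists_arc_of_polygon {E : Type*} [NormedAddCommGroup E] [NormedSpace ℝ E] (p : ℕ → E)
    (m : ℕ) : ∃ T : ℝ, 0 ≤ T ∧ ∃ γ : ℝ → E, γ 0 = p 0 ∧ γ T = p m ∧
      (∀ s ∈ Icc 0 T, ∀ t ∈ Icc 0 T, dist (γ s) (γ t) ≤ |s - t|) ∧ InjOn γ (Icc 0 T) ∧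
      T ≤ ∑ k ∈ Finset.range m, dist (p k) (p (k + 1)) ∧
      ∀ t ∈ Icc 0 T, t = 0 ∨ ∃ i < m, γ t ∈ segment ℝ (p i) (p (i + 1)) ∧
        t ≤ ∑ k ∈ Finset.range (i + 1), dist (p k) (p (k + 1)) ∧
        T - t ≤ ∑ k ∈ Finset.Ico i m, dist (p k) (p (k + 1)) := by
  induction m with
  | zero =>
    refine ⟨0, le_rfl, fun _ => p 0, rfl, rfl, by simp, by simp, by simp, fun t ht => Or.inl ?_⟩
    exact le_antisymm ht.2 ht.1
  | succ m ih =>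
    obtain ⟨T, hT, γ, h0, h1, hlip, hinj, hTle, hpos⟩ := ih
    have hcont : ContinuousOn γ (Icc 0 T) := by
      refine (LipschitzOnWith.of_dist_le_mul (K := 1) fun s hs t ht => ?_).continuousOn
      simpa [Real.dist_eq] using hlip s hs t ht
    have hclosed : IsClosed (segment ℝ (p m) (p (m + 1))) := by
      rw [← convexHull_pair]
      exact ((toFinite _).isCompact_convexHull ℝ).isClosed
    -- The arc built so far is cut at its first point on the new segment and continued from there
    -- along that segment. This loop erasure keeps the order of the segments and does not increase
    -- length.
    obtain ⟨t₀, ⟨ht₀, hmem⟩, hleast⟩ : ∃ t₀, IsLeast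
        (Icc 0 T ∩ γ ⁻¹' segment ℝ (p m) (p (m + 1))) t₀ := by
      refine IsCompact.exists_isLeast ?_ ?_
      · exact (isCompact_Icc (a := (0 : ℝ)) (b := T)).of_isClosed_subset
          (hcont.preimage_isClosed_of_isClosed isClosed_Icc hclosed) inter_subset_left
      · exact ⟨T, ⟨hT, le_rfl⟩, by rw [mem_preimage, h1]; exact left_mem_segment _ _ _⟩
    set b := p (m + 1) with hb
    set c := γ t₀ with hc
    set e := dist c b with he
    have he0 : 0 ≤ e := dist_nonneg
    have hcb : e ≤ dist (p m) b := by
      have := dist_add_dist_of_mem_segment hmem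
      have h2 : 0 ≤ dist (p m) c := dist_nonneg
      change dist (p m) c + dist c b = dist (p m) b at this
      linarith
    -- If the new vertex is already the cut point then e = 0; the division then gives 0 and the
    -- added piece is a single point.
    set γ' : ℝ → E := fun t => if t ≤ t₀ then γ t else AffineMap.lineMap c b ((t - t₀) / e) with hγ'
    have hold : ∀ t ≤ t₀, γ' t = γ t := fun t ht => by simp [hγ', ht]
    have hnew : ∀ t, t₀ ≤ t → γ' t = AffineMap.lineMap c b ((t - t₀) / e) := by
      intro t ht
      rcases ht.eq_or_lt with rfl | ht
      · simp [hγ', hc]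
      · simp [hγ', not_le.2 ht]
    have hdist : ∀ s ∈ Icc t₀ (t₀ + e), ∀ t ∈ Icc t₀ (t₀ + e), dist (γ' s) (γ' t) = |s - t| := by
      intro s hs t ht
      rw [hnew s hs.1, hnew t ht.1, dist_lineMap_lineMap, Real.dist_eq, ← he]
      rcases he0.eq_or_lt with h | h
      · have h1 : s = t₀ := le_antisymm (by linarith [hs.2]) hs.1
        have h2 : t = t₀ := le_antisymm (by linarith [ht.2]) ht.1
        simp [h1, h2]
      · rw [← sub_div, abs_div, abs_of_pos h, sub_sub_sub_cancel_right]
        field_simp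
    have hseg : ∀ t ∈ Icc t₀ (t₀ + e), γ' t ∈ segment ℝ (p m) b := by
      intro t ht
      rw [hnew t ht.1]
      refine (convex_segment _ _).segment_subset hmem (right_mem_segment _ _ _) ?_
      rw [segment_eq_image_lineMap]
      refine ⟨_, ⟨div_nonneg (by linarith [ht.1]) he0, div_le_one_of_le₀ (by linarith [ht.2]) he0⟩,
        rfl⟩
    have hlip' : ∀ s ∈ Icc 0 (t₀ + e), ∀ t ∈ Icc 0 (t₀ + e), s ≤ t →
        dist (γ' s) (γ' t) ≤ |s - t| := by
      intro s hs t ht hst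
      rcases le_total t t₀ with h | h
      · rw [hold s (hst.trans h), hold t h]
        exact hlip s ⟨hs.1, by linarith [ht₀.2]⟩ t ⟨ht.1, by linarith [ht₀.2]⟩
      rcases le_total s t₀ with h' | h'
      · have h2 := hdist t₀ ⟨le_rfl, by linarith⟩ t ⟨h, ht.2⟩
        have h3 := hlip s ⟨hs.1, by linarith [ht₀.2]⟩ t₀ ht₀
        rw [← hold s h', ← hold t₀ le_rfl] at h3
        have h4 := dist_triangle (γ' s) (γ' t₀) (γ' t)
        rw [abs_of_nonpos (by linarith)] at h2 h3 ⊢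
        linarith
      · exact (hdist s ⟨h', hs.2⟩ t ⟨h, ht.2⟩).le
    have hinj' : ∀ s ∈ Icc 0 (t₀ + e), ∀ t ∈ Icc 0 (t₀ + e), s < t → γ' s ≠ γ' t := by
      intro s hs t ht hst heq
      rcases le_or_gt t t₀ with h | h
      · rw [hold s (hst.le.trans h), hold t h] at heq
        exact hst.ne (hinj ⟨hs.1, by linarith [ht₀.2]⟩ ⟨ht.1, by linarith [ht₀.2]⟩ heq)
      -- An earlier point on the new piece would be a visit to the segment before the first one.
      · have hs' : t₀ ≤ s := by
          by_contra! hcon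
          have h2 := hseg t ⟨h.le, ht.2⟩
          rw [← heq, hold s hcon.le] at h2
          exact absurd (hleast ⟨⟨hs.1, by linarith [ht₀.2]⟩, h2⟩) (not_le.2 hcon)
        have h2 := hdist s ⟨hs', hs.2⟩ t ⟨h.le, ht.2⟩
        rw [heq, dist_self, abs_of_neg (by linarith)] at h2
        linarith
    refine ⟨t₀ + e, by linarith [ht₀.1], γ', by rw [hold 0 ht₀.1, h0], ?_, ?_, ?_, ?_, ?_⟩
    · rw [hnew _ (by linarith)]
      rcases he0.eq_or_lt with h | h
      · have : c = b := dist_eq_zero.1 (he ▸ h.symm)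
        simp [this]
      · simp [h.ne']
    · intro s hs t ht
      rcases le_total s t with h | h
      · exact hlip' s hs t ht h
      · rw [dist_comm, abs_sub_comm]
        exact hlip' t ht s hs h
    · intro s hs t ht heq
      by_contra hne
      rcases lt_or_gt_of_ne hne with h | h
      · exact hinj' s hs t ht h heq
      · exact hinj' t ht s hs h heq.symm
    · rw [Finset.sum_range_succ]
      linarith [ht₀.2]
    · intro t ht
      rcases le_or_gt t t₀ with h | h
      · rcases hpos t ⟨ht.1, by linarith [ht₀.2]⟩ with rfl | ⟨i, hi, hi1, hi2, hi3⟩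
        · exact Or.inl rfl
        · refine Or.inr ⟨i, by omega, by rwa [hold t h], hi2, ?_⟩
          rw [Finset.sum_Ico_succ_top hi.le]
          linarith [ht₀.2]
      · refine Or.inr ⟨m, by omega, hseg t ⟨h.le, ht.2⟩, ?_, ?_⟩
        · rw [Finset.sum_range_succ]
          linarith [ht₀.2, ht.2]
        · rw [Nat.Ico_succ_singleton, Finset.sum_singleton]
          linarith

section ChainArcs

variable {n : ℕ} {D : Set (EuclideanSpace ℝ (Fin n))} {x y z : EuclideanSpace ℝ (Fin n)} {m : ℕ}
  {p : ℕ → EuclideanSpace ℝ (Fin n)}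

/-- A chain of steps in `D` contains an arc running through its segments in their order. -/
lemma IsChainSeq.exists_arc (hD : IsProperDomain D) (hx : x ∈ D)
    (hp : IsChainSeq (Step D) m x y p) :
    ∃ γ : ℝ → EuclideanSpace ℝ (Fin n), IsArcIn D x y γ ∧
      eVariationOn γ (Icc 0 1) ≤
        ENNReal.ofReal (∑ k ∈ Finset.range m, dist (p k) (p (k + 1))) ∧
      ∀ t ∈ Icc (0 : ℝ) 1, (γ t = x ∧ eVariationOn γ (Icc 0 t) = 0) ∨
        ∃ i < m, γ t ∈ segment ℝ (p i) (p (i + 1)) ∧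
        eVariationOn γ (Icc 0 t) ≤
          ENNReal.ofReal (∑ k ∈ Finset.range (i + 1), dist (p k) (p (k + 1))) ∧
        eVariationOn γ (Icc t 1) ≤
          ENNReal.ofReal (∑ k ∈ Finset.Ico i m, dist (p k) (p (k + 1))) := by
  obtain ⟨T, hT, γ, h0, h1, hlip, hinj, hTle, hpos⟩ := exists_arc_of_polygon p m
  have hmem : ∀ t ∈ Icc (0 : ℝ) 1, T * t ∈ Icc 0 T := fun t ht =>
    ⟨mul_nonneg hT ht.1, mul_le_of_le_one_right hT ht.2⟩
  have hlip' : ∀ s ∈ Icc (0 : ℝ) 1, ∀ t ∈ Icc (0 : ℝ) 1,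
      dist (γ (T * s)) (γ (T * t)) ≤ T * |s - t| := by
    intro s hs t ht
    refine (hlip _ (hmem s hs) _ (hmem t ht)).trans (le_of_eq ?_)
    rw [← mul_sub, abs_mul, abs_of_nonneg hT]
  have hvar : ∀ a b, 0 ≤ a → b ≤ 1 →
      eVariationOn (fun t => γ (T * t)) (Icc a b) ≤ ENNReal.ofReal (T * (b - a)) := by
    intro a b ha hb
    refine eVariationOn_Icc_le_of_dist_le hT fun s hs t ht => ?_
    exact hlip' s ⟨ha.trans hs.1, hs.2.trans hb⟩ t ⟨ha.trans ht.1, ht.2.trans hb⟩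
  refine ⟨fun t => γ (T * t), ⟨⟨?_, ?_, ?_, ?_, ?_⟩, ?_⟩, ?_, ?_⟩
  · refine (LipschitzOnWith.of_dist_le_mul (K := Real.toNNReal T) fun s hs t ht => ?_).continuousOn
    rw [Real.coe_toNNReal _ hT, Real.dist_eq]
    exact hlip' s hs t ht
  · exact ne_top_of_le_ne_top ENNReal.ofReal_ne_top (hvar 0 1 le_rfl le_rfl)
  · intro t ht
    rcases hpos _ (hmem t ht) with h | ⟨i, hi, hi1, -⟩
    · simp only [h, h0, hp.source, hx]
    · exact (hp.step i hi).mem_of_mem_segment hD hi1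
  · simp [h0, hp.source]
  · simp [h1, hp.target]
  -- Rescaling by T = 0 gives the constant arc; otherwise it preserves injectivity.
  · rcases hT.eq_or_lt with h | h
    · right
      intro t _
      simp [← h, h0, hp.source]
    · left
      intro s hs t ht hst
      exact mul_left_cancel₀ h.ne' (hinj (hmem s hs) (hmem t ht) hst)
  · refine (hvar 0 1 le_rfl le_rfl).trans (ENNReal.ofReal_le_ofReal ?_)
    linarith
  · intro t ht
    have h2 := hvar 0 t le_rfl ht.2
    have h3 := hvar t 1 ht.1 le_rfl
    rcases hpos _ (hmem t ht) with h | ⟨i, hi, hi1, hi2, hi3⟩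
    · left
      rw [sub_zero, h, ENNReal.ofReal_zero] at h2
      exact ⟨by simp only [h, h0, hp.source], le_antisymm h2 zero_le⟩
    · right
      refine ⟨i, hi, hi1, h2.trans (ENNReal.ofReal_le_ofReal (by linarith)),
        h3.trans (ENNReal.ofReal_le_ofReal (by linarith))⟩

/-! ### The inner diameter metric -/

lemma innerDiam_nonneg (D : Set (EuclideanSpace ℝ (Fin n))) (x y : EuclideanSpace ℝ (Fin n)) :
    0 ≤ innerDiam D x y :=
  Real.sInf_nonneg (by rintro _ ⟨γ, _, rfl⟩; exact Metric.diam_nonneg)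

lemma innerDiam_le_diam {γ : ℝ → EuclideanSpace ℝ (Fin n)} (h : IsArcIn D x y γ) :
    innerDiam D x y ≤ Metric.diam (γ '' Icc 0 1) :=
  csInf_le ⟨0, by rintro _ ⟨γ, _, rfl⟩; exact Metric.diam_nonneg⟩ ⟨γ, h, rfl⟩

lemma IsPathIn.isCompact_image {γ : ℝ → EuclideanSpace ℝ (Fin n)} (h : IsPathIn D x y γ) :
    IsCompact (γ '' Icc 0 1) :=
  isCompact_Icc.image_of_continuousOn h.continuousOn

lemma IsChainSeq.mem (hx : x ∈ D) (hp : IsChainSeq (Step D) m x y p) {i : ℕ} (hi : i ≤ m) :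
    p i ∈ D := by
  rcases Nat.eq_zero_or_pos i with rfl | h
  · rwa [hp.source]
  · have := (hp.step (i - 1) (by omega)).2
    rwa [show i - 1 + 1 = i by omega] at this

/-- The arc extracted from the chain stays within ε of the members, which lie in S. With small ε
this replaces paths and their concatenations by arcs at almost no cost in diameter. -/
lemma IsChainSeq.innerDiam_le_of_mem (hD : IsProperDomain D) (hx : x ∈ D)
    (hp : IsChainSeq (Step D) m x y p) {ε : ℝ} (hε : 0 ≤ ε)
    (hstep : ∀ i < m, dist (p i) (p (i + 1)) ≤ ε) {S : Set (EuclideanSpace ℝ (Fin n))}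
    (hS : Bornology.IsBounded S) (hpS : ∀ i ≤ m, p i ∈ S) :
    innerDiam D x y ≤ Metric.diam S + 2 * ε := by
  obtain ⟨γ, hγ, -, hloc⟩ := hp.exists_arc hD hx
  refine (innerDiam_le_diam hγ).trans ?_
  have hnear : ∀ t ∈ Icc (0 : ℝ) 1, ∃ q ∈ S, dist (γ t) q ≤ ε := by
    intro t ht
    rcases hloc t ht with ⟨h, -⟩ | ⟨i, hi, hi1, -⟩
    · exact ⟨p 0, hpS 0 (Nat.zero_le _), by simpa [h, hp.source] using hε⟩
    · refine ⟨p i, hpS i hi.le, ?_⟩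
      rw [dist_comm]
      exact (dist_le_of_mem_segment hi1).trans (hstep i hi)
  refine Metric.diam_le_of_forall_dist_le (by linarith [Metric.diam_nonneg (s := S)]) ?_
  rintro _ ⟨s, hs, rfl⟩ _ ⟨t, ht, rfl⟩
  obtain ⟨q, hq, hqd⟩ := hnear s hs
  obtain ⟨q', hq', hqd'⟩ := hnear t ht
  have h1 := Metric.dist_le_diam_of_mem hS hq hq'
  have h2 := dist_triangle4 (γ s) q q' (γ t)
  rw [dist_comm q' (γ t)] at h2
  linarith

lemma IsChainSeq.innerDiam_le_sum (hD : IsProperDomain D) (hx : x ∈ D)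
    (hp : IsChainSeq (Step D) m x y p) :
    innerDiam D x y ≤ ∑ k ∈ Finset.range m, dist (p k) (p (k + 1)) := by
  obtain ⟨γ, hγ, hvar, -⟩ := hp.exists_arc hD hx
  have h0 : 0 ≤ ∑ k ∈ Finset.range m, dist (p k) (p (k + 1)) :=
    Finset.sum_nonneg fun _ _ => dist_nonneg
  refine (innerDiam_le_diam hγ).trans (Metric.diam_le_of_forall_dist_le h0 ?_)
  rintro _ ⟨s, hs, rfl⟩ _ ⟨t, ht, rfl⟩
  have := (eVariationOn.edist_le γ hs ht).trans hvar
  rw [edist_dist] at this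
  exact (ENNReal.ofReal_le_ofReal_iff h0).1 this

/-- A path in `D` can be replaced by a chain of arbitrarily small steps with members on it. -/
lemma exists_fine_chain (hD : IsProperDomain D) {γ : ℝ → EuclideanSpace ℝ (Fin n)}
    (hcont : ContinuousOn γ (Icc 0 1)) (hmaps : MapsTo γ (Icc 0 1) D) {ε : ℝ} (hε : 0 < ε) :
    ∃ m p, IsChainSeq (Step D) m (γ 0) (γ 1) p ∧ (∀ i < m, dist (p i) (p (i + 1)) ≤ ε) ∧
      ∀ i ≤ m, p i ∈ γ '' Icc 0 1 := by
  have hb : Continuous (bdist D) := Metric.continuous_infDist_pt _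
  obtain ⟨t₀, ht₀, hmin⟩ := (isCompact_Icc (a := (0 : ℝ)) (b := 1)).exists_isMinOn
    ⟨0, by simp⟩ (hb.comp_continuousOn hcont)
  have hr : 0 < bdist D (γ t₀) := bdist_pos hD (hmaps ht₀)
  have huc := isCompact_Icc.uniformContinuousOn_of_continuous hcont
  obtain ⟨δ, hδ, huc'⟩ := Metric.uniformContinuousOn_iff.1 huc (min ε (bdist D (γ t₀) / 4))
    (lt_min hε (by positivity))
  obtain ⟨m, hm⟩ := exists_nat_one_div_lt hδ
  have hmem : ∀ i ≤ m + 1, (i / (m + 1 : ℝ)) ∈ Icc (0 : ℝ) 1 := fun i hi =>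
    ⟨by positivity, div_le_one_of_le₀ (by exact_mod_cast hi) (by positivity)⟩
  have hd : ∀ i < m + 1, dist (γ (i / (m + 1 : ℝ))) (γ ((i + 1 : ℕ) / (m + 1 : ℝ))) <
      min ε (bdist D (γ t₀) / 4) := by
    intro i hi
    refine huc' _ (hmem i hi.le) _ (hmem (i + 1) hi) ?_
    rw [Real.dist_eq, ← sub_div, abs_div, abs_of_pos (by positivity : (0 : ℝ) < m + 1)]
    push_cast
    simpa using hm
  refine ⟨m + 1, fun i => γ (i / (m + 1 : ℝ)), ⟨by simp, ?_, fun i hi => ?_⟩, fun i hi => ?_,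
    fun i hi => ⟨_, hmem i hi, rfl⟩⟩
  · have : ((m : ℝ) + 1) ≠ 0 := by positivity
    simp [this]
  · have h1 : bdist D (γ t₀) ≤ bdist D (γ (i / (m + 1 : ℝ))) := hmin (hmem i hi.le)
    have h2 := (hd i hi).le.trans (min_le_right _ _)
    exact Step.of_dist_le hD (hmaps (hmem i hi.le)) (by linarith)
  · exact (hd i hi).le.trans (min_le_left _ _)

/-- A path may cross itself, but an arc can be extracted from an arbitrarily fine chain along it. -/
lemma innerDiam_le_diam_path (hD : IsProperDomain D) {γ : ℝ → EuclideanSpace ℝ (Fin n)}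
    (hγ : IsPathIn D x y γ) : innerDiam D x y ≤ Metric.diam (γ '' Icc 0 1) := by
  refine le_of_forall_pos_le_add fun ε hε => ?_
  obtain ⟨m, p, hp, hstep, hmem⟩ := exists_fine_chain hD hγ.continuousOn hγ.mapsTo (half_pos hε)
  rw [hγ.source, hγ.target] at hp
  have hx : x ∈ D := hγ.source ▸ hγ.mapsTo (by simp)
  have := hp.innerDiam_le_of_mem hD hx (by positivity) hstep hγ.isCompact_image.isBounded hmem
  linarith

/-- The path supplied by path connectedness may have infinite length; the chain along it is what
produces rectifiable arcs in D. -/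
lemma exists_chain (hD : IsProperDomain D) (hx : x ∈ D) (hy : y ∈ D) :
    ∃ m, HasChain (Step D) m x y := by
  have hpc : IsPathConnected D := hD.1.isConnected_iff_isPathConnected.1 hD.2.1
  obtain ⟨γ, hγ⟩ := hpc.joinedIn x hx y hy
  obtain ⟨m, p, hp, -⟩ := exists_fine_chain hD (γ := γ.extend) γ.continuous_extend.continuousOn
    (fun t _ => by
      rw [Path.extend_apply _ ‹_›]
      exact hγ _) one_pos
  simp only [Path.extend_zero, Path.extend_one] at hp
  exact ⟨m, p, hp⟩

lemma exists_arc_diam_lt (hD : IsProperDomain D) (hx : x ∈ D) (hy : y ∈ D) {r : ℝ}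
    (hr : innerDiam D x y < r) :
    ∃ γ, IsArcIn D x y γ ∧ Metric.diam (γ '' Icc 0 1) < r := by
  obtain ⟨m, p, hp⟩ := exists_chain hD hx hy
  obtain ⟨γ₀, hγ₀, -⟩ := hp.exists_arc hD hx
  obtain ⟨_, ⟨γ, hγ, rfl⟩, h⟩ := exists_lt_of_csInf_lt
    (s := {r | ∃ γ : ℝ → EuclideanSpace ℝ (Fin n),
      IsArcIn D x y γ ∧ r = Metric.diam (γ '' Icc 0 1)}) ⟨_, γ₀, hγ₀, rfl⟩ hr
  exact ⟨γ, hγ, h⟩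

lemma dist_le_innerDiam (hD : IsProperDomain D) (hx : x ∈ D) (hy : y ∈ D) :
    dist x y ≤ innerDiam D x y := by
  refine le_of_forall_gt_imp_ge_of_dense fun r hr => ?_
  obtain ⟨γ, hγ, h⟩ := exists_arc_diam_lt hD hx hy hr
  refine le_trans ?_ h.le
  exact Metric.dist_le_diam_of_mem hγ.toIsPathIn.isCompact_image.isBounded
    ⟨0, by simp, hγ.source⟩ ⟨1, by simp, hγ.target⟩

lemma innerDiam_triangle (hD : IsProperDomain D) (hx : x ∈ D) (hy : y ∈ D) (hz : z ∈ D) :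
    innerDiam D x z ≤ innerDiam D x y + innerDiam D y z := by
  refine le_of_forall_pos_le_add fun ε hε => ?_
  obtain ⟨γ, hγ, h⟩ := exists_arc_diam_lt hD hx hy
    (show innerDiam D x y < innerDiam D x y + ε / 4 by linarith)
  obtain ⟨γ', hγ', h'⟩ := exists_arc_diam_lt hD hy hz
    (show innerDiam D y z < innerDiam D y z + ε / 4 by linarith)
  obtain ⟨m, p, hp, hstep, hmem⟩ := exists_fine_chain hD hγ.continuousOn hγ.mapsTo
    (show 0 < ε / 4 by positivity)
  obtain ⟨m', p', hp', hstep', hmem'⟩ := exists_fine_chain hD hγ'.continuousOn hγ'.mapsTo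
    (show 0 < ε / 4 by positivity)
  rw [hγ.source, hγ.target] at hp
  rw [hγ'.source, hγ'.target] at hp'
  set S := γ '' Icc 0 1 ∪ γ' '' Icc 0 1 with hS
  have hSb : Bornology.IsBounded S :=
    hγ.toIsPathIn.isCompact_image.isBounded.union hγ'.toIsPathIn.isCompact_image.isBounded
  -- Two arcs put together need not be injective, so fine chains are concatenated instead. The
  -- relation also records the step size and membership in S, which makes both survive the
  -- concatenation.
  have hc : HasChain (fun u v => Step D u v ∧ dist u v ≤ ε / 4 ∧ u ∈ S ∧ v ∈ S) (m + m') x z :=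
    HasChain.trans
      ⟨p, hp.source, hp.target, fun i hi => ⟨hp.step i hi, hstep i hi, Or.inl (hmem i hi.le),
        Or.inl (hmem _ hi)⟩⟩
      ⟨p', hp'.source, hp'.target, fun i hi => ⟨hp'.step i hi, hstep' i hi,
        Or.inr (hmem' i hi.le), Or.inr (hmem' _ hi)⟩⟩
  obtain ⟨q, hq0, hq1, hq⟩ := hc
  have := IsChainSeq.innerDiam_le_of_mem (p := q) (m := m + m') (S := S) hD hx
    ⟨hq0, hq1, fun i hi => (hq i hi).1⟩ (show 0 ≤ ε / 4 by positivity) (fun i hi => (hq i hi).2.1)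
    hSb (fun i hi => by
      rcases Nat.eq_zero_or_pos i with rfl | h
      · rw [hq0]
        exact Or.inl ⟨0, by simp, hγ.source⟩
      · have := (hq (i - 1) (by omega)).2.2.2
        rwa [show i - 1 + 1 = i by omega] at this)
  have hdiam : Metric.diam S ≤ Metric.diam (γ '' Icc 0 1) + Metric.diam (γ' '' Icc 0 1) :=
    Metric.diam_union' ⟨y, ⟨1, by simp, hγ.target⟩, ⟨0, by simp, hγ'.source⟩⟩
  linarith

lemma ofReal_innerDiam_le_innerLength (hD : IsProperDomain D) :
    ENNReal.ofReal (innerDiam D x y) ≤ innerLength D x y := by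
  refine le_iInf₂ fun γ hγ => ?_
  rw [ENNReal.ofReal_le_iff_le_toReal hγ.rectifiable]
  refine (innerDiam_le_diam_path hD hγ).trans
    (Metric.diam_le_of_forall_dist_le ENNReal.toReal_nonneg ?_)
  rintro _ ⟨s, hs, rfl⟩ _ ⟨t, ht, rfl⟩
  exact BoundedVariationOn.dist_le hγ.rectifiable hs ht

end ChainArcs

/-! ### Reversing the orientation of a path -/

section Reverse

variable {n : ℕ} {D : Set (EuclideanSpace ℝ (Fin n))} {x y : EuclideanSpace ℝ (Fin n)}
  {γ : ℝ → EuclideanSpace ℝ (Fin n)}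

lemma image_one_sub_Icc {X : Type*} (γ : ℝ → X) (a b : ℝ) :
    (fun t => γ (1 - t)) '' Icc a b = γ '' Icc (1 - b) (1 - a) := by
  rw [← Function.comp_def γ, image_comp, image_const_sub_Icc]

lemma IsPathIn.reverse (h : IsPathIn D x y γ) : IsPathIn D y x (fun t => γ (1 - t)) := by
  have hmaps : MapsTo (fun t : ℝ => 1 - t) (Icc 0 1) (Icc 0 1) := fun t ht =>
    ⟨by linarith [ht.2], by linarith [ht.1]⟩
  refine ⟨h.continuousOn.comp (by fun_prop) hmaps, ?_, h.mapsTo.comp hmaps, by simp [h.target],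
    by simp [h.source]⟩
  exact ne_top_of_le_ne_top h.rectifiable (eVariationOn.comp_le_of_antitoneOn γ
    (fun t : ℝ => 1 - t) (fun s _ t _ hst => by linarith) hmaps)

lemma IsPathIn.eVariationOn_reverse_le :
    eVariationOn (fun t => γ (1 - t)) (Icc 0 1) ≤ eVariationOn γ (Icc 0 1) :=
  eVariationOn.comp_le_of_antitoneOn γ (fun t : ℝ => 1 - t) (fun s _ t _ hst => by linarith)
    fun t ht => ⟨by linarith [ht.2], by linarith [ht.1]⟩

lemma IsArcIn.reverse (h : IsArcIn D x y γ) : IsArcIn D y x (fun t => γ (1 - t)) := by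
  have hmaps : MapsTo (fun t : ℝ => 1 - t) (Icc 0 1) (Icc 0 1) := fun t ht =>
    ⟨by linarith [ht.2], by linarith [ht.1]⟩
  refine ⟨h.toIsPathIn.reverse, h.injOn_or_const.imp (fun hinj => ?_) (fun hc t ht => ?_)⟩
  · exact hinj.comp (sub_right_injective.injOn) hmaps
  · rw [hc _ (hmaps ht), ← h.target, hc 1 (by simp)]

lemma innerDiam_comm (hD : IsProperDomain D) (hx : x ∈ D) (hy : y ∈ D) :
    innerDiam D x y = innerDiam D y x := by
  have key : ∀ {x y}, x ∈ D → y ∈ D → innerDiam D x y ≤ innerDiam D y x := by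
    intro x y hx hy
    refine le_of_forall_gt_imp_ge_of_dense fun r hr => ?_
    obtain ⟨γ, hγ, h⟩ := exists_arc_diam_lt hD hy hx hr
    have := innerDiam_le_diam hγ.reverse
    rw [image_one_sub_Icc, sub_self, sub_zero] at this
    exact this.trans h.le
  exact le_antisymm (key hx hy) (key hy hx)

end Reverse

/-! ### Chains of logarithmic length give uniform arcs -/

/-- Any two points are joined by a chain whose length is controlled by `j'_D`. -/
def ChainBound {n : ℕ} (D : Set (EuclideanSpace ℝ (Fin n))) (A : ℝ) : Prop :=
  ∀ x ∈ D, ∀ y ∈ D, ∃ m : ℕ, (m : ℝ) ≤ A * (jPrime D x y + 1) ∧ HasChain (Step D) m x y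

/-- Inner uniformity with the length controlled by the inner diameter metric. -/
def IsStronglyInnerUniform {n : ℕ} (D : Set (EuclideanSpace ℝ (Fin n))) (c : ℝ) : Prop :=
  ∀ x ∈ D, ∀ y ∈ D, ∃ γ : ℝ → EuclideanSpace ℝ (Fin n), IsArcIn D x y γ ∧
    (∀ t ∈ Icc (0 : ℝ) 1,
      min (eVariationOn γ (Icc 0 t)) (eVariationOn γ (Icc t 1)) ≤
        ENNReal.ofReal (c * bdist D (γ t))) ∧
    eVariationOn γ (Icc 0 1) ≤ ENNReal.ofReal (c * innerDiam D x y)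

section ChainBound

variable {n : ℕ} {D : Set (EuclideanSpace ℝ (Fin n))} {x y : EuclideanSpace ℝ (Fin n)}
  {p : ℕ → EuclideanSpace ℝ (Fin n)} {m : ℕ}

lemma IsChainSeq.innerDiam_le_sum_Ico (hD : IsProperDomain D) (hx : x ∈ D)
    (hp : IsChainSeq (Step D) m x y p) {i j : ℕ} (hij : i ≤ j) (hj : j ≤ m) :
    innerDiam D (p i) (p j) ≤ ∑ k ∈ Finset.Ico i j, bdist D (p k) := by
  refine ((hp.sub hij hj).innerDiam_le_sum hD (hp.mem hx (hij.trans hj))).trans ?_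
  rw [Finset.sum_Ico_eq_sum_range]
  refine Finset.sum_le_sum fun k hk => ?_
  have h1 := (hp.step (i + k) (by simp at hk; omega)).3
  have h2 := bdist_pos hD (hp.mem hx (i := i + k) (by simp at hk; omega))
  rw [add_assoc] at h1
  linarith

/-- Subchains of a shortest chain are shortest, so `ChainBound` applied to two members bounds their
index difference; the inner diameter distance occurring there is at most the sum of the boundary
distances in between. -/
lemma IsChainSeq.isTame (hD : IsProperDomain D) (hx : x ∈ D) {A : ℝ} (hA : 1 ≤ A)
    (hc : ChainBound D A) (hp : IsChainSeq (Step D) m x y p)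
    (hmin : ∀ k, HasChain (Step D) k x y → m ≤ k) : IsTame A m (fun i => bdist D (p i)) := by
  have hpos : ∀ i ≤ m, 0 < bdist D (p i) := fun i hi => bdist_pos hD (hp.mem hx hi)
  refine ⟨hpos, fun i hi => (hp.step i hi).bdist_le, fun i hi => (hp.step i hi).symm.bdist_le,
    fun i j hij hj => ?_⟩
  obtain ⟨k, hk, hck⟩ := hc _ (hp.mem hx (hij.trans hj)) _ (hp.mem hx hj)
  have h1 : ((j - i : ℕ) : ℝ) ≤ k := by exact_mod_cast hp.sub_le_of_minimal hmin hij hj hck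
  have hmin' : 0 < min (bdist D (p i)) (bdist D (p j)) :=
    lt_min (hpos i (hij.trans hj)) (hpos j hj)
  have h2 : innerDiam D (p i) (p j) ≤ ∑ k ∈ Finset.Icc i j, bdist D (p k) := by
    refine (hp.innerDiam_le_sum_Ico hD hx hij hj).trans ?_
    exact Finset.sum_le_sum_of_subset_of_nonneg Finset.Ico_subset_Icc_self
      fun k _ _ => Metric.infDist_nonneg
  have h3 := innerDiam_nonneg D (p i) (p j)
  refine (h1.trans hk).trans ?_
  unfold jPrime
  gcongr

/-- Close points need separate treatment, since the additive constant in `ChainBound` gives no bound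
proportional to a small distance. The segment itself serves. -/
lemma exists_arc_of_step (hD : IsProperDomain D) (h : Step D x y) :
    ∃ γ, IsArcIn D x y γ ∧
      (∀ t ∈ Icc (0 : ℝ) 1, min (eVariationOn γ (Icc 0 t)) (eVariationOn γ (Icc t 1)) ≤
        ENNReal.ofReal (bdist D (γ t))) ∧
      eVariationOn γ (Icc 0 1) ≤ ENNReal.ofReal (innerDiam D x y) := by
  obtain ⟨p, hp⟩ := HasChain.single h
  obtain ⟨γ, hγ, hlen, hpos⟩ := hp.exists_arc hD h.1
  have hp0 := hp.source
  have hp1 := hp.target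
  have hsum : ∑ k ∈ Finset.range 1, dist (p k) (p (k + 1)) = dist x y := by
    simp [hp0, hp1]
  rw [hsum] at hlen
  refine ⟨γ, hγ, fun t ht => ?_,
    hlen.trans (ENNReal.ofReal_le_ofReal (dist_le_innerDiam hD h.1 h.2))⟩
  refine (min_le_left _ _).trans (((eVariationOn.mono γ (Icc_subset_Icc_right ht.2)).trans
    hlen).trans (ENNReal.ofReal_le_ofReal ?_))
  have h1 : bdist D x ≤ 2 * bdist D (γ t) := by
    rcases hpos t ht with ⟨hx, -⟩ | ⟨i, hi, hi1, -⟩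
    · rw [hx]
      linarith [bdist_pos hD h.1]
    · obtain rfl : i = 0 := by omega
      rw [zero_add, hp0, hp1] at hi1
      exact h.bdist_le_of_mem_segment hi1
  linarith [h.3]

/-- On a shortest chain joining points which are not close to each other, the distance to the
boundary is controlled by the inner diameter metric. -/
lemma exists_bdist_le_innerDiam {A K : ℝ} (hA : 1 ≤ A) (hK : 1 ≤ K) :
    ∃ C : ℝ, 2 ≤ C ∧ ∀ {n : ℕ} {D : Set (EuclideanSpace ℝ (Fin n))}
      {x y : EuclideanSpace ℝ (Fin n)} {m : ℕ} {p : ℕ → EuclideanSpace ℝ (Fin n)},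
      IsProperDomain D → ChainBound D A → x ∈ D → y ∈ D → ¬ Step D x y →
      IsChainSeq (Step D) m x y p → (∀ k, HasChain (Step D) k x y → m ≤ k) → ∀ q ≤ m,
      (∀ l ≤ q, ∑ k ∈ Finset.Icc 0 l, bdist D (p k) ≤ K * bdist D (p l)) →
      (∀ l, q ≤ l → l ≤ m → ∑ k ∈ Finset.Icc l m, bdist D (p k) ≤ K * bdist D (p l)) →
      bdist D (p q) ≤ C * innerDiam D x y := by
  obtain ⟨N, hN⟩ := exists_nat_ge (A * (Real.log (1 + (4 * K + 1)) + 1))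
  have h2N : (1 : ℝ) ≤ 2 ^ N := one_le_pow₀ one_le_two
  refine ⟨6 * 2 ^ N, by linarith, ?_⟩
  intro n D x y m p hD hc hx hy hxy hp hmin q hq hleft hright
  -- As x and y are not close, one of them has boundary distance below 2 |x - y|, and hence the
  -- other below 3 |x - y|.
  set T := 3 * innerDiam D x y with hT
  have hdist := dist_le_innerDiam hD hx hy
  have hpos : ∀ i ≤ m, 0 < bdist D (p i) := fun i hi => bdist_pos hD (hp.mem hx hi)
  have htame := hp.isTame hD hx hA hc hmin
  have hends : bdist D x ≤ T ∧ bdist D y ≤ T := by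
    have h1 := bdist_le_add_dist (D := D) x y
    have h2 := bdist_le_add_dist (D := D) y x
    rw [dist_comm] at h2
    have h3 : bdist D x / 2 < dist x y ∨ bdist D y / 2 < dist x y := by
      by_contra! hcon
      exact hxy ⟨hx, hy, hcon.1, hcon.2⟩
    rcases h3 with h3 | h3 <;> constructor <;> linarith
  have hT0 : 0 < T := (bdist_pos hD hx).trans_le hends.1
  rcases le_or_gt (bdist D (p q)) T with hle | hlt
  · nlinarith
  classical
  -- The first index i and the last index j at which the level T is reached; neighbouring terms
  -- differ by at most a factor 2, so the level is overshot at most to 2T.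
  obtain ⟨i, hiq, hiT, hi2⟩ : ∃ i ≤ q, T ≤ bdist D (p i) ∧ bdist D (p i) ≤ 2 * T := by
    have hex : ∃ i, T ≤ bdist D (p i) := ⟨q, hlt.le⟩
    have hfq : Nat.find hex ≤ q := Nat.find_min' hex hlt.le
    refine ⟨Nat.find hex, hfq, Nat.find_spec hex, ?_⟩
    rcases Nat.eq_zero_or_pos (Nat.find hex) with h | h
    · rw [h, hp.source]
      linarith [hends.1]
    · have h1 := Nat.find_min hex (m := Nat.find hex - 1) (by omega)
      have h2 := htame.succ_le (Nat.find hex - 1) (by omega)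
      simp only [show Nat.find hex - 1 + 1 = Nat.find hex by omega] at h2
      linarith
  obtain ⟨j, hqj, hjm, hjT, hj2⟩ : ∃ j, q ≤ j ∧ j ≤ m ∧ T ≤ bdist D (p j) ∧
      bdist D (p j) ≤ 2 * T := by
    set j := Nat.findGreatest (fun j => T ≤ bdist D (p j)) m with hj
    have hjm : j ≤ m := Nat.findGreatest_le m
    refine ⟨j, Nat.le_findGreatest hq hlt.le, hjm,
      Nat.findGreatest_spec (P := fun j => T ≤ bdist D (p j)) hq hlt.le, ?_⟩
    rcases hjm.eq_or_lt with h | h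
    · rw [h, hp.target]
      linarith [hends.2]
    · have h1 := Nat.findGreatest_is_greatest (P := fun j => T ≤ bdist D (p j))
        (show Nat.findGreatest _ m < j + 1 by omega) (by omega)
      have h2 := htame.le_succ j h
      linarith
  have hpi := hp.mem hx (hiq.trans hq)
  have hpj := hp.mem hx hjm
  have h1 : innerDiam D (p i) x ≤ 2 * K * T := by
    rw [innerDiam_comm hD hpi hx]
    have := hp.innerDiam_le_sum_Ico hD hx (Nat.zero_le i) (hiq.trans hq)
    rw [hp.source] at this
    refine this.trans ((Finset.sum_le_sum_of_subset_of_nonneg Finset.Ico_subset_Icc_self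
      fun k _ _ => Metric.infDist_nonneg).trans ((hleft i hiq).trans ?_))
    nlinarith
  have h2 : innerDiam D y (p j) ≤ 2 * K * T := by
    rw [innerDiam_comm hD hy hpj]
    have := hp.innerDiam_le_sum_Ico hD hx hjm le_rfl
    rw [hp.target] at this
    refine this.trans ((Finset.sum_le_sum_of_subset_of_nonneg Finset.Ico_subset_Icc_self
      fun k _ _ => Metric.infDist_nonneg).trans ((hright j hqj hjm).trans ?_))
    nlinarith
  -- Going from p i back to x, on to y and then to p j bounds the inner diameter distance by a
  -- multiple of T, which is at most the boundary distance at either point. So `ChainBound` and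
  -- minimality leave at most N steps between i and j, and the maximum in between exceeds 2T at most
  -- by the factor 2 ^ N.
  have h3 : innerDiam D (p i) (p j) ≤ (4 * K + 1) * T := by
    have h4 := innerDiam_triangle hD hpi hx hpj
    have h5 := innerDiam_triangle hD hx hy hpj
    have : innerDiam D x y ≤ T := by linarith
    linarith
  have hTmin : T ≤ min (bdist D (p i)) (bdist D (p j)) := le_min hiT hjT
  have hj' : jPrime D (p i) (p j) ≤ Real.log (1 + (4 * K + 1)) := by
    unfold jPrime
    have h0 : 0 ≤ innerDiam D (p i) (p j) / min (bdist D (p i)) (bdist D (p j)) :=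
      div_nonneg (innerDiam_nonneg _ _ _) (hT0.le.trans hTmin)
    refine Real.log_le_log (by linarith) (by
      gcongr
      rw [div_le_iff₀ (hT0.trans_le hTmin)]
      refine h3.trans ?_
      gcongr)
  obtain ⟨k, hk, hck⟩ := hc _ hpi _ hpj
  have hkN : j - i ≤ N := by
    have h4 := hp.sub_le_of_minimal hmin (hiq.trans hqj) hjm hck
    have h5 : (k : ℝ) ≤ N := hk.trans (le_trans (by gcongr) hN)
    exact h4.trans (by exact_mod_cast h5)
  have h6 := (htame.le_two_pow (i := i) (k := q - i) (by omega)).1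
  simp only [show i + (q - i) = q by omega] at h6
  have h7 : (2 : ℝ) ^ (q - i) ≤ 2 ^ N := pow_le_pow_right₀ one_le_two (by omega)
  calc bdist D (p q) ≤ 2 ^ (q - i) * bdist D (p i) := h6
    _ ≤ 2 ^ N * (2 * T) := mul_le_mul h7 hi2 Metric.infDist_nonneg (by positivity)
    _ = _ := by rw [hT]; ring

/-- The arc is extracted from a shortest chain. Up to the member farthest from the boundary the
lengths of the steps sum up to a multiple of the current boundary distance, and symmetrically after
it; the total is controlled by the largest boundary distance. -/
theorem ChainBound.exists_isStronglyInnerUniform {A : ℝ} (hA : 1 ≤ A) :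
    ∃ C : ℝ, 1 ≤ C ∧ ∀ {n : ℕ} {D : Set (EuclideanSpace ℝ (Fin n))}, IsProperDomain D →
      ChainBound D A → IsStronglyInnerUniform D C := by
  obtain ⟨K, hK, hsum⟩ := IsTame.exists_sum_Icc_le hA
  obtain ⟨C, hC, hbd⟩ := exists_bdist_le_innerDiam hA hK
  refine ⟨K * C, by nlinarith, fun {n D} hD hc x hx y hy => ?_⟩
  have hKC : 2 * K ≤ K * C := by nlinarith
  by_cases hxy : Step D x y
  · obtain ⟨γ, hγ, h1, h2⟩ := exists_arc_of_step hD hxy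
    refine ⟨γ, hγ, fun t ht => (h1 t ht).trans (ENNReal.ofReal_le_ofReal ?_),
      h2.trans (ENNReal.ofReal_le_ofReal ?_)⟩
    · exact le_mul_of_one_le_left Metric.infDist_nonneg (by nlinarith)
    · exact le_mul_of_one_le_left (innerDiam_nonneg _ _ _) (by nlinarith)
  obtain ⟨_, hm₀⟩ := exists_chain hD hx hy
  obtain ⟨m, p, -, hp, hmin⟩ := hm₀.exists_minimal
  have htame := hp.isTame hD hx hA hc hmin
  obtain ⟨q, hq, hmax⟩ : ∃ q ≤ m, ∀ i ≤ m, bdist D (p i) ≤ bdist D (p q) := by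
    obtain ⟨q, hq, h⟩ := Finset.exists_max_image (Finset.range (m + 1)) (fun i => bdist D (p i))
      ⟨0, by simp⟩
    exact ⟨q, by simpa [Nat.lt_succ_iff] using hq, fun i hi => h i (by simpa [Nat.lt_succ_iff])⟩
  obtain ⟨hleft, hright⟩ := hsum m _ htame q hq hmax
  have hdq := hbd hD hc hx hy hxy hp hmin q hq hleft hright
  obtain ⟨γ, hγ, hlen, hpos⟩ := hp.exists_arc hD hx
  have hsteps : ∀ i < m, dist (p i) (p (i + 1)) ≤ bdist D (p i) / 2 := fun i hi => (hp.step i hi).3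
  have hbn : ∀ i, 0 ≤ bdist D (p i) := fun i => Metric.infDist_nonneg
  have hsteps' : ∀ s : Finset ℕ, (∀ k ∈ s, k < m) → ∑ k ∈ s, dist (p k) (p (k + 1)) ≤
      (∑ k ∈ s, bdist D (p k)) / 2 := by
    intro s hs
    rw [Finset.sum_div]
    exact Finset.sum_le_sum fun k hk => hsteps k (hs k hk)
  have hl : ∀ i < m, i ≤ q → ∑ k ∈ Finset.range (i + 1), dist (p k) (p (k + 1)) ≤
      K * bdist D (p i) / 2 := by
    intro i hi hiq
    refine (hsteps' _ fun k hk => by simp at hk; omega).trans ?_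
    rw [Finset.range_eq_Ico, Finset.Ico_add_one_right_eq_Icc]
    linarith [hleft i hiq]
  have hr : ∀ i ≤ m, q ≤ i → ∑ k ∈ Finset.Ico i m, dist (p k) (p (k + 1)) ≤
      K * bdist D (p i) / 2 := by
    intro i hi hqi
    refine (hsteps' _ fun k hk => by simp at hk; omega).trans ?_
    have := Finset.sum_le_sum_of_subset_of_nonneg (Finset.Ico_subset_Icc_self (a := i) (b := m))
      (f := fun k => bdist D (p k)) fun k _ _ => hbn k
    linarith [hright i hqi hi]
  refine ⟨γ, hγ, fun t ht => ?_, hlen.trans (ENNReal.ofReal_le_ofReal ?_)⟩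
  · rcases hpos t ht with ⟨h, h0⟩ | ⟨i, hi, hi1, hi2, hi3⟩
    · exact (min_le_left _ _).trans (by rw [h0]; exact zero_le)
    -- The factor 2 lost between p i and a point of its segment is compensated by the steps being at
    -- most half the boundary distances.
    · have h1 := (hp.step i hi).bdist_le_of_mem_segment hi1
      have h2 : K * bdist D (p i) / 2 ≤ K * C * bdist D (γ t) := by
        have : 0 ≤ bdist D (γ t) := Metric.infDist_nonneg
        nlinarith
      rcases le_total i q with hiq | hqi
      · exact (min_le_left _ _).trans (hi2.trans (ENNReal.ofReal_le_ofReal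
          ((hl i hi hiq).trans h2)))
      · exact (min_le_right _ _).trans (hi3.trans (ENNReal.ofReal_le_ofReal
          ((hr i hi.le hqi).trans h2)))
  · rw [Finset.range_eq_Ico, ← Finset.sum_Ico_consecutive _ (Nat.zero_le q) hq]
    have h1 := hr q hq le_rfl
    have h2 : ∑ k ∈ Finset.Ico 0 q, dist (p k) (p (k + 1)) ≤ K * bdist D (p q) / 2 := by
      refine (hsteps' _ fun k hk => by simp at hk; omega).trans ?_
      have := Finset.sum_le_sum_of_subset_of_nonneg (Finset.Ico_subset_Icc_self (a := 0) (b := q))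
        (f := fun k => bdist D (p k)) fun k _ _ => hbn k
      linarith [hleft q le_rfl]
    nlinarith

end ChainBound

/-! ### Consequences of strong inner uniformity -/

section Strong

variable {n : ℕ} {D : Set (EuclideanSpace ℝ (Fin n))} {C C' : ℝ}

lemma IsStronglyInnerUniform.isInnerUniform (hD : IsProperDomain D) (hC : 0 ≤ C)
    (h : IsStronglyInnerUniform D C) : IsInnerUniform D C := by
  intro x hx y hy
  obtain ⟨γ, hγ, h1, h2⟩ := h x hx y hy
  refine ⟨γ, hγ, h1, h2.trans ?_⟩
  rw [ENNReal.ofReal_mul hC]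
  gcongr
  exact ofReal_innerDiam_le_innerLength hD

lemma diam_image_le {E : Type*} [PseudoMetricSpace E] {γ : ℝ → E} {s : Set ℝ} {r : ℝ} (hr : 0 ≤ r)
    (h : eVariationOn γ s ≤ ENNReal.ofReal r) : Metric.diam (γ '' s) ≤ r := by
  refine Metric.diam_le_of_forall_dist_le hr ?_
  rintro _ ⟨a, ha, rfl⟩ _ ⟨b, hb, rfl⟩
  have := (eVariationOn.edist_le γ ha hb).trans h
  rw [edist_dist] at this
  exact (ENNReal.ofReal_le_ofReal_iff hr).1 this

lemma min_diam_le {E : Type*} [PseudoMetricSpace E] {γ : ℝ → E} {s s' : Set ℝ} {r : ℝ} (hr : 0 ≤ r)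
    (h : min (eVariationOn γ s) (eVariationOn γ s') ≤ ENNReal.ofReal r) :
    min (Metric.diam (γ '' s)) (Metric.diam (γ '' s')) ≤ r := by
  rcases min_le_iff.1 h with h | h
  · exact (min_le_left _ _).trans (diam_image_le hr h)
  · exact (min_le_right _ _).trans (diam_image_le hr h)

lemma IsStronglyInnerUniform.isDiamInnerUniform (hC : 0 ≤ C)
    (h : IsStronglyInnerUniform D C) : IsDiamInnerUniform D C := by
  intro x hx y hy
  obtain ⟨γ, hγ, h1, h2⟩ := h x hx y hy
  exact ⟨γ, hγ, fun t ht => min_diam_le (mul_nonneg hC Metric.infDist_nonneg) (h1 t ht),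
    diam_image_le (mul_nonneg hC (innerDiam_nonneg _ _ _)) h2⟩

lemma IsStronglyInnerUniform.mono (hCC : C ≤ C') (h : IsStronglyInnerUniform D C) :
    IsStronglyInnerUniform D C' := by
  intro x hx y hy
  obtain ⟨γ, hγ, h1, h2⟩ := h x hx y hy
  refine ⟨γ, hγ, fun t ht => (h1 t ht).trans (ENNReal.ofReal_le_ofReal ?_),
    h2.trans (ENNReal.ofReal_le_ofReal ?_)⟩
  · exact mul_le_mul_of_nonneg_right hCC Metric.infDist_nonneg
  · exact mul_le_mul_of_nonneg_right hCC (innerDiam_nonneg _ _ _)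

end Strong

/-! ### Chains along a path from packing and from monotone growth -/

section Covering

variable {n : ℕ} {D : Set (EuclideanSpace ℝ (Fin n))} {x y : EuclideanSpace ℝ (Fin n)}

/-- If pairwise unrelated members of a shortest chain number at most `M`, the chain has at most
`2 * M` steps. -/
lemma IsChainSeq.le_of_card_le {X : Type*} {R : X → X → Prop} {m M : ℕ} {x y : X} {p : ℕ → X}
    (h : IsChainSeq R m x y p) (hmin : ∀ k, HasChain R k x y → m ≤ k)
    (hM : ∀ (k : ℕ) (f : ℕ → X), (∀ i < k, ∃ l ≤ m, f i = p l) →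
      (∀ i < k, ∀ j < k, i < j → ¬ R (f i) (f j)) → k ≤ M) : m ≤ 2 * M := by
  -- The members with even index are pairwise unrelated.
  have := hM (m / 2 + 1) (fun i => p (2 * i)) (fun i hi => ⟨2 * i, by omega, rfl⟩)
    (fun i hi j hj hij => h.not_rel_of_minimal hmin (by omega) (by omega))
  omega

/-- A path which stays away from the boundary at a distance comparable with its diameter can be
replaced by a chain of bounded length. -/
lemma exists_hasChain_of_dist_le (n : ℕ) (A : ℝ) :
    ∃ M : ℕ, ∀ {D : Set (EuclideanSpace ℝ (Fin n))}, IsProperDomain D →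
      ∀ {γ : ℝ → EuclideanSpace ℝ (Fin n)} {a b : ℝ}, a ≤ b → ContinuousOn γ (Icc a b) →
      MapsTo γ (Icc a b) D → ∀ {r : ℝ}, 0 < r → (∀ t ∈ Icc a b, r ≤ bdist D (γ t)) →
      (∀ t ∈ Icc a b, dist (γ t) (γ a) ≤ A * r) → HasChain (Step D) M (γ a) (γ b) := by
  obtain ⟨M, hM⟩ := exists_card_le_of_separated_ball (EuclideanSpace ℝ (Fin n)) (4 * A)
  refine ⟨2 * M, fun {D} hD {γ a b} hab hcont hmaps {r} hr hbd hdist => ?_⟩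
  have hmem : ∀ t ∈ Icc (0 : ℝ) 1, a + (b - a) * t ∈ Icc a b := fun t ht =>
    ⟨by nlinarith [ht.1], by nlinarith [ht.2]⟩
  obtain ⟨m, p, hp, hstep, hpS⟩ := exists_fine_chain hD
    (γ := fun t => γ (a + (b - a) * t)) (hcont.comp (by fun_prop) hmem)
    (fun t ht => hmaps (hmem t ht)) (show 0 < r / 4 by positivity)
  set S := γ '' Icc a b with hS
  have hpS' : ∀ i ≤ m, p i ∈ S := fun i hi => by
    obtain ⟨t, ht, h⟩ := hpS i hi
    exact ⟨_, hmem t ht, h⟩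
  -- Chains are restricted to points of the curve, so that the members of a shortest one remain in
  -- the ball of radius A r. Unrelated members are r / 4 apart, which explains the packing constant
  -- 4 A.
  set R : EuclideanSpace ℝ (Fin n) → EuclideanSpace ℝ (Fin n) → Prop :=
    fun u v => u ∈ S ∧ v ∈ S ∧ dist u v ≤ r / 4 with hR
  have hchain : HasChain R m (γ a) (γ b) :=
    ⟨p, by simpa using hp.source, by simpa using hp.target,
      fun i hi => ⟨hpS' i hi.le, hpS' _ hi, hstep i hi⟩⟩
  obtain ⟨k, q, -, hq, hmin⟩ := hchain.exists_minimal
  have hRStep : ∀ u v, R u v → Step D u v := by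
    rintro u v ⟨⟨t, ht, rfl⟩, hv, h⟩
    exact Step.of_dist_le hD (hmaps ht) (by linarith [hbd t ht])
  have hqS : ∀ l ≤ k, q l ∈ S := by
    intro l hl
    rcases Nat.eq_zero_or_pos l with rfl | h
    · rw [hq.source]
      exact ⟨a, ⟨le_rfl, hab⟩, rfl⟩
    · have := (hq.step (l - 1) (by omega)).2.1
      rwa [show l - 1 + 1 = l by omega] at this
  have hk : k ≤ 2 * M := by
    refine hq.le_of_card_le hmin fun j f hf hsep => ?_
    have hfS : ∀ i < j, f i ∈ S := fun i hi => by
      obtain ⟨l, hl, h⟩ := hf i hi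
      rw [h]
      exact hqS l hl
    refine hM (r / 4) (by positivity) j f (γ a) (fun i hi => ?_) fun i hi l hl hil => ?_
    · obtain ⟨t, ht, h⟩ := hfS i hi
      rw [← h]
      linarith [hdist t ht]
    · by_contra! hcon
      exact hsep i hi l hl hil ⟨hfS i hi, hfS l hl, hcon.le⟩
  have hchain' : HasChain (Step D) k (γ a) (γ b) := HasChain.imp ⟨q, hq⟩ hRStep
  exact hchain'.mono (Step.refl hD (hmaps ⟨hab, le_rfl⟩)) hk

lemma exists_step_of_continuousOn (hD : IsProperDomain D) {γ : ℝ → EuclideanSpace ℝ (Fin n)}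
    {a b : ℝ} (hcont : ContinuousOn γ (Icc a b)) (hmaps : MapsTo γ (Icc a b) D) {t : ℝ}
    (ht : t ∈ Icc a b) : ∃ ε > 0, ∀ s ∈ Icc a b, |s - t| < ε → Step D (γ t) (γ s) := by
  have hpos := bdist_pos hD (hmaps ht)
  obtain ⟨ε, hε, h⟩ := Metric.continuousWithinAt_iff.1 (hcont t ht) (bdist D (γ t) / 4)
    (by positivity)
  refine ⟨ε, hε, fun s hs hst => Step.of_dist_le hD (hmaps ht) ?_⟩
  rw [dist_comm]
  exact (h hs (by rwa [Real.dist_eq])).le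

lemma exists_hasChain_of_monotoneOn (hD : IsProperDomain D) {γ : ℝ → EuclideanSpace ℝ (Fin n)}
    {Φ : ℝ → ℝ} {b δ : ℝ} {M : ℕ} (hδ : 0 < δ) (hb : 0 ≤ b) (hcont : ContinuousOn γ (Icc 0 b))
    (hmaps : MapsTo γ (Icc 0 b) D) (hΦ : MonotoneOn Φ (Icc 0 b))
    (h : ∀ s t, 0 ≤ s → s ≤ t → t ≤ b → Φ t - Φ s < δ → HasChain (Step D) M (γ s) (γ t)) :
    ∃ m : ℕ, (m : ℝ) ≤ (M + 2) * ((Φ b - Φ 0) / δ + 1) ∧ HasChain (Step D) m (γ 0) (γ b) := by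
  have h0 : 0 ≤ (Φ b - Φ 0) / δ :=
    div_nonneg (sub_nonneg.2 (hΦ ⟨le_rfl, hb⟩ ⟨hb, le_rfl⟩ hb)) hδ.le
  refine ⟨(⌊(Φ b - Φ 0) / δ⌋₊ + 1) * (M + 2), ?_,
    hasChain_of_monotoneOn hδ (fun t ht ht0 => Step.refl hD (hmaps ⟨ht0, ht⟩)) (fun t ht => ?_)
      hΦ h _ 0 le_rfl hb ?_⟩
  · push_cast
    rw [mul_comm]
    have := Nat.floor_le h0
    gcongr
  · obtain ⟨ε, hε, hst⟩ := exists_step_of_continuousOn hD hcont hmaps ht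
    exact ⟨ε, hε, fun s hs hs' => ⟨(hst s hs hs').symm, hst s hs hs'⟩⟩
  · rw [← div_lt_iff₀ hδ]
    push_cast
    exact Nat.lt_floor_add_one _

end Covering

/-! ### Inner uniformity in terms of diameters -/

/-- One half of a cigar. With F(t) the diameter of γ[0,t] plus half the boundary distance of γ(0),
the boundary distance along γ is at least F / (2c). While F less than doubles, packing gives
boundedly many steps, so the count is governed by the growth of log F. -/
lemma exists_hasChain_of_diam_le (n : ℕ) {c : ℝ} (hc : 1 ≤ c) :
    ∃ B : ℝ, 1 ≤ B ∧ ∀ {D : Set (EuclideanSpace ℝ (Fin n))}, IsProperDomain D →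
      ∀ {γ : ℝ → EuclideanSpace ℝ (Fin n)} {b : ℝ}, 0 ≤ b → ContinuousOn γ (Icc 0 b) →
      MapsTo γ (Icc 0 b) D →
      (∀ t ∈ Icc 0 b, Metric.diam (γ '' Icc 0 t) ≤ c * bdist D (γ t)) →
      ∃ m : ℕ, (m : ℝ) ≤
        B * (Real.log (1 + 2 * Metric.diam (γ '' Icc 0 b) / bdist D (γ 0)) + 1) ∧
        HasChain (Step D) m (γ 0) (γ b) := by
  obtain ⟨M, hM⟩ := exists_hasChain_of_dist_le n (4 * c)
  refine ⟨2 * (M + 2), by linarith [Nat.cast_nonneg (α := ℝ) M],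
    fun {D} hD {γ b} hb hcont hmaps hdiam => ?_⟩
  set d₀ := bdist D (γ 0) with hd₀
  have hd₀pos : 0 < d₀ := bdist_pos hD (hmaps ⟨le_rfl, hb⟩)
  have hbdd : ∀ t ≤ b, Bornology.IsBounded (γ '' Icc 0 t) := fun t ht =>
    ((isCompact_Icc.image_of_continuousOn hcont).isBounded).subset
      (image_mono (Icc_subset_Icc_right ht))
  set F : ℝ → ℝ := fun t => d₀ / 2 + Metric.diam (γ '' Icc 0 t) with hF
  have hFpos : ∀ t, 0 < F t := fun t => by
    have : 0 ≤ Metric.diam (γ '' Icc 0 t) := Metric.diam_nonneg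
    positivity
  have hFmono : ∀ s t, s ≤ t → t ≤ b → F s ≤ F t := fun s t hst ht => by
    have := Metric.diam_mono (image_mono (Icc_subset_Icc_right hst)) (hbdd t ht)
    simp only [hF]
    linarith
  have hFd : ∀ t ∈ Icc 0 b, F t ≤ 2 * c * bdist D (γ t) := by
    intro t ht
    have h1 := hdiam t ht
    have h2 : dist (γ 0) (γ t) ≤ Metric.diam (γ '' Icc 0 t) :=
      Metric.dist_le_diam_of_mem (hbdd t ht.2) ⟨0, ⟨le_rfl, ht.1⟩, rfl⟩ ⟨t, ⟨ht.1, le_rfl⟩, rfl⟩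
    have h3 := bdist_le_add_dist (D := D) (γ 0) (γ t)
    have h4 : 0 < bdist D (γ t) := bdist_pos hD (hmaps ht)
    simp only [hF]
    -- If the diameter is at most d₀ / 2, the point γ t is still at distance at least d₀ / 2 from
    -- the boundary; otherwise the diameter dominates F and the cigar condition applies.
    rcases le_total (Metric.diam (γ '' Icc 0 t)) (d₀ / 2) with h | h <;> nlinarith
  obtain ⟨m, hm, hchain⟩ := exists_hasChain_of_monotoneOn (Φ := fun t => Real.log (F t))
    (δ := Real.log 2) (M := M) hD (Real.log_pos one_lt_two) hb hcont hmaps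
    (fun s hs t ht hst => Real.log_le_log (hFpos s) (hFmono s t hst ht.2)) (by
      intro s t hs hst ht hlt
      rw [← Real.log_div (hFpos t).ne' (hFpos s).ne',
        Real.log_lt_log_iff (div_pos (hFpos t) (hFpos s)) two_pos, div_lt_iff₀ (hFpos s)] at hlt
      have hsub : Icc s t ⊆ Icc 0 b := Icc_subset_Icc hs ht
      have hc0 : (0 : ℝ) < 2 * c := by linarith
      -- With r = F s / (2c), the piece has diameter at most F t < 2 F s = 4c r.
      refine hM hD hst (hcont.mono hsub) (hmaps.mono_left hsub) (r := F s / (2 * c))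
        (div_pos (hFpos s) hc0) (fun u hu => ?_) fun u hu => ?_
      · rw [div_le_iff₀' hc0]
        exact (hFmono s u hu.1 (hu.2.trans ht)).trans (hFd u (hsub hu))
      · have h1 : dist (γ u) (γ s) ≤ Metric.diam (γ '' Icc 0 t) :=
          Metric.dist_le_diam_of_mem (hbdd t ht) ⟨u, ⟨hs.trans hu.1, hu.2⟩, rfl⟩
            ⟨s, ⟨hs, hst⟩, rfl⟩
        have h2 : 4 * c * (F s / (2 * c)) = 2 * F s := by
          field_simp
          ring
        have h3 : Metric.diam (γ '' Icc 0 t) ≤ F t := by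
          simp only [hF]
          linarith
        linarith)
  refine ⟨m, hm.trans ?_, hchain⟩
  have hF0 : F 0 = d₀ / 2 := by simp [hF]
  have h1 : Real.log (F b) - Real.log (F 0) =
      Real.log (1 + 2 * Metric.diam (γ '' Icc 0 b) / d₀) := by
    rw [← Real.log_div (hFpos b).ne' (hFpos 0).ne', hF0]
    congr 1
    simp only [hF]
    field_simp
  rw [h1]
  have h2 : 0 ≤ Real.log (1 + 2 * Metric.diam (γ '' Icc 0 b) / d₀) :=
    Real.log_nonneg (le_add_of_nonneg_right (by
      have : 0 ≤ Metric.diam (γ '' Icc 0 b) := Metric.diam_nonneg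
      positivity))
  have h3 : Real.log (1 + 2 * Metric.diam (γ '' Icc 0 b) / d₀) / Real.log 2 ≤
      2 * Real.log (1 + 2 * Metric.diam (γ '' Icc 0 b) / d₀) := by
    rw [div_le_iff₀ (Real.log_pos one_lt_two)]
    nlinarith [Real.log_two_gt_d9]
  have h4 : (0 : ℝ) ≤ M := Nat.cast_nonneg M
  nlinarith

/-- The arc is halved where the diameters of its initial and final parts balance. On either half the
minimum in the cigar condition is the diameter measured from the nearer end, so the estimate for
half cigars applies from both ends. -/
theorem exists_chainBound_of_isDiamInnerUniform (n : ℕ) {c : ℝ} (hc : 1 ≤ c) :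
    ∃ A : ℝ, 1 ≤ A ∧ ∀ {D : Set (EuclideanSpace ℝ (Fin n))}, IsProperDomain D →
      IsDiamInnerUniform D c → ChainBound D A := by
  obtain ⟨B, hB, hhalf⟩ := exists_hasChain_of_diam_le n hc
  have hlog : 0 ≤ Real.log (2 * c) := Real.log_nonneg (by linarith)
  refine ⟨2 * B * (Real.log (2 * c) + 1) + 2, by nlinarith, fun {D} hD h x hx y hy => ?_⟩
  obtain ⟨γ, hγ, hcig, hlen⟩ := h x hx y hy
  have hcont := hγ.continuousOn
  have hmaps := hγ.mapsTo
  have hbdd : ∀ s t, 0 ≤ s → t ≤ 1 → Bornology.IsBounded (γ '' Icc s t) := fun s t hs ht =>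
    hγ.toIsPathIn.isCompact_image.isBounded.subset (image_mono (Icc_subset_Icc hs ht))
  have hleft : ∀ s t, s ≤ t → t ≤ 1 →
      Metric.diam (γ '' Icc 0 s) ≤ Metric.diam (γ '' Icc 0 t) := fun s t hst ht =>
    Metric.diam_mono (image_mono (Icc_subset_Icc_right hst)) (hbdd 0 t le_rfl ht)
  have hright : ∀ s t, 0 ≤ s → s ≤ t →
      Metric.diam (γ '' Icc t 1) ≤ Metric.diam (γ '' Icc s 1) := fun s t hs hst =>
    Metric.diam_mono (image_mono (Icc_subset_Icc_left hst)) (hbdd s 1 hs le_rfl)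
  -- The balancing time is approached by t₁ from below and t₂ from above, so no continuity of the
  -- diameters is needed. The gap costs two steps, the summand 2 in the constant.
  set S : Set ℝ := {t | 0 ≤ t ∧ t ≤ 1 ∧ Metric.diam (γ '' Icc 0 t) ≤ Metric.diam (γ '' Icc t 1)}
    with hS
  have h0S : 0 ∈ S := ⟨le_rfl, zero_le_one, by simpa using Metric.diam_nonneg⟩
  have hSb : BddAbove S := ⟨1, fun t ht => ht.2.1⟩
  set t₀ := sSup S with ht₀
  have ht₀0 : 0 ≤ t₀ := le_csSup hSb h0S
  have ht₀1 : t₀ ≤ 1 := csSup_le ⟨0, h0S⟩ fun t ht => ht.2.1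
  obtain ⟨ε, hε, hst⟩ := exists_step_of_continuousOn hD hcont hmaps ⟨ht₀0, ht₀1⟩
  obtain ⟨t₁, ht₁, hlt⟩ := exists_lt_of_lt_csSup ⟨0, h0S⟩ (show t₀ - ε < sSup S by linarith)
  have ht₁le : t₁ ≤ t₀ := le_csSup hSb ht₁
  have hstep₁ : Step D (γ t₁) (γ t₀) := (hst t₁ ⟨ht₁.1, ht₁.2.1⟩ (by
    rw [abs_lt]; constructor <;> linarith)).symm
  obtain ⟨t₂, ht₂0, ht₂1, hstep₂, hcig₂⟩ : ∃ t₂, 0 ≤ t₂ ∧ t₂ ≤ 1 ∧ Step D (γ t₀) (γ t₂) ∧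
      ∀ s ∈ Icc t₂ 1, Metric.diam (γ '' Icc s 1) ≤ c * bdist D (γ s) := by
    rcases ht₀1.eq_or_lt with h1 | h1
    · refine ⟨1, zero_le_one, le_rfl, by rw [h1]; exact Step.refl hD (hmaps (by simp)), ?_⟩
      intro s hs
      obtain rfl : s = 1 := le_antisymm hs.2 hs.1
      simp only [Icc_self, image_singleton, Metric.diam_singleton]
      exact mul_nonneg (by linarith) Metric.infDist_nonneg
    · have hlt' : t₀ < min (t₀ + ε / 2) 1 := lt_min (by linarith) h1
      have hle' : min (t₀ + ε / 2) 1 ≤ t₀ + ε / 2 := min_le_left _ _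
      have hle1 : min (t₀ + ε / 2) 1 ≤ 1 := min_le_right _ _
      refine ⟨min (t₀ + ε / 2) 1, by linarith, hle1, hst _ ⟨by linarith, hle1⟩ (by
        rw [abs_lt]; constructor <;> linarith), fun s hs => ?_⟩
      have hs0 : 0 ≤ s := by linarith [hs.1]
      have hsS : ¬ (Metric.diam (γ '' Icc 0 s) ≤ Metric.diam (γ '' Icc s 1)) := fun hcon =>
        absurd (le_csSup hSb (show s ∈ S from ⟨hs0, hs.2, hcon⟩)) (not_le.2 (by linarith [hs.1]))
      have := hcig s ⟨hs0, hs.2⟩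
      rwa [min_eq_right (not_le.1 hsS).le] at this
  have hsub₁ : Icc 0 t₁ ⊆ Icc 0 1 := Icc_subset_Icc_right ht₁.2.1
  obtain ⟨m₁, hm₁, hc₁⟩ := hhalf hD ht₁.1 (hcont.mono hsub₁) (hmaps.mono_left hsub₁) (by
    intro t ht
    have := hcig t (hsub₁ ht)
    rwa [min_eq_left ((hleft t t₁ ht.2 ht₁.2.1).trans (ht₁.2.2.trans
      (hright t t₁ ht.1 ht.2)))] at this)
  have hmaps' : MapsTo (fun t : ℝ => 1 - t) (Icc 0 (1 - t₂)) (Icc 0 1) := fun t ht =>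
    ⟨by linarith [ht.2], by linarith [ht.1]⟩
  obtain ⟨m₂, hm₂, hc₂⟩ := hhalf hD (γ := fun t => γ (1 - t)) (b := 1 - t₂) (by linarith)
    (hcont.comp (by fun_prop) hmaps') (hmaps.comp hmaps') (by
    intro t ht
    rw [image_one_sub_Icc, sub_zero]
    exact hcig₂ _ ⟨by linarith [ht.2], by linarith [ht.1]⟩)
  rw [image_one_sub_Icc] at hm₂
  simp only [sub_zero, sub_sub_cancel, hγ.target] at hm₂ hc₂
  rw [hγ.source] at hm₁ hc₁
  have hchain := ((hc₁.trans (.single hstep₁)).trans (.single hstep₂)).trans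
    (hc₂.symm fun u v h => h.symm)
  refine ⟨_, ?_, hchain⟩
  have hdx := bdist_pos hD hx
  have hdy := bdist_pos hD hy
  have hmin : 0 < min (bdist D x) (bdist D y) := lt_min hdx hdy
  have hρ := innerDiam_nonneg D x y
  -- As 2c ≥ 1, one has 1 + 2c u ≤ 2c (1 + u), so the factor 2c costs only an additive log (2c).
  have hlogle : ∀ d e : ℝ, 0 ≤ e → e ≤ c * innerDiam D x y → 0 < d →
      min (bdist D x) (bdist D y) ≤ d →
      Real.log (1 + 2 * e / d) ≤ Real.log (2 * c) + jPrime D x y := by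
    intro d e he0 he hd hle
    have hu : 0 ≤ innerDiam D x y / min (bdist D x) (bdist D y) := by positivity
    unfold jPrime
    rw [← Real.log_mul (by linarith) (by linarith)]
    refine Real.log_le_log (by positivity) ?_
    have h1 : 2 * e / d ≤ 2 * (c * innerDiam D x y) / min (bdist D x) (bdist D y) := by gcongr
    have h2 : 2 * (c * innerDiam D x y) / min (bdist D x) (bdist D y) =
        2 * c * (innerDiam D x y / min (bdist D x) (bdist D y)) := by ring
    nlinarith
  have h1 := hlogle (bdist D x) _ Metric.diam_nonneg ((hleft t₁ 1 ht₁.2.1 le_rfl).trans hlen) hdx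
    (min_le_left _ _)
  have h2 := hlogle (bdist D y) _ Metric.diam_nonneg ((hright 0 t₂ le_rfl ht₂0).trans hlen) hdy
    (min_le_right _ _)
  have hj : 0 ≤ jPrime D x y := Real.log_nonneg (by
    have hu : 0 ≤ innerDiam D x y / min (bdist D x) (bdist D y) := by positivity
    linarith)
  push_cast
  have h3 : (m₁ : ℝ) ≤ B * (Real.log (2 * c) + jPrime D x y + 1) := hm₁.trans (by gcongr)
  have h4 : (m₂ : ℝ) ≤ B * (Real.log (2 * c) + jPrime D x y + 1) := hm₂.trans (by gcongr)
  nlinarith [mul_nonneg (mul_nonneg (by linarith : (0:ℝ) ≤ B) hlog) hj]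

/-! ### The Apollonian metric -/

section Apollonian

variable {n : ℕ} {D : Set (EuclideanSpace ℝ (Fin n))} {x y z w : EuclideanSpace ℝ (Fin n)}

lemma coe_mem_extBoundary_iff {a : EuclideanSpace ℝ (Fin n)} :
    (a : OnePoint (EuclideanSpace ℝ (Fin n))) ∈ extBoundary D ↔ a ∈ frontier D := by
  have hopen : IsOpenMap (OnePoint.some : EuclideanSpace ℝ (Fin n) → _) :=
    OnePoint.isOpenEmbedding_coe.isOpenMap
  have := hopen.preimage_frontier_eq_frontier_preimage
    OnePoint.continuous_coe ((OnePoint.some : _ → OnePoint (EuclideanSpace ℝ (Fin n))) '' D)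
  rw [preimage_image_eq _ OnePoint.coe_injective] at this
  rw [← this]
  rfl

/-- A neighbourhood of ∞ disjoint from D would have a bounded complement containing D. -/
lemma infty_mem_extBoundary (hD : IsOpen D) (hb : ¬ Bornology.IsBounded D) :
    OnePoint.infty ∈ extBoundary D := by
  have hopen : IsOpen ((OnePoint.some : _ → OnePoint (EuclideanSpace ℝ (Fin n))) '' D) :=
    OnePoint.isOpenEmbedding_coe.isOpenMap D hD
  unfold extBoundary
  rw [hopen.frontier_eq]
  refine ⟨?_, by simp⟩
  by_contra hcl
  have h1 : (closure ((OnePoint.some : _ → OnePoint (EuclideanSpace ℝ (Fin n))) '' D))ᶜ ∈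
      nhds OnePoint.infty := isClosed_closure.isOpen_compl.mem_nhds hcl
  have h2 := Filter.preimage_mem_comap (m := (OnePoint.some : EuclideanSpace ℝ (Fin n) → _)) h1
  rw [OnePoint.comap_coe_nhds_infty, Filter.coclosedCompact_eq_cocompact,
    ← Metric.cobounded_eq_cocompact, ← Bornology.isCobounded_def,
    ← Bornology.isBounded_compl_iff, ← preimage_compl,
    compl_compl] at h2
  exact hb (h2.subset fun q hq => subset_closure (mem_image_of_mem _ hq))

lemma ratio_pos (hD : IsProperDomain D) (hx : x ∈ D) (hy : y ∈ D)
    {a : OnePoint (EuclideanSpace ℝ (Fin n))} (ha : a ∈ extBoundary D) : 0 < ratio a x y := by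
  induction a using OnePoint.rec with
  | infty => exact one_pos
  | coe a =>
    have ha' := coe_mem_extBoundary_iff.1 ha
    have h1 := (bdist_pos hD hx).trans_le (bdist_le_dist ha')
    have h2 := (bdist_pos hD hy).trans_le (bdist_le_dist ha')
    rw [dist_comm] at h1 h2
    exact div_pos h1 h2

lemma ratio_le (hD : IsProperDomain D) (hy : y ∈ D)
    {a : OnePoint (EuclideanSpace ℝ (Fin n))} (ha : a ∈ extBoundary D) :
    ratio a x y ≤ 1 + dist x y / bdist D y := by
  have hpos := bdist_pos hD hy
  induction a using OnePoint.rec with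
  | infty =>
    change (1 : ℝ) ≤ _
    exact le_add_of_nonneg_right (by positivity)
  | coe a =>
    have ha' := coe_mem_extBoundary_iff.1 ha
    have h1 : bdist D y ≤ dist a y := by
      rw [dist_comm]
      exact bdist_le_dist ha'
    change dist a x / dist a y ≤ _
    rw [div_le_iff₀ (hpos.trans_le h1)]
    have h2 := dist_triangle_right a x y
    have h3 : dist x y ≤ dist x y / bdist D y * dist a y := by
      rw [div_mul_eq_mul_div, le_div_iff₀ hpos]
      gcongr
    linarith

lemma ratio_mul_ratio (hD : IsProperDomain D) (hy : y ∈ D)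
    {a : OnePoint (EuclideanSpace ℝ (Fin n))} (ha : a ∈ extBoundary D) :
    ratio a x y * ratio a y z = ratio a x z := by
  induction a using OnePoint.rec with
  | infty => exact one_mul 1
  | coe a =>
    have h := (bdist_pos hD hy).trans_le (bdist_le_dist (coe_mem_extBoundary_iff.1 ha))
    rw [dist_comm] at h
    exact div_mul_div_cancel₀ h.ne'

lemma log_ratio_mul_ratio_le (hD : IsProperDomain D) (hx : x ∈ D) (hy : y ∈ D)
    {a b : OnePoint (EuclideanSpace ℝ (Fin n))} (ha : a ∈ extBoundary D)
    (hb : b ∈ extBoundary D) :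
    Real.log (ratio a x y * ratio b y x) ≤ dist x y / bdist D y + dist x y / bdist D x := by
  have h1 := ratio_pos hD hx hy ha
  have h2 := ratio_pos hD hy hx hb
  rw [Real.log_mul h1.ne' h2.ne']
  have h3 := ratio_le (x := x) hD hy ha
  have h4 := ratio_le (x := y) hD hx hb
  rw [dist_comm y x] at h4
  have h5 := Real.log_le_sub_one_of_pos h1
  have h6 := Real.log_le_sub_one_of_pos h2
  linarith

lemma log_le_apollonian (hD : IsProperDomain D) (hx : x ∈ D) (hy : y ∈ D)
    {a b : OnePoint (EuclideanSpace ℝ (Fin n))} (ha : a ∈ extBoundary D)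
    (hb : b ∈ extBoundary D) :
    Real.log (ratio a x y * ratio b y x) ≤ apollonian D x y := by
  -- The upper bound is essential: the real supremum of an unbounded set takes the default value 0.
  refine le_csSup ⟨dist x y / bdist D y + dist x y / bdist D x, ?_⟩ ⟨a, ha, b, hb, rfl⟩
  rintro _ ⟨a, ha, b, hb, rfl⟩
  exact log_ratio_mul_ratio_le hD hx hy ha hb

lemma apollonian_le_of_forall (hD : IsProperDomain D) {r : ℝ}
    (h : ∀ a ∈ extBoundary D, ∀ b ∈ extBoundary D,
      Real.log (ratio a x y * ratio b y x) ≤ r) : apollonian D x y ≤ r := by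
  obtain ⟨a, ha⟩ := hD.frontier_nonempty
  refine csSup_le ⟨_, a, coe_mem_extBoundary_iff.2 ha, a, coe_mem_extBoundary_iff.2 ha, rfl⟩ ?_
  rintro _ ⟨a, ha, b, hb, rfl⟩
  exact h a ha b hb

lemma apollonian_le (hD : IsProperDomain D) (hx : x ∈ D) (hy : y ∈ D) :
    apollonian D x y ≤ dist x y / bdist D y + dist x y / bdist D x :=
  apollonian_le_of_forall hD fun _ ha _ hb => log_ratio_mul_ratio_le hD hx hy ha hb

lemma apollonian_triangle (hD : IsProperDomain D) (hx : x ∈ D) (hy : y ∈ D) (hz : z ∈ D) :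
    apollonian D x z ≤ apollonian D x y + apollonian D y z := by
  refine apollonian_le_of_forall hD fun a ha b hb => ?_
  have h1 := log_le_apollonian hD hx hy ha hb
  have h2 := log_le_apollonian hD hy hz ha hb
  have hp1 := mul_pos (ratio_pos hD hx hy ha) (ratio_pos hD hy hx hb)
  have hp2 := mul_pos (ratio_pos hD hy hz ha) (ratio_pos hD hz hy hb)
  have h3 : ratio a x z * ratio b z x =
      (ratio a x y * ratio b y x) * (ratio a y z * ratio b z y) := by
    rw [← ratio_mul_ratio hD hy ha, ← ratio_mul_ratio (x := z) hD hy hb]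
    ring
  rw [h3, Real.log_mul hp1.ne' hp2.ne']
  linarith

/-- Some boundary point is at least as far from `x` as from `y`. -/
lemma exists_one_le_ratio (hD : IsProperDomain D) (hx : x ∈ D) (hy : y ∈ D) :
    ∃ a ∈ extBoundary D, 1 ≤ ratio a x y := by
  by_cases hb : Bornology.IsBounded D
  · rcases eq_or_ne x y with rfl | hxy
    · obtain ⟨a, ha⟩ := hD.frontier_nonempty
      have h := (bdist_pos hD hx).trans_le (bdist_le_dist ha)
      rw [dist_comm] at h
      refine ⟨a, coe_mem_extBoundary_iff.2 ha, ?_⟩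
      change 1 ≤ dist a x / dist a x
      rw [div_self h.ne']
    -- maximize the coordinate in the direction `y - x`
    have hcomp : IsCompact (closure D) := hb.isCompact_closure
    obtain ⟨a, ha, hmax⟩ := hcomp.exists_isMaxOn ⟨x, subset_closure hx⟩
      (f := fun p => inner ℝ (y - x) p) (by fun_prop)
    have haf : a ∈ frontier D := by
      rw [hD.1.frontier_eq]
      refine ⟨ha, fun haD => ?_⟩
      obtain ⟨ε, hε, hball⟩ := Metric.isOpen_iff.1 hD.1 a haD
      have hn : 0 < ‖y - x‖ := norm_pos_iff.2 (sub_ne_zero.2 hxy.symm)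
      have hmem : a + (ε / (2 * ‖y - x‖)) • (y - x) ∈ D := by
        refine hball ?_
        rw [Metric.mem_ball, dist_eq_norm, add_sub_cancel_left, norm_smul, Real.norm_of_nonneg
          (by positivity)]
        field_simp
        linarith
      have := hmax (subset_closure hmem)
      simp only [mem_ofPred_eq, inner_add_right, inner_smul_right, real_inner_self_eq_norm_sq] at this
      have : 0 < ε / (2 * ‖y - x‖) * ‖y - x‖ ^ 2 := by positivity
      linarith
    refine ⟨a, coe_mem_extBoundary_iff.2 haf, ?_⟩
    have h := (bdist_pos hD hy).trans_le (bdist_le_dist haf)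
    rw [dist_comm] at h
    change 1 ≤ dist a x / dist a y
    rw [one_le_div h, dist_eq_norm, dist_eq_norm]
    have h1 : inner ℝ (y - x) y ≤ inner ℝ (y - x) a := hmax (subset_closure hy)
    refine le_of_sq_le_sq ?_ (norm_nonneg _)
    -- By maximality the angle at y between a - y and y - x is not obtuse, so a is at least as far
    -- from x as from y.
    have h2 : ‖a - x‖ ^ 2 = ‖a - y‖ ^ 2 + 2 * inner ℝ (a - y) (y - x) + ‖y - x‖ ^ 2 := by
      rw [← norm_add_sq_real, sub_add_sub_cancel]
    have h3 : inner ℝ (a - y) (y - x) = inner ℝ (y - x) a - inner ℝ (y - x) y := by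
      rw [real_inner_comm, inner_sub_right]
    nlinarith [sq_nonneg ‖y - x‖]
  · exact ⟨_, infty_mem_extBoundary hD.1 hb, le_rfl⟩

/-- The second boundary point in the supremum is chosen with ratio at least 1, so that it can be
dropped. -/
lemma log_dist_div_le_apollonian (hD : IsProperDomain D) (hx : x ∈ D) (hy : y ∈ D)
    {a : EuclideanSpace ℝ (Fin n)} (ha : a ∈ frontier D) :
    Real.log (dist a y / dist a x) ≤ apollonian D x y := by
  obtain ⟨b, hb, hb1⟩ := exists_one_le_ratio hD hx hy
  have ha' := coe_mem_extBoundary_iff.2 ha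
  refine le_trans ?_ (log_le_apollonian hD hx hy hb ha')
  have h := ratio_pos hD hy hx ha'
  exact Real.log_le_log h (le_mul_of_one_le_left h.le hb1)

lemma log_dist_div_le_apollonian' (hD : IsProperDomain D) (hx : x ∈ D) (hy : y ∈ D)
    {a : EuclideanSpace ℝ (Fin n)} (ha : a ∈ frontier D) :
    Real.log (dist a x / dist a y) ≤ apollonian D x y := by
  obtain ⟨b, hb, hb1⟩ := exists_one_le_ratio hD hy hx
  have ha' := coe_mem_extBoundary_iff.2 ha
  refine le_trans ?_ (log_le_apollonian hD hx hy ha' hb)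
  have h := ratio_pos hD hx hy ha'
  exact Real.log_le_log h (le_mul_of_one_le_right h.le hb1)

/-- Tested on the boundary point nearest to x, the hypothesis puts y within 2 d(x) of it, hence
within 3 d(x) of x. Tested on the one nearest to y, it gives d(x) ≤ 2 d(y). -/
lemma bdist_lt_of_apollonian_lt (hD : IsProperDomain D) (hx : x ∈ D) (hy : y ∈ D)
    (h : apollonian D x y < Real.log 2) :
    bdist D x ≤ 2 * bdist D y ∧ dist y x ≤ 3 * bdist D x := by
  have hdx := bdist_pos hD hx
  have hdy := bdist_pos hD hy
  obtain ⟨a, ha, had⟩ := exists_bdist_eq_dist hD x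
  obtain ⟨b, hb, hbd⟩ := exists_bdist_eq_dist hD y
  have hay := bdist_le_dist (z := y) ha
  have hbx := bdist_le_dist (z := x) hb
  have h1 := (log_dist_div_le_apollonian hD hx hy ha).trans_lt h
  have h2 := (log_dist_div_le_apollonian' hD hx hy hb).trans_lt h
  rw [dist_comm a y, dist_comm a x, ← had,
    Real.log_lt_log_iff (div_pos (hdy.trans_le hay) hdx) two_pos, div_lt_iff₀ hdx] at h1
  rw [dist_comm b y, dist_comm b x, ← hbd,
    Real.log_lt_log_iff (div_pos (hdx.trans_le hbx) hdy) two_pos, div_lt_iff₀ hdy] at h2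
  exact ⟨by linarith, by linarith [dist_triangle_right y x a]⟩

end Apollonian

/-! ### The length of a path in a given metric -/

section Length

variable {n : ℕ}

/-- The `d`-length of `γ` on `[a,b]`. -/
noncomputable def dLengthOn (d : EuclideanSpace ℝ (Fin n) → EuclideanSpace ℝ (Fin n) → ℝ)
    (γ : ℝ → EuclideanSpace ℝ (Fin n)) (a b : ℝ) : ℝ≥0∞ :=
  ⨆ (k : ℕ) (t : ℕ → ℝ) (_ : t 0 = a ∧ t k = b ∧ ∀ i < k, t i < t (i + 1)),
    ∑ i ∈ Finset.range k, ENNReal.ofReal (d (γ (t i)) (γ (t (i + 1))))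

variable {d : EuclideanSpace ℝ (Fin n) → EuclideanSpace ℝ (Fin n) → ℝ}
  {γ : ℝ → EuclideanSpace ℝ (Fin n)}

lemma sum_le_dLengthOn {a b : ℝ} {k : ℕ} {t : ℕ → ℝ}
    (h : t 0 = a ∧ t k = b ∧ ∀ i < k, t i < t (i + 1)) :
    ∑ i ∈ Finset.range k, ENNReal.ofReal (d (γ (t i)) (γ (t (i + 1)))) ≤ dLengthOn d γ a b :=
  le_iSup_of_le k (le_iSup_of_le t (le_iSup_of_le h le_rfl))

/-- Every partition of [a,s] becomes one of [a,u] by appending u. This makes the increments of the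
length function dominate d. -/
lemma dLengthOn_add_le {a s u : ℝ} (has : a ≤ s) (hsu : s < u) :
    dLengthOn d γ a s + ENNReal.ofReal (d (γ s) (γ u)) ≤ dLengthOn d γ a u := by
  have key : ∀ (k : ℕ) (t : ℕ → ℝ), (t 0 = a ∧ t k = s ∧ ∀ i < k, t i < t (i + 1)) →
      ∑ i ∈ Finset.range k, ENNReal.ofReal (d (γ (t i)) (γ (t (i + 1)))) +
        ENNReal.ofReal (d (γ s) (γ u)) ≤ dLengthOn d γ a u := by
    rintro k t ⟨h0, hk, ht⟩
    have h := sum_le_dLengthOn (d := d) (γ := γ) (a := a) (b := u) (k := k + 1)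
      (t := fun i => if i ≤ k then t i else u) ⟨by simpa using h0, by simp, fun i hi => by
        rcases Nat.lt_succ_iff_lt_or_eq.1 hi with h | rfl
        · simpa [h.le, Nat.succ_le_of_lt h] using ht i h
        · simpa [hk] using hsu⟩
    rw [Finset.sum_range_succ] at h
    refine le_trans (le_of_eq ?_) h
    congr 1
    · refine Finset.sum_congr rfl fun i hi => ?_
      rw [Finset.mem_range] at hi
      simp [hi.le, Nat.succ_le_of_lt hi]
    · simp [hk]
  -- Truncated subtraction requires this bound separately. It uses that [a,s] has a partition at
  -- all, the trivial one with k = 0 when a = s.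
  have hle : ENNReal.ofReal (d (γ s) (γ u)) ≤ dLengthOn d γ a u := by
    rcases has.eq_or_lt with rfl | h
    · exact le_add_self.trans (key 0 (fun _ => a) ⟨rfl, rfl, by simp⟩)
    · exact le_add_self.trans (key 1 (fun i => if i = 0 then a else s) ⟨by simp, by simp, by
        intro i hi
        obtain rfl : i = 0 := by omega
        simpa using h⟩)
  refine add_le_of_le_tsub_right_of_le hle ?_
  refine iSup_le fun k => iSup_le fun t => iSup_le fun ht => ?_
  exact ENNReal.le_sub_of_add_le_right ENNReal.ofReal_ne_top (key k t ht)

lemma dLengthOn_mono {a s u : ℝ} (has : a ≤ s) (hsu : s ≤ u) :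
    dLengthOn d γ a s ≤ dLengthOn d γ a u := by
  rcases hsu.eq_or_lt with rfl | h
  · exact le_rfl
  · exact le_self_add.trans (dLengthOn_add_le has h)

end Length

/-! ### From the Apollonian inner metric to chains -/

lemma jPrime_nonneg {n : ℕ} (D : Set (EuclideanSpace ℝ (Fin n)))
    (x y : EuclideanSpace ℝ (Fin n)) : 0 ≤ jPrime D x y :=
  Real.log_nonneg (le_add_of_nonneg_right (div_nonneg (innerDiam_nonneg _ _ _)
    (le_min Metric.infDist_nonneg Metric.infDist_nonneg)))

/-- Φ is the Apollonian length of γ[0,t]. On a piece of growth below log 2 starting at γ(s), the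
boundary distance is at least r = d(γ(s)) / 2 and the piece stays within 3 d(γ(s)) = 6r of its
start, the setting of the packing lemma. -/
theorem exists_chainBound_of_apollonianInnerLeJPrime (n : ℕ) {c : ℝ} (hc : 0 ≤ c) :
    ∃ A : ℝ, 1 ≤ A ∧ ∀ {D : Set (EuclideanSpace ℝ (Fin n))}, IsProperDomain D →
      ApollonianInnerLeJPrime D c → ChainBound D A := by
  obtain ⟨M, hM⟩ := exists_hasChain_of_dist_le n 6
  have hM0 : (0 : ℝ) ≤ M := Nat.cast_nonneg M
  refine ⟨(M + 2) * (2 * c + 3), by nlinarith, fun {D} hD h x hx y hy => ?_⟩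
  have hj := jPrime_nonneg D x y
  -- The summand 1 makes the inequality strict, so that some path realizes it; it is absorbed by the
  -- 1 in `ChainBound`.
  obtain ⟨γ, hγ, hlen⟩ : ∃ γ, IsPathIn D x y γ ∧
      dLengthOn (apollonian D) γ 0 1 < ENNReal.ofReal (c * jPrime D x y + 1) := by
    have h1 : apollonianInner D x y < ENNReal.ofReal (c * jPrime D x y + 1) :=
      (h x hx y hy).trans_lt ((ENNReal.ofReal_lt_ofReal_iff (by positivity)).2 (by linarith))
    unfold apollonianInner innerMetric at h1
    simp only [iInf_lt_iff, exists_prop] at h1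
    exact h1
  set Φ : ℝ → ℝ := fun t => (dLengthOn (apollonian D) γ 0 t).toReal with hΦ
  have hfin : ∀ t, 0 ≤ t → t ≤ 1 → dLengthOn (apollonian D) γ 0 t ≠ ∞ := fun t ht0 ht1 =>
    ne_top_of_le_ne_top (hlen.trans_le le_top).ne (dLengthOn_mono ht0 ht1)
  have hmono : MonotoneOn Φ (Icc 0 1) := fun s hs t ht hst =>
    ENNReal.toReal_mono (hfin t ht.1 ht.2) (dLengthOn_mono hs.1 hst)
  have hα : ∀ s u, 0 ≤ s → s < u → u ≤ 1 → apollonian D (γ s) (γ u) ≤ Φ u - Φ s := by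
    intro s u hs hsu hu
    have h1 := ENNReal.toReal_mono (hfin u (hs.trans hsu.le) hu)
      (dLengthOn_add_le (d := apollonian D) (γ := γ) hs hsu)
    rw [ENNReal.toReal_add (hfin s hs (hsu.le.trans hu)) ENNReal.ofReal_ne_top,
      ENNReal.toReal_ofReal'] at h1
    linarith [le_max_left (apollonian D (γ s) (γ u)) 0]
  obtain ⟨m, hm, hchain⟩ := exists_hasChain_of_monotoneOn (Φ := Φ) (M := M) (b := 1) hD
    (Real.log_pos one_lt_two) zero_le_one hγ.continuousOn hγ.mapsTo hmono (by
      intro s t hs hst ht hlt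
      have hsub : Icc s t ⊆ Icc 0 1 := Icc_subset_Icc hs ht
      have hsD : γ s ∈ D := hγ.mapsTo ⟨hs, hst.trans ht⟩
      have hbd : ∀ u ∈ Icc s t, bdist D (γ s) ≤ 2 * bdist D (γ u) ∧
          dist (γ u) (γ s) ≤ 3 * bdist D (γ s) := by
        intro u hu
        rcases hu.1.eq_or_lt with rfl | hsu
        · have := bdist_pos hD hsD
          exact ⟨by linarith, by rw [dist_self]; positivity⟩
        · refine bdist_lt_of_apollonian_lt hD hsD (hγ.mapsTo (hsub hu)) ?_
          have h1 := hα s u hs hsu (hu.2.trans ht)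
          have h2 := hmono (hsub hu) ⟨hs.trans hst, ht⟩ hu.2
          linarith
      exact hM hD hst (hγ.continuousOn.mono hsub) (hγ.mapsTo.mono_left hsub)
        (r := bdist D (γ s) / 2) (half_pos (bdist_pos hD hsD))
        (fun u hu => by linarith [(hbd u hu).1]) fun u hu => by linarith [(hbd u hu).2])
  rw [hγ.source, hγ.target] at hchain
  refine ⟨m, hm.trans ?_, hchain⟩
  have h0 : 0 ≤ Φ 0 := ENNReal.toReal_nonneg
  have h1 : Φ 1 ≤ c * jPrime D x y + 1 :=
    ENNReal.toReal_le_of_le_ofReal (by positivity) hlen.le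
  have h2 : (Φ 1 - Φ 0) / Real.log 2 ≤ 2 * (c * jPrime D x y + 1) := by
    rw [div_le_iff₀ (Real.log_pos one_lt_two)]
    have : 0 ≤ c * jPrime D x y := by positivity
    nlinarith [Real.log_two_gt_d9]
  calc ((M : ℝ) + 2) * ((Φ 1 - Φ 0) / Real.log 2 + 1)
      ≤ (M + 2) * (2 * (c * jPrime D x y + 1) + 1) := by gcongr
    _ ≤ (M + 2) * ((2 * c + 3) * (jPrime D x y + 1)) := by
        gcongr
        nlinarith
    _ = _ := by ring

/-! ### The length function of a path -/

section ArcLength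

variable {n : ℕ} {D : Set (EuclideanSpace ℝ (Fin n))} {x y : EuclideanSpace ℝ (Fin n)}
  {γ : ℝ → EuclideanSpace ℝ (Fin n)}

/-- The length of `γ` on `[0,t]`. -/
noncomputable def arcLength (γ : ℝ → EuclideanSpace ℝ (Fin n)) (t : ℝ) : ℝ :=
  variationOnFromTo γ (Icc 0 1) 0 t

lemma arcLength_zero : arcLength γ 0 = 0 := variationOnFromTo.self _ _ _

lemma IsPathIn.locallyBoundedVariationOn (h : IsPathIn D x y γ) :
    LocallyBoundedVariationOn γ (Icc 0 1) :=
  BoundedVariationOn.locallyBoundedVariationOn h.rectifiable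

lemma IsPathIn.arcLength_sub (h : IsPathIn D x y γ) {s t : ℝ} (hs : 0 ≤ s) (hst : s ≤ t)
    (ht : t ≤ 1) : arcLength γ t - arcLength γ s = (eVariationOn γ (Icc s t)).toReal := by
  have h0 : (0 : ℝ) ∈ Icc (0 : ℝ) 1 := by simp
  unfold arcLength
  rw [variationOnFromTo.sub_right h.locallyBoundedVariationOn h0 ⟨hs.trans hst, ht⟩
    ⟨hs, hst.trans ht⟩, variationOnFromTo.eq_of_le _ _ hst,
    inter_eq_right.2 (Icc_subset_Icc hs ht)]

lemma IsPathIn.arcLength_eq (h : IsPathIn D x y γ) {t : ℝ} (ht0 : 0 ≤ t) (ht : t ≤ 1) :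
    arcLength γ t = (eVariationOn γ (Icc 0 t)).toReal := by
  rw [← h.arcLength_sub le_rfl ht0 ht, arcLength_zero, sub_zero]

lemma IsPathIn.eVariationOn_ne_top (h : IsPathIn D x y γ) {s t : ℝ} (hs : 0 ≤ s) (ht : t ≤ 1) :
    eVariationOn γ (Icc s t) ≠ ∞ :=
  ne_top_of_le_ne_top h.rectifiable (eVariationOn.mono γ (Icc_subset_Icc hs ht))

lemma IsPathIn.monotoneOn_arcLength (h : IsPathIn D x y γ) :
    MonotoneOn (arcLength γ) (Icc 0 1) :=
  variationOnFromTo.monotoneOn h.locallyBoundedVariationOn (by simp)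

lemma IsPathIn.dist_le_arcLength_sub (h : IsPathIn D x y γ) {s t : ℝ} (hs : 0 ≤ s) (hst : s ≤ t)
    (ht : t ≤ 1) : dist (γ s) (γ t) ≤ arcLength γ t - arcLength γ s := by
  rw [h.arcLength_sub hs hst ht]
  exact BoundedVariationOn.dist_le (h.eVariationOn_ne_top hs ht) ⟨le_rfl, hst⟩ ⟨hst, le_rfl⟩

/-- For a continuous function of bounded variation, the variation over intervals shrinking to a
point tends to 0 from both sides. -/
lemma IsPathIn.continuousOn_arcLength (h : IsPathIn D x y γ) :
    ContinuousOn (arcLength γ) (Icc 0 1) := by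
  intro t ht
  have hl := BoundedVariationOn.tendsto_eVariationOn_Icc_zero_left h.rectifiable (x := t)
    ((h.continuousOn t ht).mono inter_subset_left)
  have hr := BoundedVariationOn.tendsto_eVariationOn_Icc_zero_right h.rectifiable t
    ((h.continuousOn t ht).mono inter_subset_left)
  have hsum := (ENNReal.tendsto_toReal ENNReal.zero_ne_top).comp hl |>.add
    ((ENNReal.tendsto_toReal ENNReal.zero_ne_top).comp hr)
  simp only [ENNReal.toReal_zero, add_zero] at hsum
  rw [ContinuousWithinAt, tendsto_iff_dist_tendsto_zero]
  refine squeeze_zero' (Filter.Eventually.of_forall fun _ => dist_nonneg) ?_ hsum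
  filter_upwards [self_mem_nhdsWithin] with s hs
  simp only [Function.comp_apply]
  have h1 : 0 ≤ (eVariationOn γ (Icc 0 1 ∩ Icc s t)).toReal := ENNReal.toReal_nonneg
  have h2 : 0 ≤ (eVariationOn γ (Icc 0 1 ∩ Icc t s)).toReal := ENNReal.toReal_nonneg
  rcases le_total s t with hst | hst
  · have h3 := h.arcLength_sub hs.1 hst ht.2
    rw [inter_eq_right.2 (Icc_subset_Icc hs.1 ht.2), ← h3] at h1 ⊢
    rw [dist_comm, Real.dist_eq, abs_of_nonneg h1]
    linarith
  · have h3 := h.arcLength_sub ht.1 hst hs.2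
    rw [inter_eq_right.2 (Icc_subset_Icc ht.1 hs.2), ← h3] at h2 ⊢
    rw [Real.dist_eq, abs_of_nonneg h2]
    linarith

/-- The parametrization by arc length takes on `[v(s),v(t)]`, where `v` is the length function, only
values of `γ` on `[s,t]`. -/
lemma IsPathIn.exists_naturalParameterization_eq (h : IsPathIn D x y γ) {s t r : ℝ} (hs : 0 ≤ s)
    (hst : s ≤ t) (ht : t ≤ 1) (hr : r ∈ Icc (arcLength γ s) (arcLength γ t)) :
    ∃ u ∈ Icc s t, arcLength γ u = r ∧ naturalParameterization γ (Icc 0 1) 0 r = γ u := by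
  obtain ⟨u, hu, rfl⟩ := intermediate_value_Icc hst
    (h.continuousOn_arcLength.mono (Icc_subset_Icc hs ht)) hr
  refine ⟨u, hu, rfl, ?_⟩
  exact edist_eq_zero.1 (edist_naturalParameterization_eq_zero h.locallyBoundedVariationOn
    (by simp) ⟨hs.trans hu.1, hu.2.trans ht⟩)

/-- The integral of `ρ` along the part of `γ` on `[s,t]`. -/
noncomputable def subarcIntegral (ρ : EuclideanSpace ℝ (Fin n) → ℝ≥0∞)
    (γ : ℝ → EuclideanSpace ℝ (Fin n)) (s t : ℝ) : ℝ≥0∞ :=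
  ∫⁻ r in Ioc (arcLength γ s) (arcLength γ t), ρ (naturalParameterization γ (Icc 0 1) 0 r)

lemma subarcIntegral_self (ρ : EuclideanSpace ℝ (Fin n) → ℝ≥0∞) (s : ℝ) :
    subarcIntegral ρ γ s s = 0 := by
  simp [subarcIntegral]

/-- Half-open intervals of arc length make adjacent pieces disjoint; the missing end point is a null
set. -/
lemma IsPathIn.arcIntegral_eq (h : IsPathIn D x y γ) (ρ : EuclideanSpace ℝ (Fin n) → ℝ≥0∞) :
    arcIntegral ρ γ = subarcIntegral ρ γ 0 1 := by
  unfold arcIntegral subarcIntegral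
  rw [← h.arcLength_eq zero_le_one le_rfl, arcLength_zero]
  exact setLIntegral_congr Ioc_ae_eq_Icc.symm

lemma IsPathIn.subarcIntegral_add (h : IsPathIn D x y γ)
    (ρ : EuclideanSpace ℝ (Fin n) → ℝ≥0∞) {s t u : ℝ} (hs : 0 ≤ s) (hst : s ≤ t) (htu : t ≤ u)
    (hu : u ≤ 1) : subarcIntegral ρ γ s t + subarcIntegral ρ γ t u = subarcIntegral ρ γ s u := by
  have h1 := h.monotoneOn_arcLength ⟨hs, by linarith⟩ ⟨by linarith, by linarith⟩ hst
  have h2 := h.monotoneOn_arcLength ⟨by linarith, by linarith⟩ ⟨by linarith, hu⟩ htu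
  unfold subarcIntegral
  rw [← Ioc_union_Ioc_eq_Ioc h1 h2, lintegral_union measurableSet_Ioc
    (by rw [Set.disjoint_left]; intro r hr hr'; exact absurd hr.2 (not_le.2 hr'.1))]

lemma IsPathIn.le_subarcIntegral (h : IsPathIn D x y γ) {ρ : EuclideanSpace ℝ (Fin n) → ℝ≥0∞}
    {s t : ℝ} {a : ℝ≥0∞} (hs : 0 ≤ s) (hst : s ≤ t) (ht : t ≤ 1)
    (ha : ∀ u ∈ Icc s t, a ≤ ρ (γ u)) :
    a * ENNReal.ofReal (arcLength γ t - arcLength γ s) ≤ subarcIntegral ρ γ s t := by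
  rw [← Real.volume_Ioc, ← setLIntegral_const]
  refine setLIntegral_mono' measurableSet_Ioc fun r hr => ?_
  obtain ⟨u, hu, -, hu'⟩ := h.exists_naturalParameterization_eq hs hst ht ⟨hr.1.le, hr.2⟩
  rw [hu']
  exact ha u hu

lemma IsPathIn.subarcIntegral_le (h : IsPathIn D x y γ) {ρ : EuclideanSpace ℝ (Fin n) → ℝ≥0∞}
    {s t : ℝ} {a : ℝ≥0∞} (hs : 0 ≤ s) (hst : s ≤ t) (ht : t ≤ 1)
    (ha : ∀ u ∈ Icc s t, ρ (γ u) ≤ a) :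
    subarcIntegral ρ γ s t ≤ a * ENNReal.ofReal (arcLength γ t - arcLength γ s) := by
  rw [← Real.volume_Ioc, ← setLIntegral_const]
  refine setLIntegral_mono' measurableSet_Ioc fun r hr => ?_
  obtain ⟨u, hu, -, hu'⟩ := h.exists_naturalParameterization_eq hs hst ht ⟨hr.1.le, hr.2⟩
  rw [hu']
  exact ha u hu

end ArcLength

/-! ### From the quasihyperbolic metric to chains -/

/-- A path leaving the ball of radius d(z) / 4 about z has collected quasihyperbolic length at least
1/5 by then. So a piece of smaller length joins its ends by a single step, and the constants come
from 3 (5 (c j' + 1) + 1) = 15 c j' + 18. -/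
theorem exists_chainBound_of_quasihyperbolicLeJPrime {c : ℝ} (hc : 0 ≤ c) :
    ∃ A : ℝ, 1 ≤ A ∧ ∀ {n : ℕ} {D : Set (EuclideanSpace ℝ (Fin n))}, IsProperDomain D →
      QuasihyperbolicLeJPrime D c → ChainBound D A := by
  refine ⟨15 * c + 18, by linarith, fun {n D} hD h x hx y hy => ?_⟩
  have hj := jPrime_nonneg D x y
  set ρ : EuclideanSpace ℝ (Fin n) → ℝ≥0∞ := fun z => ENNReal.ofReal (1 / bdist D z) with hρ
  obtain ⟨γ, hγ, hlen⟩ : ∃ γ, IsPathIn D x y γ ∧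
      arcIntegral ρ γ < ENNReal.ofReal (c * jPrime D x y + 1) := by
    have h1 : quasihyperbolic D x y < ENNReal.ofReal (c * jPrime D x y + 1) :=
      (h x hx y hy).trans_lt ((ENNReal.ofReal_lt_ofReal_iff (by positivity)).2 (by linarith))
    unfold quasihyperbolic at h1
    simp only [iInf_lt_iff, exists_prop] at h1
    exact h1
  rw [hγ.arcIntegral_eq] at hlen
  have hfin : ∀ s t, 0 ≤ s → s ≤ t → t ≤ 1 → subarcIntegral ρ γ s t ≠ ∞ := by
    intro s t hs hst ht
    refine ne_top_of_le_ne_top (hlen.trans_le le_top).ne ?_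
    rw [← hγ.subarcIntegral_add ρ le_rfl hs (hst.trans ht) le_rfl,
      ← hγ.subarcIntegral_add ρ hs hst ht le_rfl]
    exact le_self_add.trans le_add_self
  set Φ : ℝ → ℝ := fun t => (subarcIntegral ρ γ 0 t).toReal with hΦ
  have hsub : ∀ s t, 0 ≤ s → s ≤ t → t ≤ 1 →
      Φ t - Φ s = (subarcIntegral ρ γ s t).toReal := by
    intro s t hs hst ht
    simp only [hΦ]
    rw [← hγ.subarcIntegral_add ρ le_rfl hs hst ht,
      ENNReal.toReal_add (hfin 0 s le_rfl hs (hst.trans ht)) (hfin s t hs hst ht)]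
    ring
  have hmono : MonotoneOn Φ (Icc 0 1) := fun s hs t ht hst => by
    have := hsub s t hs.1 hst ht.2
    have : 0 ≤ (subarcIntegral ρ γ s t).toReal := ENNReal.toReal_nonneg
    linarith
  obtain ⟨m, hm, hchain⟩ := exists_hasChain_of_monotoneOn (Φ := Φ) (M := 1) (b := 1) (δ := 1 / 5)
    hD (by norm_num) zero_le_one hγ.continuousOn hγ.mapsTo hmono (by
      intro s t hs hst ht hlt
      have hsubset : Icc s t ⊆ Icc 0 1 := Icc_subset_Icc hs ht
      have hsD : γ s ∈ D := hγ.mapsTo ⟨hs, hst.trans ht⟩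
      have hpos := bdist_pos hD hsD
      refine HasChain.single (Step.of_dist_le hD hsD ?_)
      by_contra! hcon
      -- the first exit from the ball of radius `bdist D (γ s) / 4`
      set f : ℝ → ℝ := fun u => dist (γ s) (γ u) with hf
      have hfc : ContinuousOn f (Icc s t) :=
        (continuous_const.dist continuous_id).comp_continuousOn (hγ.continuousOn.mono hsubset)
      have hfs : f s = 0 := dist_self _
      obtain ⟨e, ⟨he, hfe⟩, hleast⟩ : ∃ e, IsLeast (Icc s t ∩ f ⁻¹' {bdist D (γ s) / 4}) e := by
        refine IsCompact.exists_isLeast ?_ ?_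
        · exact isCompact_Icc.of_isClosed_subset
            (hfc.preimage_isClosed_of_isClosed isClosed_Icc isClosed_singleton) inter_subset_left
        · exact intermediate_value_Icc hst hfc ⟨by rw [hfs]; positivity, hcon.le⟩
      have hfe' : dist (γ s) (γ e) = bdist D (γ s) / 4 := hfe
      have hle : ∀ u ∈ Icc s e, f u ≤ bdist D (γ s) / 4 := by
        intro u hu
        by_contra! hcon'
        obtain ⟨u', hu', hfu'⟩ := intermediate_value_Icc hu.1
          (hfc.mono (Icc_subset_Icc_right (hu.2.trans he.2)))
          (show bdist D (γ s) / 4 ∈ Icc (f s) (f u) from ⟨by rw [hfs]; positivity, hcon'.le⟩)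
        have h1 := hleast ⟨⟨hu'.1, hu'.2.trans (hu.2.trans he.2)⟩, hfu'⟩
        obtain rfl : u' = u := le_antisymm hu'.2 (hu.2.trans h1)
        linarith
      have he1 : e ≤ 1 := he.2.trans ht
      -- Up to the exit time the boundary distance is at most 5/4 of that at γ s, and the arc is at
      -- least a quarter of it long.
      have h1 := hγ.le_subarcIntegral (ρ := ρ) (a := ENNReal.ofReal (4 / (5 * bdist D (γ s)))) hs
        he.1 he1 (by
          intro u hu
          refine ENNReal.ofReal_le_ofReal ?_
          have h2 := bdist_le_add_dist (D := D) (γ u) (γ s)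
          rw [dist_comm] at h2
          have h3 : dist (γ s) (γ u) ≤ bdist D (γ s) / 4 := hle u hu
          have h4 := bdist_pos hD (hγ.mapsTo (show u ∈ Icc 0 1 from
            ⟨hs.trans hu.1, hu.2.trans he1⟩))
          rw [div_le_div_iff₀ (by positivity) h4]
          linarith)
      have h2 := hγ.dist_le_arcLength_sub hs he.1 he1
      rw [← ENNReal.ofReal_mul (by positivity),
        ENNReal.ofReal_le_iff_le_toReal (hfin s e hs he.1 he1), ← hsub s e hs he.1 he1] at h1
      have h3 : (1 : ℝ) / 5 ≤ 4 / (5 * bdist D (γ s)) * (arcLength γ e - arcLength γ s) := by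
        calc (1 : ℝ) / 5 = 4 / (5 * bdist D (γ s)) * (bdist D (γ s) / 4) := by field_simp
          _ ≤ _ := by
            rw [← hfe']
            gcongr
      have h4 := hmono ⟨hs.trans he.1, he1⟩ ⟨hs.trans hst, ht⟩ he.2
      linarith)
  rw [hγ.source, hγ.target] at hchain
  refine ⟨m, hm.trans ?_, hchain⟩
  have h0 : Φ 0 = 0 := by simp [hΦ, subarcIntegral_self]
  have h1 : Φ 1 ≤ c * jPrime D x y + 1 :=
    ENNReal.toReal_le_of_le_ofReal (by positivity) hlen.le
  rw [h0]
  push_cast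
  nlinarith

/-! ### Polygonal paths -/

/-- The polygonal line with vertices `p 0, p 1, …`, the vertex `p i` being reached at the time
`i`. -/
noncomputable def polyline {E : Type*} [NormedAddCommGroup E] [NormedSpace ℝ E] (p : ℕ → E)
    (t : ℝ) : E :=
  AffineMap.lineMap (p ⌊t⌋₊) (p (⌊t⌋₊ + 1)) (t - ⌊t⌋₊)

section Polyline

variable {E : Type*} [NormedAddCommGroup E] [NormedSpace ℝ E] {p : ℕ → E} {i : ℕ}

lemma polyline_eq {t : ℝ} (h1 : i ≤ t) (h2 : t ≤ i + 1) :
    polyline p t = AffineMap.lineMap (p i) (p (i + 1)) (t - i) := by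
  rcases h2.eq_or_lt with rfl | h2
  · have : ⌊(i : ℝ) + 1⌋₊ = i + 1 := by exact_mod_cast Nat.floor_natCast (R := ℝ) (i + 1)
    simp [polyline, this]
  · have : ⌊t⌋₊ = i := (Nat.floor_eq_iff ((Nat.cast_nonneg i).trans h1)).2 ⟨h1, h2⟩
    simp [polyline, this]

lemma polyline_natCast (i : ℕ) : polyline p i = p i := by
  rw [polyline_eq le_rfl (by linarith)]
  simp

lemma dist_polyline {s t : ℝ} (hs : i ≤ s) (hst : s ≤ t) (ht : t ≤ i + 1) :
    dist (polyline p s) (polyline p t) = (t - s) * dist (p i) (p (i + 1)) := by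
  rw [polyline_eq hs (hst.trans ht), polyline_eq (hs.trans hst) ht, dist_lineMap_lineMap,
    dist_comm, Real.dist_eq, sub_sub_sub_cancel_right, abs_of_nonneg (by linarith)]

lemma polyline_mem_segment {t : ℝ} (h1 : i ≤ t) (h2 : t ≤ i + 1) :
    polyline p t ∈ segment ℝ (p i) (p (i + 1)) := by
  rw [polyline_eq h1 h2, segment_eq_image_lineMap]
  exact ⟨_, ⟨by linarith, by linarith⟩, rfl⟩

lemma polyline_sub {S : ℕ → ℝ} {s t : ℝ} (hs : i ≤ s) (hst : s ≤ t) (ht : t ≤ i + 1) :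
    polyline S t - polyline S s = (t - s) * (S (i + 1) - S i) := by
  rw [polyline_eq hs (hst.trans ht), polyline_eq (hs.trans hst) ht, AffineMap.lineMap_apply_ring',
    AffineMap.lineMap_apply_ring']
  ring

end Polyline

/-- A function of two variables with the triangle inequality is bounded by the increments of `G` as
soon as this is so on every interval between consecutive integers. -/
lemma le_sub_of_forall_Icc {δ : ℝ → ℝ → ℝ} {G : ℝ → ℝ} {m : ℕ}
    (htri : ∀ s u t : ℝ, 0 ≤ s → s ≤ u → u ≤ t → t ≤ m → δ s t ≤ δ s u + δ u t)
    (hloc : ∀ i < m, ∀ s t : ℝ, i ≤ s → s ≤ t → t ≤ i + 1 → δ s t ≤ G t - G s)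
    (hself : δ 0 0 ≤ 0) {s t : ℝ} (hs : 0 ≤ s) (hst : s ≤ t) (ht : t ≤ m) :
    δ s t ≤ G t - G s := by
  induction m generalizing s t with
  | zero =>
    have h1 : t ≤ 0 := by simpa using ht
    obtain rfl : s = 0 := by linarith
    obtain rfl : t = 0 := by linarith
    linarith
  | succ m ih =>
    have hmle : (m : ℝ) ≤ (m + 1 : ℕ) := by push_cast; linarith
    have ih' : ∀ {s t : ℝ}, 0 ≤ s → s ≤ t → t ≤ m → δ s t ≤ G t - G s :=
      ih (fun s u t hs hsu hut ht => htri s u t hs hsu hut (ht.trans hmle))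
        (fun i hi => hloc i (by omega))
    have ht' : t ≤ m + 1 := by exact_mod_cast ht
    rcases le_total t m with h | h
    · exact ih' hs hst h
    rcases le_total (m : ℝ) s with h' | h'
    · exact hloc m (by omega) s t h' hst ht'
    · have h1 := ih' hs h' le_rfl
      have h2 := hloc m (by omega) m t le_rfl h ht'
      linarith [htri s m t hs h' h ht]

section PolygonalPaths

variable {n : ℕ} {D : Set (EuclideanSpace ℝ (Fin n))} {x y : EuclideanSpace ℝ (Fin n)} {m : ℕ}
  {p : ℕ → EuclideanSpace ℝ (Fin n)}

lemma exists_floor_lt {m : ℕ} (hm : 0 < m) {t : ℝ} (ht0 : 0 ≤ t) (ht : t ≤ m) :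
    ∃ i < m, (i : ℝ) ≤ t ∧ t ≤ i + 1 := by
  rcases ht.eq_or_lt with rfl | h
  · refine ⟨m - 1, by omega, ?_, ?_⟩ <;> rw [Nat.cast_sub (by omega)] <;> push_cast <;> linarith
  · exact ⟨⌊t⌋₊, (Nat.floor_lt ht0).2 h, Nat.floor_le ht0, (Nat.lt_floor_add_one t).le⟩

lemma IsChainSeq.polyline_mem (hD : IsProperDomain D) (hm : 0 < m)
    (hp : IsChainSeq (Step D) m x y p) {t : ℝ} (ht0 : 0 ≤ t) (ht : t ≤ m) :
    polyline p t ∈ D := by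
  obtain ⟨i, hi, h1, h2⟩ := exists_floor_lt hm ht0 ht
  exact (hp.step i hi).mem_of_mem_segment hD (polyline_mem_segment h1 h2)

lemma dist_polyline_le {s t : ℝ} (hs : 0 ≤ s) (hst : s ≤ t) (ht : t ≤ m) :
    dist (polyline p s) (polyline p t) ≤
      (∑ k ∈ Finset.range m, dist (p k) (p (k + 1))) * (t - s) := by
  have := le_sub_of_forall_Icc (m := m) (δ := fun s t => dist (polyline p s) (polyline p t))
    (G := fun t => (∑ k ∈ Finset.range m, dist (p k) (p (k + 1))) * t)
    (fun s u t _ _ _ _ => dist_triangle _ _ _) (fun i hi s t hs hst ht => by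
      rw [dist_polyline hs hst ht, ← mul_sub, mul_comm]
      have := Finset.single_le_sum (f := fun k => dist (p k) (p (k + 1)))
        (fun k _ => dist_nonneg) (Finset.mem_range.2 hi)
      exact mul_le_mul_of_nonneg_right this (by linarith)) (by simp) hs hst ht
  rwa [← mul_sub] at this

lemma IsChainSeq.isPathIn_polyline (hD : IsProperDomain D) (hm : 0 < m)
    (hp : IsChainSeq (Step D) m x y p) : IsPathIn D x y (fun t => polyline p (m * t)) := by
  have hm' : (0 : ℝ) < m := by exact_mod_cast hm
  set C := (∑ k ∈ Finset.range m, dist (p k) (p (k + 1))) * m with hC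
  have hC0 : 0 ≤ C := mul_nonneg (Finset.sum_nonneg fun _ _ => dist_nonneg) hm'.le
  have hlip : ∀ s ∈ Icc (0 : ℝ) 1, ∀ t ∈ Icc (0 : ℝ) 1,
      dist (polyline p (m * s)) (polyline p (m * t)) ≤ C * |s - t| := by
    have key : ∀ s ∈ Icc (0 : ℝ) 1, ∀ t ∈ Icc (0 : ℝ) 1, s ≤ t →
        dist (polyline p (m * s)) (polyline p (m * t)) ≤ C * |s - t| := by
      intro s hs t ht hst
      refine (dist_polyline_le (m := m) (mul_nonneg hm'.le hs.1) (by gcongr)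
        (mul_le_of_le_one_right hm'.le ht.2)).trans (le_of_eq ?_)
      rw [abs_sub_comm, abs_of_nonneg (by linarith), hC]
      ring
    intro s hs t ht
    rcases le_total s t with h | h
    · exact key s hs t ht h
    · rw [dist_comm, abs_sub_comm]
      exact key t ht s hs h
  refine ⟨?_, ?_, ?_, ?_, ?_⟩
  · refine (LipschitzOnWith.of_dist_le_mul (K := Real.toNNReal C) fun s hs t ht => ?_).continuousOn
    rw [Real.coe_toNNReal _ hC0, Real.dist_eq]
    exact hlip s hs t ht
  · exact ne_top_of_le_ne_top ENNReal.ofReal_ne_top (eVariationOn_Icc_le_of_dist_le hC0 hlip)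
  · intro t ht
    exact hp.polyline_mem hD hm (mul_nonneg hm'.le ht.1) (mul_le_of_le_one_right hm'.le ht.2)
  · have := polyline_natCast (p := p) 0
    simpa [hp.source] using this
  · simp [polyline_natCast, hp.target]

/-- On each segment the boundary distance is at least half of that at its first vertex, whence the
factor 2. -/
lemma IsChainSeq.quasihyperbolic_le (hD : IsProperDomain D) (hm : 0 < m)
    (hp : IsChainSeq (Step D) m x y p) :
    quasihyperbolic D x y ≤
      ENNReal.ofReal (∑ k ∈ Finset.range m, 2 * (dist (p k) (p (k + 1)) / bdist D (p k))) := by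
  have hm' : (0 : ℝ) < m := by exact_mod_cast hm
  have hγ := hp.isPathIn_polyline hD hm
  set γ : ℝ → EuclideanSpace ℝ (Fin n) := fun t => polyline p (m * t) with hγdef
  refine (iInf₂_le γ hγ).trans ?_
  rw [hγ.arcIntegral_eq]
  set ρ : EuclideanSpace ℝ (Fin n) → ℝ≥0∞ := fun z => ENNReal.ofReal (1 / bdist D z) with hρ
  have hterm : ∀ k < m, 0 ≤ 2 * (dist (p k) (p (k + 1)) / bdist D (p k)) := fun k hk =>
    mul_nonneg two_pos.le (div_nonneg dist_nonneg Metric.infDist_nonneg)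
  have key : ∀ i ≤ m, subarcIntegral ρ γ 0 (i / m) ≤
      ENNReal.ofReal (∑ k ∈ Finset.range i, 2 * (dist (p k) (p (k + 1)) / bdist D (p k))) := by
    intro i
    induction i with
    | zero => simp [subarcIntegral_self]
    | succ i ih =>
      intro hi
      have hi0 : (0 : ℝ) ≤ i / m := by positivity
      have hle : (i / m : ℝ) ≤ (i + 1 : ℕ) / m := by gcongr; omega
      have hle1 : ((i + 1 : ℕ) / m : ℝ) ≤ 1 := div_le_one_of_le₀ (by exact_mod_cast hi) hm'.le
      have hstep := hp.step i (by omega)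
      have hdi := bdist_pos hD hstep.1
      have htime : ∀ u ∈ Icc (i / m : ℝ) ((i + 1 : ℕ) / m), (i : ℝ) ≤ m * u ∧ m * u ≤ i + 1 := by
        intro u hu
        have h1 := (div_le_iff₀' hm').1 hu.1
        have h2 := (le_div_iff₀' hm').1 hu.2
        push_cast at h2
        exact ⟨h1, h2⟩
      rw [← hγ.subarcIntegral_add ρ le_rfl hi0 hle hle1, Finset.sum_range_succ,
        ENNReal.ofReal_add (Finset.sum_nonneg fun k hk => hterm k (by simp at hk; omega))
          (hterm i (by omega))]
      refine add_le_add (ih (by omega)) ?_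
      have h1 := hγ.subarcIntegral_le (ρ := ρ) (a := ENNReal.ofReal (2 / bdist D (p i))) hi0 hle
        hle1 (by
          intro u hu
          refine ENNReal.ofReal_le_ofReal ?_
          have h2 := hstep.bdist_le_of_mem_segment
            (polyline_mem_segment (p := p) (htime u hu).1 (htime u hu).2)
          have h3 : 0 < bdist D (γ u) := bdist_pos hD (hγ.mapsTo ⟨hi0.trans hu.1, hu.2.trans hle1⟩)
          rw [div_le_div_iff₀ h3 hdi]
          linarith)
      refine h1.trans ?_
      rw [← ENNReal.ofReal_mul (by positivity)]
      refine ENNReal.ofReal_le_ofReal ?_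
      have h4 : arcLength γ ((i + 1 : ℕ) / m) - arcLength γ (i / m) ≤
          dist (p i) (p (i + 1)) := by
        rw [hγ.arcLength_sub hi0 hle hle1]
        refine ENNReal.toReal_le_of_le_ofReal dist_nonneg ?_
        have h5 := eVariationOn_Icc_le_of_dist_le (γ := γ) (a := i / m) (b := (i + 1 : ℕ) / m)
          (C := m * dist (p i) (p (i + 1))) (by positivity) (by
            have hkey : ∀ s ∈ Icc (i / m : ℝ) ((i + 1 : ℕ) / m),
                ∀ t ∈ Icc (i / m : ℝ) ((i + 1 : ℕ) / m), s ≤ t →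
                dist (γ s) (γ t) ≤ m * dist (p i) (p (i + 1)) * |s - t| := by
              intro s hs t ht hst
              simp only [hγdef]
              rw [dist_polyline (htime s hs).1 (by gcongr) (htime t ht).2, abs_sub_comm,
                abs_of_nonneg (by linarith)]
              exact le_of_eq (by ring)
            intro s hs t ht
            rcases le_total s t with h | h
            · exact hkey s hs t ht h
            · rw [dist_comm, abs_sub_comm]
              exact hkey t ht s hs h)
        refine h5.trans (ENNReal.ofReal_le_ofReal (le_of_eq ?_))
        push_cast
        field_simp
        ring
      calc 2 / bdist D (p i) * (arcLength γ ((i + 1 : ℕ) / m) - arcLength γ (i / m))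
          ≤ 2 / bdist D (p i) * dist (p i) (p (i + 1)) := by gcongr
        _ = _ := by ring
  have := key m le_rfl
  rwa [div_self hm'.ne'] at this

/-- The piecewise linear interpolation of the partial sums S majorizes the Apollonian distance along
the path: on one segment by `apollonian_le`, with one factor 2 from its two summands and one from
the comparison of boundary distances, and across vertices by the triangle inequality. Sums over any
partition then telescope. -/
lemma IsChainSeq.apollonianInner_le (hD : IsProperDomain D) (hm : 0 < m)
    (hp : IsChainSeq (Step D) m x y p) :
    apollonianInner D x y ≤
      ENNReal.ofReal (∑ k ∈ Finset.range m, 4 * (dist (p k) (p (k + 1)) / bdist D (p k))) := by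
  have hm' : (0 : ℝ) < m := by exact_mod_cast hm
  have hγ := hp.isPathIn_polyline hD hm
  set S : ℕ → ℝ := fun i => ∑ k ∈ Finset.range i, 4 * (dist (p k) (p (k + 1)) / bdist D (p k))
    with hS
  have hSsucc : ∀ i, S (i + 1) - S i = 4 * (dist (p i) (p (i + 1)) / bdist D (p i)) := by
    intro i
    simp only [hS, Finset.sum_range_succ]
    ring
  have hmem : ∀ t, 0 ≤ t → t ≤ (m : ℝ) → polyline p t ∈ D := fun t h0 h1 =>
    hp.polyline_mem hD hm h0 h1
  have hα : ∀ s t, 0 ≤ s → s ≤ t → t ≤ (m : ℝ) →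
      apollonian D (polyline p s) (polyline p t) ≤ polyline S t - polyline S s := by
    intro s t hs hst ht
    refine le_sub_of_forall_Icc (m := m)
      (δ := fun s t => apollonian D (polyline p s) (polyline p t)) (fun s u t hs hsu hut ht =>
        apollonian_triangle hD (hmem s hs (by linarith)) (hmem u (by linarith) (by linarith))
          (hmem t (by linarith) ht)) ?_ ?_ hs hst ht
    · intro i hi s t hs hst ht
      have hi0 : (0 : ℝ) ≤ i := Nat.cast_nonneg i
      have him : (i : ℝ) + 1 ≤ m := by exact_mod_cast hi
      have hstep := hp.step i hi
      have hdi := bdist_pos hD hstep.1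
      have hsD := hmem s (by linarith) (by linarith)
      have htD := hmem t (by linarith) (by linarith)
      refine (apollonian_le hD hsD htD).trans ?_
      rw [polyline_sub hs hst ht, hSsucc, dist_polyline hs hst ht]
      have hbound : ∀ u : ℝ, i ≤ u → u ≤ i + 1 → (t - s) * dist (p i) (p (i + 1)) /
          bdist D (polyline p u) ≤ (t - s) * (2 * (dist (p i) (p (i + 1)) / bdist D (p i))) := by
        intro u h1 h2
        have h3 := hstep.bdist_le_of_mem_segment (polyline_mem_segment (p := p) h1 h2)
        have h4 := bdist_pos hD (hmem u (by linarith) (by linarith))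
        rw [div_le_iff₀ h4]
        have h5 : 1 ≤ 2 * bdist D (polyline p u) / bdist D (p i) := by rwa [one_le_div hdi]
        have h6 : 0 ≤ (t - s) * dist (p i) (p (i + 1)) := mul_nonneg (by linarith) dist_nonneg
        calc (t - s) * dist (p i) (p (i + 1))
            ≤ (t - s) * dist (p i) (p (i + 1)) * (2 * bdist D (polyline p u) / bdist D (p i)) :=
              le_mul_of_one_le_right h6 h5
          _ = _ := by ring
      have h1 := hbound s hs (by linarith)
      have h2 := hbound t (by linarith) ht
      linarith
    · have h0 := hmem 0 le_rfl hm'.le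
      simpa using apollonian_le hD h0 h0
  have hmono : ∀ s t, 0 ≤ s → s ≤ t → t ≤ (m : ℝ) → 0 ≤ polyline S t - polyline S s := by
    intro s t hs hst ht
    refine le_sub_of_forall_Icc (m := m) (δ := fun _ _ => 0) (by simp) ?_ le_rfl hs hst ht
    intro i hi s t hs hst ht
    rw [polyline_sub hs hst ht, hSsucc]
    exact mul_nonneg (by linarith)
      (mul_nonneg (by norm_num) (div_nonneg dist_nonneg Metric.infDist_nonneg))
  refine (iInf₂_le _ hγ).trans ?_
  refine iSup_le fun k => iSup_le fun t => iSup_le fun ht => ?_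
  obtain ⟨ht0, htk, hlt⟩ := ht
  have hle : ∀ i j, i ≤ j → j ≤ k → t i ≤ t j := by
    intro i j hij
    induction j, hij using Nat.le_induction with
    | base => exact fun _ => le_rfl
    | succ j _ ih => exact fun hj => (ih (by omega)).trans (hlt j (by omega)).le
  have htm : ∀ i ≤ k, 0 ≤ m * t i ∧ m * t i ≤ m := by
    intro i hi
    have h1 := hle 0 i (Nat.zero_le _) hi
    have h2 := hle i k hi le_rfl
    rw [ht0] at h1
    rw [htk] at h2
    exact ⟨mul_nonneg hm'.le h1, mul_le_of_le_one_right hm'.le h2⟩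
  have hti : ∀ i < k, (m : ℝ) * t i ≤ m * t (i + 1) := fun i hi =>
    mul_le_mul_of_nonneg_left (hlt i hi).le hm'.le
  calc ∑ i ∈ Finset.range k,
        ENNReal.ofReal (apollonian D (polyline p (m * t i)) (polyline p (m * t (i + 1))))
      ≤ ∑ i ∈ Finset.range k,
        ENNReal.ofReal (polyline S (m * t (i + 1)) - polyline S (m * t i)) := by
        refine Finset.sum_le_sum fun i hi => ENNReal.ofReal_le_ofReal ?_
        rw [Finset.mem_range] at hi
        exact hα _ _ (htm i hi.le).1 (hti i hi) (htm (i + 1) hi).2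
    _ = ENNReal.ofReal (∑ i ∈ Finset.range k,
        (polyline S (m * t (i + 1)) - polyline S (m * t i))) := by
        refine (ENNReal.ofReal_sum_of_nonneg fun i hi => ?_).symm
        rw [Finset.mem_range] at hi
        exact hmono _ _ (htm i hi.le).1 (hti i hi) (htm (i + 1) hi).2
    _ = ENNReal.ofReal (S m) := by
        rw [Finset.sum_range_sub (fun i => polyline S (m * t i)), ht0, htk, mul_one, mul_zero]
        have h0 := polyline_natCast (p := S) 0
        rw [Nat.cast_zero] at h0
        rw [polyline_natCast, h0]
        simp [hS]

/-- A chain whose weight with respect to the quasihyperbolic metric is controlled by `j'_D`. -/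
lemma ChainBound.exists_chain_sum_le (hD : IsProperDomain D) {A : ℝ} (hA : 1 ≤ A)
    (h : ChainBound D A) (hx : x ∈ D) (hy : y ∈ D) :
    ∃ m p, 0 < m ∧ IsChainSeq (Step D) m x y p ∧
      ∑ k ∈ Finset.range m, dist (p k) (p (k + 1)) / bdist D (p k) ≤ 2 * A * jPrime D x y := by
  have hdx := bdist_pos hD hx
  have hdy := bdist_pos hD hy
  have hmin : 0 < min (bdist D x) (bdist D y) := lt_min hdx hdy
  have hj := jPrime_nonneg D x y
  -- From log (1 + u) ≥ u / (1 + u): j' is at least 2u/3 for u ≤ 1/2, and at least 1/3 once u = 1/2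
  -- is admissible.
  have hlog : ∀ u : ℝ, 0 ≤ u → u ≤ innerDiam D x y / min (bdist D x) (bdist D y) →
      u / (1 + u) ≤ jPrime D x y := by
    intro u hu hle
    have h1 := Real.one_sub_inv_le_log_of_pos (show 0 < 1 + u by linarith)
    have h2 : Real.log (1 + u) ≤ jPrime D x y := Real.log_le_log (by linarith) (by linarith)
    have h3 : u / (1 + u) = 1 - (1 + u)⁻¹ := by
      field_simp
      ring
    linarith
  have hdist : dist x y / min (bdist D x) (bdist D y) ≤
      innerDiam D x y / min (bdist D x) (bdist D y) := by
    gcongr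
    exact dist_le_innerDiam hD hx hy
  by_cases hxy : Step D x y
  · obtain ⟨p, hp⟩ := HasChain.single hxy
    have hp0 := hp.source
    have hp1 := hp.target
    refine ⟨1, p, one_pos, hp, ?_⟩
    simp only [Finset.range_one, Finset.sum_singleton, zero_add, hp0, hp1]
    set u := dist x y / min (bdist D x) (bdist D y) with hu
    have hu0 : 0 ≤ u := by positivity
    have hu1 : u ≤ 1 / 2 := by
      rw [hu, div_le_iff₀ hmin]
      rcases min_cases (bdist D x) (bdist D y) with h | h <;> rw [h.1]
      · linarith [hxy.3]
      · linarith [hxy.4]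
    have h1 : dist x y / bdist D x ≤ u := by
      rw [hu]
      gcongr
      exact min_le_left _ _
    have h2 := hlog u hu0 hdist
    rw [div_le_iff₀ (by linarith)] at h2
    nlinarith
  · obtain ⟨m, hm, p, hp⟩ := h x hx y hy
    have hm0 : 0 < m := by
      rcases Nat.eq_zero_or_pos m with rfl | h
      · have : x = y := by rw [← hp.source, hp.target]
        subst this
        exact absurd (Step.refl hD hx) hxy
      · exact h
    refine ⟨m, p, hm0, hp, ?_⟩
    have h1 : ∑ k ∈ Finset.range m, dist (p k) (p (k + 1)) / bdist D (p k) ≤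
        ∑ k ∈ Finset.range m, (1 / 2 : ℝ) := by
      refine Finset.sum_le_sum fun k hk => ?_
      have hs := hp.step k (by simpa using hk)
      rw [div_le_iff₀ (bdist_pos hD hs.1)]
      linarith [hs.3]
    rw [Finset.sum_const, Finset.card_range, nsmul_eq_mul] at h1
    -- Points that are not close have j' ≥ 1/3. Thus 1 ≤ 3 j', and m / 2 ≤ A (j' + 1) / 2 ≤ 2 A j'.
    have h2 : (1 / 2 : ℝ) ≤ dist x y / min (bdist D x) (bdist D y) := by
      rw [le_div_iff₀ hmin]
      by_contra! hcon
      refine hxy ⟨hx, hy, ?_, ?_⟩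
      · linarith [min_le_left (bdist D x) (bdist D y)]
      · linarith [min_le_right (bdist D x) (bdist D y)]
    have h3 := hlog (1 / 2) (by norm_num) (h2.trans hdist)
    norm_num at h3
    nlinarith

theorem ChainBound.quasihyperbolicLeJPrime (hD : IsProperDomain D) {A : ℝ} (hA : 1 ≤ A)
    (h : ChainBound D A) : QuasihyperbolicLeJPrime D (4 * A) := by
  intro x hx y hy
  obtain ⟨m, p, hm, hp, hsum⟩ := h.exists_chain_sum_le hD hA hx hy
  refine (hp.quasihyperbolic_le hD hm).trans (ENNReal.ofReal_le_ofReal ?_)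
  rw [← Finset.mul_sum]
  linarith

theorem ChainBound.apollonianInnerLeJPrime (hD : IsProperDomain D) {A : ℝ} (hA : 1 ≤ A)
    (h : ChainBound D A) : ApollonianInnerLeJPrime D (8 * A) := by
  intro x hx y hy
  obtain ⟨m, p, hm, hp, hsum⟩ := h.exists_chain_sum_le hD hA hx hy
  refine (hp.apollonianInner_le hD hm).trans (ENNReal.ofReal_le_ofReal ?_)
  rw [← Finset.mul_sum]
  linarith

end PolygonalPaths

/-! ### The inner length metric -/

section InnerLength

variable {n : ℕ} {D : Set (EuclideanSpace ℝ (Fin n))} {x y z : EuclideanSpace ℝ (Fin n)}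

lemma IsPathIn.exists_trans {γ γ' : ℝ → EuclideanSpace ℝ (Fin n)} (h : IsPathIn D x y γ)
    (h' : IsPathIn D y z γ') : ∃ η, IsPathIn D x z η ∧
      eVariationOn η (Icc 0 1) ≤ eVariationOn γ (Icc 0 1) + eVariationOn γ' (Icc 0 1) := by
  set η : ℝ → EuclideanSpace ℝ (Fin n) := fun t => if t ≤ 1 / 2 then γ (2 * t) else γ' (2 * t - 1)
    with hη
  have hmap : MapsTo (fun t : ℝ => 2 * t) (Icc 0 (1 / 2)) (Icc 0 1) := fun t ht =>
    ⟨by linarith [ht.1], by linarith [ht.2]⟩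
  have hmap' : MapsTo (fun t : ℝ => 2 * t - 1) (Icc (1 / 2) 1) (Icc 0 1) := fun t ht =>
    ⟨by linarith [ht.1], by linarith [ht.2]⟩
  have h1 : EqOn η (γ ∘ fun t => 2 * t) (Icc 0 (1 / 2)) := fun t ht => by
    simp only [hη, Function.comp_apply, if_pos ht.2]
  have h2 : EqOn η (γ' ∘ fun t => 2 * t - 1) (Icc (1 / 2) 1) := fun t ht => by
    rcases ht.1.eq_or_lt with rfl | hlt
    · simp [hη, h.target, h'.source]
    · simp only [hη, Function.comp_apply, if_neg (not_le.2 hlt)]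
  have hunion : Icc (0 : ℝ) 1 = Icc 0 (1 / 2) ∪ Icc (1 / 2) 1 :=
    (Icc_union_Icc_eq_Icc (by norm_num) (by norm_num)).symm
  have hvar : eVariationOn η (Icc 0 1) ≤
      eVariationOn γ (Icc 0 1) + eVariationOn γ' (Icc 0 1) := by
    rw [hunion, eVariationOn.union η (x := 1 / 2) (isGreatest_Icc (by norm_num))
      (isLeast_Icc (by norm_num)), eVariationOn.congr h1, eVariationOn.congr h2, ← hunion]
    exact add_le_add
      (eVariationOn.comp_le_of_monotoneOn γ _ (fun s _ t _ hst => by simpa using hst) hmap)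
      (eVariationOn.comp_le_of_monotoneOn γ' _ (fun s _ t _ hst => by simpa using hst) hmap')
  refine ⟨η, ⟨?_, ?_, ?_, ?_, ?_⟩, hvar⟩
  · rw [hunion]
    exact ContinuousOn.union_of_isClosed ((h.continuousOn.comp (by fun_prop) hmap).congr h1)
      ((h'.continuousOn.comp (by fun_prop) hmap').congr h2) isClosed_Icc isClosed_Icc
  · exact ne_top_of_le_ne_top (ENNReal.add_ne_top.2 ⟨h.rectifiable, h'.rectifiable⟩) hvar
  · rw [hunion]
    exact ((h.mapsTo.comp hmap).congr h1.symm).union ((h'.mapsTo.comp hmap').congr h2.symm)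
  · simp [hη, h.source]
  · rw [h2 ⟨by norm_num, le_rfl⟩]
    norm_num [h'.target]

lemma innerLength_triangle : innerLength D x z ≤ innerLength D x y + innerLength D y z := by
  simp only [innerLength, ENNReal.iInf_add, ENNReal.add_iInf]
  refine le_iInf fun γ => le_iInf fun hγ => le_iInf fun γ' => le_iInf fun hγ' => ?_
  obtain ⟨η, hη, hle⟩ := IsPathIn.exists_trans ‹_› ‹_›
  exact (iInf₂_le η hη).trans hle

lemma innerLength_comm : innerLength D x y = innerLength D y x := by
  have key : ∀ x y, innerLength D x y ≤ innerLength D y x := fun x y =>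
    le_iInf₂ fun γ hγ => (iInf₂_le _ hγ.reverse).trans IsPathIn.eVariationOn_reverse_le
  exact le_antisymm (key x y) (key y x)

lemma Step.innerLength_le (hD : IsProperDomain D) (h : Step D x y) :
    innerLength D x y ≤ ENNReal.ofReal (dist x y) := by
  obtain ⟨p, hp⟩ := HasChain.single h
  obtain ⟨γ, hγ, hlen, -⟩ := hp.exists_arc hD h.1
  have hp0 := hp.source
  have hp1 := hp.target
  simp only [Finset.range_one, Finset.sum_singleton, zero_add, hp0, hp1] at hlen
  exact (iInf₂_le γ hγ.toIsPathIn).trans hlen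

lemma IsPathIn.innerLength_le_eVariationOn {γ : ℝ → EuclideanSpace ℝ (Fin n)}
    (h : IsPathIn D x y γ) {t : ℝ} (ht0 : 0 ≤ t) (ht : t ≤ 1) :
    innerLength D x (γ t) ≤ eVariationOn γ (Icc 0 t) := by
  have hmap : MapsTo (fun s : ℝ => t * s) (Icc 0 1) (Icc 0 t) := fun s hs =>
    ⟨mul_nonneg ht0 hs.1, mul_le_of_le_one_right ht0 hs.2⟩
  have hsub : Icc 0 t ⊆ Icc 0 1 := Icc_subset_Icc_right ht
  have hle : eVariationOn (fun s => γ (t * s)) (Icc 0 1) ≤ eVariationOn γ (Icc 0 t) :=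
    eVariationOn.comp_le_of_monotoneOn γ (fun s => t * s)
      (fun s _ u _ hsu => mul_le_mul_of_nonneg_left hsu ht0) hmap
  refine (iInf₂_le (fun s => γ (t * s)) ⟨?_, ?_, ?_, ?_, ?_⟩).trans hle
  · exact (h.continuousOn.mono hsub).comp (by fun_prop) hmap
  · exact ne_top_of_le_ne_top (h.eVariationOn_ne_top le_rfl ht) hle
  · exact (h.mapsTo.mono_left hsub).comp hmap
  · simp [h.source]
  · simp

/-! ### In inner uniform domains the inner length and inner diameter metrics are comparable -/

/-- In an inner uniform domain, for points at inner distance more than `h` some point near the first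
one lies far from the boundary. -/
lemma IsInnerUniform.exists_bdist_ge {c h : ℝ} (hc : 1 ≤ c) (hh : 0 < h)
    (hU : IsInnerUniform D c) (hx : x ∈ D) (hy : y ∈ D)
    (hxy : ENNReal.ofReal h < innerLength D x y) :
    ∃ w ∈ D, innerLength D x w ≤ ENNReal.ofReal (h / 4) ∧ dist x w ≤ h / 4 ∧
      h / (4 * c) ≤ bdist D w := by
  obtain ⟨γ, hγ, hcig, -⟩ := hU x hx y hy
  have hγ' := hγ.toIsPathIn
  have h1 : h < arcLength γ 1 := by
    rw [hγ'.arcLength_eq zero_le_one le_rfl, ← ENNReal.ofReal_lt_iff_lt_toReal hh.le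
      hγ'.rectifiable]
    exact hxy.trans_le (iInf₂_le γ hγ')
  -- The point at arc length h / 4 from x. The rest of the arc is longer than h / 4, so the cigar
  -- condition is effective there.
  obtain ⟨t, ht, hvt⟩ := intermediate_value_Icc zero_le_one hγ'.continuousOn_arcLength
    (show h / 4 ∈ Icc (arcLength γ 0) (arcLength γ 1) by
      rw [arcLength_zero]
      constructor <;> linarith)
  have hfin0 := hγ'.eVariationOn_ne_top le_rfl ht.2
  have hfin1 := hγ'.eVariationOn_ne_top ht.1 le_rfl
  have hlen0 : eVariationOn γ (Icc 0 t) = ENNReal.ofReal (h / 4) := by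
    rw [← hvt, hγ'.arcLength_eq ht.1 ht.2, ENNReal.ofReal_toReal hfin0]
  have hlen1 : ENNReal.ofReal (h / 4) ≤ eVariationOn γ (Icc t 1) := by
    rw [ENNReal.ofReal_le_iff_le_toReal hfin1, ← hγ'.arcLength_sub ht.1 ht.2 le_rfl]
    linarith
  refine ⟨γ t, hγ'.mapsTo ht, ?_, ?_, ?_⟩
  · exact (hγ'.innerLength_le_eVariationOn ht.1 ht.2).trans hlen0.le
  · have := hγ'.dist_le_arcLength_sub le_rfl ht.1 ht.2
    rwa [arcLength_zero, sub_zero, hvt, hγ'.source] at this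
  · have h2 := (le_min hlen0.ge hlen1).trans (hcig t ht)
    have h3 : 0 ≤ c * bdist D (γ t) := mul_nonneg (by linarith) Metric.infDist_nonneg
    rw [ENNReal.ofReal_le_ofReal_iff h3] at h2
    rw [div_le_iff₀ (by linarith)]
    linarith

/-- Along an arc of almost minimal diameter, points are linked when their inner length distance is
at most h, which is twice the inner diameter distance. Pairwise unlinked points have companions far
from the boundary, and these must be separated in the Euclidean sense: otherwise a short segment
between two companions would link the points. Packing bounds their number, hence the number of
links. -/
theorem exists_innerLength_le_innerDiam (n : ℕ) {c : ℝ} (hc : 1 ≤ c) :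
    ∃ C : ℝ, 1 ≤ C ∧ ∀ {D : Set (EuclideanSpace ℝ (Fin n))}, IsProperDomain D →
      IsInnerUniform D c → ∀ x ∈ D, ∀ y ∈ D,
      innerLength D x y ≤ ENNReal.ofReal (C * innerDiam D x y) := by
  obtain ⟨M, hM⟩ := exists_card_le_of_separated_ball (EuclideanSpace ℝ (Fin n)) (20 * c)
  refine ⟨4 * (M + 1), by linarith [Nat.cast_nonneg (α := ℝ) M], fun {D} hD hU x hx y hy => ?_⟩
  rcases eq_or_ne x y with rfl | hxy
  · refine ((Step.refl hD hx).innerLength_le hD).trans ?_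
    simp
  set h := 2 * innerDiam D x y with hh
  have hpos : 0 < innerDiam D x y := (dist_pos.2 hxy).trans_le (dist_le_innerDiam hD hx hy)
  have hhpos : 0 < h := by positivity
  have hc0 : 0 < c := by linarith
  obtain ⟨β, hβ, hdiam⟩ := exists_arc_diam_lt hD hx hy (show innerDiam D x y < h by linarith)
  obtain ⟨m, p, hp, hstep, hpS⟩ := exists_fine_chain hD hβ.continuousOn hβ.mapsTo hhpos
  rw [hβ.source, hβ.target] at hp
  set S := β '' Icc 0 1 with hS
  have hSD : S ⊆ D := hβ.mapsTo.image_subset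
  have hSb : Bornology.IsBounded S := hβ.toIsPathIn.isCompact_image.isBounded
  have hxS : x ∈ S := ⟨0, by simp, hβ.source⟩
  set R : EuclideanSpace ℝ (Fin n) → EuclideanSpace ℝ (Fin n) → Prop :=
    fun u v => u ∈ S ∧ v ∈ S ∧ innerLength D u v ≤ ENNReal.ofReal h with hR
  have hchain : HasChain R m x y := ⟨p, hp.source, hp.target, fun i hi =>
    ⟨hpS i hi.le, hpS _ hi, ((hp.step i hi).innerLength_le hD).trans
      (ENNReal.ofReal_le_ofReal (hstep i hi))⟩⟩
  obtain ⟨k, q, -, hq, hmin⟩ := hchain.exists_minimal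
  have hqS : ∀ l ≤ k, q l ∈ S := by
    intro l hl
    rcases Nat.eq_zero_or_pos l with rfl | h
    · rwa [hq.source]
    · have := (hq.step (l - 1) (by omega)).2.1
      rwa [show l - 1 + 1 = l by omega] at this
  have hk : k ≤ 2 * (M + 1) := by
    refine hq.le_of_card_le hmin fun j f hf hsep => ?_
    -- A single point has no partner at large inner distance, so it gets no companion; hence M + 1
    -- in place of M.
    rcases le_or_gt j 1 with hj | hj
    · omega
    have hfS : ∀ i < j, f i ∈ S := fun i hi => by
      obtain ⟨l, hl, h⟩ := hf i hi
      rw [h]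
      exact hqS l hl
    have hfar : ∀ i < j, ∀ l < j, i < l → ENNReal.ofReal h < innerLength D (f i) (f l) :=
      fun i hi l hl hil => by
        by_contra! hcon
        exact hsep i hi l hl hil ⟨hfS i hi, hfS l hl, hcon⟩
    have hw : ∀ i, ∃ w, i < j → w ∈ D ∧ innerLength D (f i) w ≤ ENNReal.ofReal (h / 4) ∧
        dist (f i) w ≤ h / 4 ∧ h / (4 * c) ≤ bdist D w := by
      intro i
      by_cases hi : i < j
      · obtain ⟨l, hl, hil⟩ : ∃ l < j, ENNReal.ofReal h < innerLength D (f i) (f l) := by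
          rcases Nat.eq_zero_or_pos i with rfl | h0
          · exact ⟨1, hj, hfar 0 hi 1 hj one_pos⟩
          · exact ⟨0, by omega, by
              rw [innerLength_comm]
              exact hfar 0 (by omega) i hi h0⟩
        obtain ⟨w, hw⟩ := hU.exists_bdist_ge hc hhpos (hSD (hfS i hi)) (hSD (hfS l hl)) hil
        exact ⟨w, fun _ => hw⟩
      · exact ⟨x, fun h => absurd h hi⟩
    choose w hw using hw
    -- The companions lie within h + h / 4 = 20c · h / (16c) of x. If two were closer than h /
    -- (16c), a quarter of their lower bound h / (4c) for the boundary distance, they would form a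
    -- step, and the points themselves would be at inner distance at most 3h / 4.
    refine (hM (h / (16 * c)) (by positivity) j w x (fun i hi => ?_) fun i hi l hl hil => ?_).trans
      (Nat.le_succ M)
    · have h1 := (hw i hi).2.2.1
      have h2 := Metric.dist_le_diam_of_mem hSb (hfS i hi) hxS
      have h3 := dist_triangle_left (w i) x (f i)
      have h4 : 20 * c * (h / (16 * c)) = h / 4 + h := by
        field_simp
        ring
      linarith
    · by_contra! hcon
      obtain ⟨hi1, hi2, -, hi4⟩ := hw i hi
      obtain ⟨-, hl2, -, -⟩ := hw l hl
      have h1 : h / (16 * c) = h / (4 * c) / 4 := by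
        field_simp
        ring
      have hs : Step D (w i) (w l) := Step.of_dist_le hD hi1 (by linarith)
      have h2 : dist (w i) (w l) ≤ h / 4 := by
        refine hcon.le.trans ?_
        exact div_le_div_of_nonneg_left hhpos.le (by norm_num) (by linarith)
      have h3 := (hs.innerLength_le hD).trans (ENNReal.ofReal_le_ofReal h2)
      rw [innerLength_comm] at hl2
      have h4 : innerLength D (f i) (f l) ≤ ENNReal.ofReal (h / 4) + ENNReal.ofReal (h / 4) +
          ENNReal.ofReal (h / 4) :=
        (innerLength_triangle (y := w l)).trans
          (add_le_add ((innerLength_triangle (y := w i)).trans (add_le_add hi2 h3)) hl2)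
      rw [← ENNReal.ofReal_add (by positivity) (by positivity),
        ← ENNReal.ofReal_add (by positivity) (by positivity)] at h4
      exact absurd ((hfar i hi l hl hil).trans_le h4)
        (not_lt.2 (ENNReal.ofReal_le_ofReal (by linarith)))
  have hsum : ∀ i ≤ k, innerLength D x (q i) ≤ ENNReal.ofReal (i * h) := by
    intro i
    induction i with
    | zero =>
      intro _
      rw [hq.source]
      simpa using (Step.refl hD hx).innerLength_le hD
    | succ i ih =>
      intro hi
      push_cast
      rw [add_mul, one_mul, ENNReal.ofReal_add (by positivity) hhpos.le]
      exact innerLength_triangle.trans (add_le_add (ih (by omega)) (hq.step i hi).2.2)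
  have := hsum k le_rfl
  rw [hq.target] at this
  refine this.trans (ENNReal.ofReal_le_ofReal ?_)
  have hk' : (k : ℝ) ≤ 2 * (M + 1) := by exact_mod_cast hk
  calc (k : ℝ) * h ≤ 2 * (M + 1) * h := by gcongr
    _ = _ := by rw [hh]; ring

theorem exists_isStronglyInnerUniform_of_isInnerUniform (n : ℕ) {c : ℝ} (hc : 1 ≤ c) :
    ∃ C : ℝ, 1 ≤ C ∧ ∀ {D : Set (EuclideanSpace ℝ (Fin n))}, IsProperDomain D →
      IsInnerUniform D c → IsStronglyInnerUniform D C := by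
  obtain ⟨C, hC, h⟩ := exists_innerLength_le_innerDiam n hc
  refine ⟨c * C, by nlinarith, fun {D} hD hU x hx y hy => ?_⟩
  obtain ⟨γ, hγ, h1, h2⟩ := hU x hx y hy
  refine ⟨γ, hγ, fun t ht => (h1 t ht).trans (ENNReal.ofReal_le_ofReal ?_), h2.trans ?_⟩
  · exact mul_le_mul_of_nonneg_right (by nlinarith) Metric.infDist_nonneg
  · rw [mul_assoc, ENNReal.ofReal_mul (by linarith)]
    gcongr
    exact h hD hU x hx y hy

end InnerLength

/-- Each of the four conditions bounds the lengths of chains. -/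
theorem exists_chainBound (n : ℕ) {P : Set (EuclideanSpace ℝ (Fin n)) → ℝ → Prop}
    (hP : P ∈ ({IsInnerUniform, QuasihyperbolicLeJPrime, ApollonianInnerLeJPrime,
      IsDiamInnerUniform} : Set (Set (EuclideanSpace ℝ (Fin n)) → ℝ → Prop))) {c : ℝ}
    (hc : 1 ≤ c) :
    ∃ A : ℝ, 1 ≤ A ∧ ∀ D : Set (EuclideanSpace ℝ (Fin n)), IsProperDomain D → P D c →
      ChainBound D A := by
  simp only [mem_insert_iff, mem_singleton_iff] at hP
  rcases hP with rfl | rfl | rfl | rfl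
  · obtain ⟨C, hC, h⟩ := exists_isStronglyInnerUniform_of_isInnerUniform n hc
    obtain ⟨A, hA, h'⟩ := exists_chainBound_of_isDiamInnerUniform n hC
    exact ⟨A, hA, fun D hD hU => h' hD ((h hD hU).isDiamInnerUniform (by linarith))⟩
  · obtain ⟨A, hA, h⟩ := exists_chainBound_of_quasihyperbolicLeJPrime (c := c) (by linarith)
    exact ⟨A, hA, fun D => h⟩
  · obtain ⟨A, hA, h⟩ := exists_chainBound_of_apollonianInnerLeJPrime n (c := c) (by linarith)
    exact ⟨A, hA, fun D => h⟩
  · obtain ⟨A, hA, h⟩ := exists_chainBound_of_isDiamInnerUniform n hc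
    exact ⟨A, hA, fun D => h⟩

/-- A bound for the lengths of chains implies each of the four conditions. -/
theorem exists_of_chainBound (n : ℕ) {Q : Set (EuclideanSpace ℝ (Fin n)) → ℝ → Prop}
    (hQ : Q ∈ ({IsInnerUniform, QuasihyperbolicLeJPrime, ApollonianInnerLeJPrime,
      IsDiamInnerUniform} : Set (Set (EuclideanSpace ℝ (Fin n)) → ℝ → Prop))) {A : ℝ}
    (hA : 1 ≤ A) :
    ∃ c : ℝ, 1 < c ∧ ∀ D : Set (EuclideanSpace ℝ (Fin n)), IsProperDomain D → ChainBound D A →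
      Q D c := by
  obtain ⟨C, hC, h⟩ := ChainBound.exists_isStronglyInnerUniform hA
  simp only [mem_insert_iff, mem_singleton_iff] at hQ
  rcases hQ with rfl | rfl | rfl | rfl
  -- C may equal 1, whereas the final constant has to exceed 1.
  · exact ⟨C + 1, by linarith, fun D hD hc =>
      ((h hD hc).mono (by linarith)).isInnerUniform hD (by linarith)⟩
  · exact ⟨4 * A, by linarith, fun D hD hc => hc.quasihyperbolicLeJPrime hD hA⟩
  · exact ⟨8 * A, by linarith, fun D hD hc => hc.apollonianInnerLeJPrime hD hA⟩
  · exact ⟨C + 1, by linarith, fun D hD hc =>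
      ((h hD hc).mono (by linarith)).isDiamInnerUniform (by linarith)⟩

end InnerUniform

theorem theorem1p1 (n : ℕ) (hn : 2 ≤ n) :
    ∀ P ∈ ({IsInnerUniform, QuasihyperbolicLeJPrime, ApollonianInnerLeJPrime,
        IsDiamInnerUniform} : Set (Set (EuclideanSpace ℝ (Fin n)) → ℝ → Prop)),
    ∀ Q ∈ ({IsInnerUniform, QuasihyperbolicLeJPrime, ApollonianInnerLeJPrime,
        IsDiamInnerUniform} : Set (Set (EuclideanSpace ℝ (Fin n)) → ℝ → Prop)),
    ∀ c : ℝ, 1 < c → ∃ c' : ℝ, 1 < c' ∧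
      ∀ D : Set (EuclideanSpace ℝ (Fin n)), IsProperDomain D → IsApollonian D →
        P D c → Q D c' := by
  intro P hP Q hQ c hc
  obtain ⟨A, hA, h⟩ := exists_chainBound n hP hc.le
  obtain ⟨c', hc', h'⟩ := exists_of_chainBound n hQ hA
  exact ⟨c', hc', fun D hD _ hPD => h' D hD (h D hD hPD)⟩
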